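/- Let $n\ge 1$. A piecewise flat simplicial $n$-complex is a finite simplicial complex each of whose simplices carries the metric of a nondegenerate Euclidean simplex (of dimension at most $n$), such that the inclusion of each face is an isometry; $\mathrm{vol}_k$ denotes the $k$-dimensional volume for this metric. A PL Morse function on a simplicial complex $L$ is a function $f:L\to\mathbb R$ which is linear on every simplex of $L$ and takes pairwise distinct values at the vertices of $L$. For a piecewise flat simplicial $n$-complex $X$, its $(n-1)$-volume width is \[ \mathcal W_{n-1}(X)=\inf_f\ \sup_{t\in\mathbb R}\ \mathrm{vol}_{n-1}\bigl(f^{-1}(t)\bigr), \] where $f$ runs over all PL Morse functions on finite simplicial subdivisions of $X$. Proposition. Let $D$ be a piecewise flat simplicial $n$-complex homeomorphic to a compact $n$-manifold with (possibly empty) boundary. Let $S$ be a simplicial $(n-1)$-chain of $D$ (with coefficients modulo $2$, i.e. a finite set of $(n-1)$-simplices of $D$) with boundary lying in $\partial D$, which decomposes $D$ into two $n$-dimensional simplicial subcomplexes $D_1$ and $D_2$; that is, every simplex of $D_i$ is a face of an $n$-simplex of $D_i$, $D=D_1\cup D_2$, and $D_1\cap D_2$ is the union of the simplices of $S$. Then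 \[ \mathcal W_{n-1}(D)\ \le\ \max\{\mathcal W_{n-1}(D_1),\mathcal W_{n-1}(D_2)\}+2n\,\mathrm{vol}_{n-1}(S). \] -/

import Mathlib

open MeasureTheory Geometry
open scoped ENNReal

namespace PLWidth

variable {E : Type*} [AddCommGroup E] [Module ℝ E]

/-- A piecewise flat structure on a simplicial complex `K` of dimension at most `n`: every simplex
is identified, by an affine map, with a nondegenerate Euclidean simplex in `ℝⁿ`, in such a way that
the inclusion of a face into a simplex is an isometry (for affine maps it is enough that distances
between vertices agree). The ambient vector space of `K` only carries the affine structure of the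
simplices; no metric is taken from it. The values of `chart s` outside the simplex spanned by `s`,
and for `s` not a face of `K`, are irrelevant. -/
structure FlatStructure (n : ℕ) (K : SimplicialComplex ℝ E) where
  chart : Finset E → E →ᵃ[ℝ] EuclideanSpace ℝ (Fin n)
  affineIndependent_chart : ∀ s ∈ K.faces, AffineIndependent ℝ (fun v : s => chart s (v : E))
  dist_chart : ∀ s ∈ K.faces, ∀ t ∈ K.faces, s ⊆ t → ∀ x ∈ s, ∀ y ∈ s,
    dist (chart s x) (chart s y) = dist (chart t x) (chart t y)

/-- The open simplex with vertex set `s`: the closed simplex minus all its proper faces. -/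
def openSimplex (s : Finset E) : Set E :=
  convexHull ℝ (s : Set E) \ ⋃ t ∈ {t : Finset E | t ⊂ s}, convexHull ℝ (t : Set E)

/-- The polyhedron of a simplicial complex is the disjoint union of its open simplices, each of
which is isometrically charted in `ℝⁿ`. The `k`-volume of a subset `A` is the sum of the
`k`-dimensional Hausdorff measures (normalised to agree with Lebesgue measure) of its pieces in the
open simplices. -/
noncomputable def FlatStructure.vol {n : ℕ} {K : SimplicialComplex ℝ E} (F : FlatStructure n K)
    (k : ℕ) (A : Set E) : ℝ≥0∞ :=
  ∑' s : K.faces, μHE[k] (F.chart s '' (A ∩ openSimplex (s : Finset E)))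

/-- The piecewise flat structure induced on a subcomplex. -/
def FlatStructure.restrict {n : ℕ} {K L : SimplicialComplex ℝ E} (F : FlatStructure n K)
    (h : L ≤ K) : FlatStructure n L where
  chart := F.chart
  affineIndependent_chart s hs := F.affineIndependent_chart s (h hs)
  dist_chart s hs t ht := F.dist_chart s (h hs) t (h ht)

/-- `L` is a (finite) simplicial subdivision of `K`. -/
structure IsSubdivision (L K : SimplicialComplex ℝ E) : Prop where
  finite : L.faces.Finite
  space_eq : L.space = K.space
  subset : ∀ s ∈ L.faces, ∃ t ∈ K.faces,
    convexHull ℝ (s : Set E) ⊆ convexHull ℝ (t : Set E)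

/-- `f` is a PL Morse function on `L`: it is linear on every simplex and takes pairwise distinct
values at the vertices. Only the values of `f` on the polyhedron of `L` matter. -/
structure IsPLMorse (L : SimplicialComplex ℝ E) (f : E → ℝ) : Prop where
  linear : ∀ s ∈ L.faces, ∃ g : E →ᵃ[ℝ] ℝ, Set.EqOn f g (convexHull ℝ (s : Set E))
  injOn : Set.InjOn f L.vertices

/-- The `(n-1)`-volume width of a function on a piecewise flat complex: the supremum of the
`(n-1)`-volumes of its level sets. -/
noncomputable def FlatStructure.levelWidth {n : ℕ} {K : SimplicialComplex ℝ E}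
    (F : FlatStructure n K) (f : E → ℝ) : ℝ≥0∞ :=
  ⨆ t : ℝ, F.vol (n - 1) {x ∈ K.space | f x = t}

/-- The `(n-1)`-volume width of a piecewise flat complex: the infimum of the widths of the
PL Morse functions on simplicial subdivisions of it. -/
noncomputable def FlatStructure.width {n : ℕ} {K : SimplicialComplex ℝ E}
    (F : FlatStructure n K) : ℝ≥0∞ :=
  ⨅ (L : SimplicialComplex ℝ E) (_ : IsSubdivision L K) (f : E → ℝ) (_ : IsPLMorse L f),
    F.levelWidth f

/-- The simplices of the boundary of a triangulated `n`-manifold: the faces of the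
`(n-1)`-simplices which lie in exactly one `n`-simplex. -/
def boundaryFaces (n : ℕ) (K : SimplicialComplex ℝ E) : Set (Finset E) :=
  {ρ ∈ K.faces | ∃ τ ∈ K.faces, ρ ⊆ τ ∧ τ.card = n ∧
    ∃! σ : Finset E, σ ∈ K.faces ∧ σ.card = n + 1 ∧ τ ⊆ σ}

/-- A simplicial `(n-1)`-chain (with coefficients modulo 2) is given by its finite set `S` of
`(n-1)`-simplices. Its boundary consists of the `(n-2)`-simplices which are faces of an odd number
of simplices of `S`. -/
def chainBoundary (n : ℕ) (S : Finset (Finset E)) : Set (Finset E) :=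
  {ρ | ρ.Nonempty ∧ ρ.card + 1 = n ∧ Odd {τ : Finset E | τ ∈ S ∧ ρ ⊆ τ}.ncard}

/-- Every simplex of `K` is a face of an `n`-simplex of `K`. -/
def IsPure (n : ℕ) (K : SimplicialComplex ℝ E) : Prop :=
  ∀ s ∈ K.faces, ∃ t ∈ K.faces, s ⊆ t ∧ t.card = n + 1

/-- The `(n-1)`-chain `S` of `D`, with boundary lying in `∂D`, decomposes `D` into the two
`n`-dimensional subcomplexes `D₁` and `D₂`: they cover `D` and meet exactly along `S`. -/
structure Decomposes (n : ℕ) (D D₁ D₂ : SimplicialComplex ℝ E) (S : Finset (Finset E)) :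
    Prop where
  isChain : ∀ τ ∈ S, τ ∈ D.faces ∧ τ.card = n
  boundary_subset : chainBoundary n S ⊆ boundaryFaces n D
  left_le : D₁ ≤ D
  right_le : D₂ ≤ D
  left_pure : IsPure n D₁
  right_pure : IsPure n D₂
  cover : ∀ s ∈ D.faces, s ∈ D₁.faces ∨ s ∈ D₂.faces
  inter : ∀ s ∈ D.faces, (s ∈ D₁.faces ∧ s ∈ D₂.faces) ↔ ∃ τ ∈ S, s ⊆ τ

/-- The `(n-1)`-volume of an `(n-1)`-chain: the sum of the volumes of its simplices. -/
noncomputable def FlatStructure.chainVol {n : ℕ} {K : SimplicialComplex ℝ E}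
    (F : FlatStructure n K) (S : Finset (Finset E)) : ℝ≥0∞ :=
  ∑ τ ∈ S, F.vol (n - 1) (convexHull ℝ (τ : Set E))

end PLWidth

/-! Take nearly optimal functions `f₁` and `f₂` on the two halves and refine both subdivisions to
parts of one subdivision `L` of `D` in which `D₁` is full: a simplex of `L` with all vertices in
`D₁` lies in `D₁`. A small perturbation (`IsPLMorse.exists_perturbation`) makes the values at the
new vertices distinct and changes the volumes of the level sets by little. Let `B` bound both
functions at the vertices.

Extend `f₁` to a function `u` on `D` by the value `M` at every vertex outside `D₁`, and extend `3 *
B + 1 + f₂` to a function `v`. The glued function is `min u v`. On `D₁` it is `f₁`, with values at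
most `B`; elsewhere it is either the raised `f₂`, with values at least `2 * B + 1`, or `u`. A level
set therefore consists of a level set of only one of the two functions, together with slices `u = c`
of simplices `t` not in `D₁`. This is why a maximum appears rather than a sum.

As `M` grows, these slices lie ever closer to the face of `t` spanned by its vertices in `D₁`. A
section of a thin neighbourhood of a compact piece of a hyperplane has almost no more volume than
the piece, whatever the direction of the section (`exists_thin`), so each slice costs at most the
volume of that face plus a small error. Faces with fewer than `n` vertices cost nothing, and those
with `n` vertices lie in simplices of `S`. Each is a face of at most two `n`-simplices of `L`,
because the polyhedron is a manifold (`card_cofaces_le_two`, by invariance of domain). The total is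
at most `2 * chainVol S`, and `2 ≤ 2 * n`.

The minimum is affine on the simplices once `L` is cut along `u = v`. For large `M` its values at
the vertices are distinct, since the value at a new vertex is close to that of the end of its edge
in `D₁ ∩ D₂` (`Gluing.eventually_isPLMorse`). -/

namespace PLWidth

/-! ### Barycentric coordinates and affine independence. -/

section Bary

variable {E : Type*} [AddCommGroup E] [Module ℝ E] {V : Type*} [AddCommGroup V] [Module ℝ V]

/-- `w` is a system of barycentric coordinates of `x`, supported on `s`. -/
structure IsBary (s : Finset E) (w : E → ℝ) (x : E) : Prop where
  nonneg : ∀ v, 0 ≤ w v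
  off : ∀ v, v ∉ s → w v = 0
  sum_eq : ∑ v ∈ s, w v = 1
  comb : ∑ v ∈ s, w v • v = x

variable {s t : Finset E} {w w' : E → ℝ} {x : E}

theorem mem_convexHull_iff_isBary : x ∈ convexHull ℝ (s : Set E) ↔ ∃ w, IsBary s w x := by
  classical
  rw [Finset.mem_convexHull']
  constructor
  · rintro ⟨w, h0, h1, h2⟩
    refine ⟨fun v => if v ∈ s then w v else 0, fun v => ?_, fun v hv => by simp [hv], ?_, ?_⟩
    · by_cases hv : v ∈ s <;> simp [hv, h0]
    · rw [← h1]; exact Finset.sum_congr rfl fun v hv => by simp [hv]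
    · rw [← h2]; exact Finset.sum_congr rfl fun v hv => by simp [hv]
  · rintro ⟨w, h⟩
    exact ⟨w, fun v _ => h.nonneg v, h.sum_eq, h.comb⟩

theorem IsBary.mem_convexHull (h : IsBary s w x) : x ∈ convexHull ℝ (s : Set E) :=
  mem_convexHull_iff_isBary.2 ⟨w, h⟩

theorem IsBary.sum_smul_eq (h : IsBary s w x) (ht : ∀ v, v ∉ t → w v = 0) (g : E → V) :
    ∑ v ∈ t, w v • g v = ∑ v ∈ s, w v • g v := by
  classical
  have h1 : ∑ v ∈ t, w v • g v = ∑ v ∈ s ∪ t, w v • g v :=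
    Finset.sum_subset Finset.subset_union_right fun v _ hv => by rw [ht v hv, zero_smul]
  have h2 : ∑ v ∈ s, w v • g v = ∑ v ∈ s ∪ t, w v • g v :=
    Finset.sum_subset Finset.subset_union_left fun v _ hv => by rw [h.off v hv, zero_smul]
  rw [h1, h2]

theorem IsBary.of_support (h : IsBary s w x) (ht : ∀ v, v ∉ t → w v = 0) : IsBary t w x where
  nonneg := h.nonneg
  off := ht
  sum_eq := by simpa using (h.sum_smul_eq ht fun _ => (1 : ℝ)).trans (by simpa using h.sum_eq)
  comb := (h.sum_smul_eq ht id).trans h.comb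

theorem IsBary.mono (h : IsBary s w x) (hst : s ⊆ t) : IsBary t w x :=
  h.of_support fun v hv => h.off v fun hs => hv (hst hs)

theorem isBary_single [DecidableEq E] (hx : x ∈ s) : IsBary s (fun v => if v = x then 1 else 0) x where
  nonneg v := by split_ifs <;> norm_num
  off v hv := if_neg fun (h : v = x) => hv (h ▸ hx)
  sum_eq := by simp [hx]
  comb := by simp [hx]

theorem IsBary.map_affine (h : IsBary s w x) (f : E →ᵃ[ℝ] V) : f x = ∑ v ∈ s, w v • f v := by
  have hf : ∀ y, f y = f.linear y + f 0 := fun y => congrFun f.decomp y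
  have h1 : ∑ v ∈ s, w v • f v = ∑ v ∈ s, w v • f.linear v + ∑ v ∈ s, w v • f 0 := by
    rw [← Finset.sum_add_distrib]
    exact Finset.sum_congr rfl fun v _ => by rw [← smul_add, ← hf v]
  rw [h1, ← Finset.sum_smul, h.sum_eq, one_smul, hf x]
  conv_lhs => rw [← h.comb, map_sum]
  simp_rw [map_smul]

theorem IsBary.convex_comb {ι : Type*} {T : Finset ι} {c : ι → ℝ} {W : ι → E → ℝ} {X : ι → E}
    (hc : ∀ i ∈ T, 0 ≤ c i) (hc1 : ∑ i ∈ T, c i = 1) (h : ∀ i ∈ T, IsBary s (W i) (X i)) :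
    IsBary s (fun v => ∑ i ∈ T, c i * W i v) (∑ i ∈ T, c i • X i) where
  nonneg v := Finset.sum_nonneg fun i hi => mul_nonneg (hc i hi) ((h i hi).nonneg v)
  off v hv := Finset.sum_eq_zero fun i hi => by rw [(h i hi).off v hv, mul_zero]
  sum_eq := by
    rw [Finset.sum_comm, ← hc1]
    exact Finset.sum_congr rfl fun i hi => by rw [← Finset.mul_sum, (h i hi).sum_eq, mul_one]
  comb := by
    simp_rw [Finset.sum_smul]
    rw [Finset.sum_comm]
    refine Finset.sum_congr rfl fun i hi => ?_
    rw [← (h i hi).comb, Finset.smul_sum]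
    exact Finset.sum_congr rfl fun v _ => mul_smul _ _ _

omit [AddCommGroup E] [Module ℝ E] in
/-- If nonnegative normalised weights are determined by the corresponding convex combination, then
the points are affinely independent. -/
theorem affineIndependent_of_unique_weights {p : E → V}
    (h : ∀ w w' : E → ℝ, (∀ v, 0 ≤ w v) → (∀ v, 0 ≤ w' v) → (∀ v, v ∉ s → w v = 0) →
      (∀ v, v ∉ s → w' v = 0) → ∑ v ∈ s, w v = 1 → ∑ v ∈ s, w' v = 1 →
      ∑ v ∈ s, w v • p v = ∑ v ∈ s, w' v • p v → w = w') :
    AffineIndependent ℝ (fun v : s => p v) := by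
  classical
  rw [affineIndependent_iff_of_fintype]
  intro z hz hzp i
  rw [Finset.weightedVSub_eq_linear_combination _ hz] at hzp
  set N : ℝ := ∑ v : s, |z v| with hN
  have hN0 : 0 ≤ N := Finset.sum_nonneg fun _ _ => abs_nonneg _
  have hzN : ∀ v : s, |z v| ≤ N := fun v =>
    Finset.single_le_sum (f := fun v => |z v|) (fun _ _ => abs_nonneg _) (Finset.mem_univ v)
  have hc : (0 : ℝ) < s.card := by
    exact Nat.cast_pos.2 (Finset.card_pos.2 ⟨_, i.2⟩)
  -- The affine dependency `z`, scaled by `e`, is added to the uniform weights. The size of `e`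
  -- keeps the result nonnegative, and uniqueness then forces `e * z i = 0`.
  let w : E → ℝ := fun v => if v ∈ s then 1 / s.card else 0
  let e : ℝ := 1 / (s.card * (N + 1))
  have he : 0 < e := by positivity
  let w' : E → ℝ := fun v => if hv : v ∈ s then 1 / s.card + e * z ⟨v, hv⟩ else 0
  have hw1 : ∑ v ∈ s, w v = 1 := by
    rw [Finset.sum_congr rfl (fun v hv => if_pos hv)]
    simp [hc.ne']
  have hs : ∀ g : s → ℝ,
      ∑ v ∈ s, (if hv : v ∈ s then g ⟨v, hv⟩ else 0) = ∑ v : s, g v := by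
    intro g
    rw [← Finset.sum_coe_sort]
    exact Finset.sum_congr rfl fun v _ => by simp
  have hs' : ∀ g : s → V,
      ∑ v ∈ s, (if hv : v ∈ s then g ⟨v, hv⟩ else 0) = ∑ v : s, g v := by
    intro g
    rw [← Finset.sum_coe_sort]
    exact Finset.sum_congr rfl fun v _ => by simp
  have key : w = w' := by
    refine h w w' (fun v => ?_) (fun v => ?_) (fun v hv => if_neg hv) (fun v hv => dif_neg hv)
      hw1 ?_ ?_
    · by_cases hv : v ∈ s <;> simp [w, hv]
    · by_cases hv : v ∈ s
      · simp only [w', hv, dite_true]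
        have h1 := (abs_le.1 (hzN ⟨v, hv⟩)).1
        have h2 : e * N ≤ 1 / s.card := by
          simp only [e]
          rw [one_div_mul_eq_div, div_le_div_iff₀ (by positivity) hc]
          nlinarith
        nlinarith
      · simp [w', hv]
    · simp only [w']
      rw [hs (fun v => 1 / (s.card : ℝ) + e * z v), Finset.sum_add_distrib, ← Finset.mul_sum, hz]
      simp [hc.ne']
    · have h1 : ∑ v ∈ s, w' v • p v =
          ∑ v ∈ s, (if hv : v ∈ s then (1 / (s.card : ℝ) + e * z ⟨v, hv⟩) • p v else 0) :=
        Finset.sum_congr rfl fun v hv => by simp [w', hv]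
      have h2 : ∑ v ∈ s, w v • p v =
          ∑ v ∈ s, (if hv : v ∈ s then (1 / (s.card : ℝ)) • p v else 0) :=
        Finset.sum_congr rfl fun v hv => by simp [w, hv]
      rw [h1, h2, hs' fun v => (1 / (s.card : ℝ) + e * z v) • p v,
        hs' fun v => (1 / (s.card : ℝ)) • p v]
      simp_rw [add_smul, Finset.sum_add_distrib, mul_smul, ← Finset.smul_sum, hzp]
      simp
  have := congrFun key i
  simp only [w, w', i.2, if_true, dite_true] at this
  have h3 : e * z i = 0 := by linarith
  exact (mul_eq_zero.1 h3).resolve_left he.ne'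

theorem affineIndependent_of_unique
    (h : ∀ w w' x, IsBary s w x → IsBary s w' x → w = w') :
    AffineIndependent ℝ (fun v : s => (v : E)) :=
  affineIndependent_of_unique_weights (p := id) fun w w' h1 h2 h3 h4 h5 h6 h7 =>
    h w w' _ ⟨h1, h3, h5, h7⟩ ⟨h2, h4, h6, rfl⟩

-- The difference of the two weights is an affine dependency. Nonnegativity plays no role in this
-- direction.
omit [AddCommGroup E] [Module ℝ E] in
theorem weights_unique {p : E → V} (hs : AffineIndependent ℝ (fun v : s => p v))
    (h1 : ∀ v, v ∉ s → w v = 0) (h2 : ∀ v, v ∉ s → w' v = 0)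
    (h3 : ∑ v ∈ s, w v = ∑ v ∈ s, w' v) (h4 : ∑ v ∈ s, w v • p v = ∑ v ∈ s, w' v • p v) :
    w = w' := by
  rw [affineIndependent_iff_of_fintype] at hs
  have hz : ∑ v : s, (w v - w' v) = 0 := by
    rw [Finset.sum_coe_sort s fun v => w v - w' v, Finset.sum_sub_distrib, h3, sub_self]
  have := hs (fun v => w v - w' v) hz (by
    rw [Finset.weightedVSub_eq_linear_combination _ hz]
    rw [Finset.sum_coe_sort s fun v => (w v - w' v) • p v]
    simp_rw [sub_smul]
    rw [Finset.sum_sub_distrib, h4, sub_self])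
  funext v
  by_cases hv : v ∈ s
  · exact sub_eq_zero.1 (this ⟨v, hv⟩)
  · rw [h1 v hv, h2 v hv]

theorem IsBary.unique (hs : AffineIndependent ℝ (fun v : s => (v : E))) (h : IsBary s w x)
    (h' : IsBary s w' x) : w = w' :=
  weights_unique (p := id) hs h.off h'.off (h.sum_eq.trans h'.sum_eq.symm)
    (h.comb.trans h'.comb.symm)

theorem IsBary.exists_pos (h : IsBary s w x) : ∃ v ∈ s, 0 < w v := by
  by_contra! hc
  have : ∑ v ∈ s, w v ≤ 0 := Finset.sum_nonpos hc
  linarith [h.sum_eq]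

/-- A zero weight puts the point on the opposite face; conversely a point of a proper face has, by
uniqueness, weight zero at the missing vertices. -/
theorem mem_openSimplex_iff (hs : AffineIndependent ℝ (fun v : s => (v : E)))
    (h : IsBary s w x) : x ∈ openSimplex s ↔ ∀ v ∈ s, 0 < w v := by
  classical
  simp only [openSimplex, Set.mem_sdiff, h.mem_convexHull, true_and, Set.mem_iUnion, not_exists,
    Set.mem_ofPred_eq]
  constructor
  · intro hx v hv
    refine lt_of_le_of_ne (h.nonneg v) fun h0 => ?_
    refine hx (s.erase v) (Finset.erase_ssubset hv) (h.of_support fun u hu => ?_).mem_convexHull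
    by_cases huv : u = v
    · rw [huv, ← h0]
    · exact h.off u fun hus => hu (Finset.mem_erase.2 ⟨huv, hus⟩)
  · intro hp t hts hx
    obtain ⟨w', h'⟩ := mem_convexHull_iff_isBary.1 hx
    obtain ⟨v, hvs, hvt⟩ := Finset.exists_of_ssubset hts
    have := congrFun (h.unique hs (h'.mono hts.1)) v
    rw [h'.off v hvt] at this
    exact (hp v hvs).ne' this

omit [AddCommGroup E] [Module ℝ E] in
/-- Values at affinely independent points extend to an affine map. -/
theorem exists_affineMap {p : E → V} {W : Type*} [AddCommGroup W] [Module ℝ W]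
    (hs : AffineIndependent ℝ (fun v : s => p v)) (g : E → W) :
    ∃ A : V →ᵃ[ℝ] W, ∀ v ∈ s, A (p v) = g v := by
  classical
  rcases s.eq_empty_or_nonempty with rfl | ⟨a, ha⟩
  · exact ⟨AffineMap.const ℝ V 0, by simp⟩
  have hl := (affineIndependent_iff_linearIndependent_vsub ℝ _ (⟨a, ha⟩ : s)).1 hs
  -- The differences from `a` form a basis of their span; a linear map given there extends to all of
  -- `V`, of any dimension.
  obtain ⟨f, hf⟩ := ((Module.Basis.span hl).constr ℝ
    fun v => g ((v : s) : E) - g a).exists_extend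
  refine ⟨(f.toAffineMap.comp (AffineMap.id ℝ V - AffineMap.const ℝ V (p a))) +
    AffineMap.const ℝ V (g a), fun v hv => ?_⟩
  by_cases hva : v = a
  · simp [hva]
  · have h1 := LinearMap.congr_fun hf (Module.Basis.span hl ⟨⟨v, hv⟩, by simpa using hva⟩)
    rw [Module.Basis.constr_basis, LinearMap.comp_apply, Submodule.subtype_apply,
      Module.Basis.span_apply] at h1
    have h2 : f (p v) - f (p a) = g v - g a := by simpa using h1
    simp [h2]

end Bary

/-! ### Coordinates on a polyhedron and functions affine on faces. -/

section Complex

variable {E : Type*} [AddCommGroup E] [Module ℝ E] {V : Type*} [AddCommGroup V] [Module ℝ V]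
  {s t : Finset E} {w w' : E → ℝ} {x : E}

/-- A family of finite sets with barycentric coordinates unique across the whole family is a
simplicial complex. -/
def complexOfUnique (faces : Set (Finset E)) (hne : ∀ s ∈ faces, s.Nonempty)
    (hdown : ∀ s ∈ faces, ∀ t ⊆ s, t.Nonempty → t ∈ faces)
    (h : ∀ s ∈ faces, ∀ t ∈ faces, ∀ w w' x, IsBary s w x → IsBary t w' x → w = w') :
    SimplicialComplex ℝ E where
  faces := faces
  isRelLowerSet_faces s hs := ⟨hne s hs, fun t hts ht => hdown s hs t hts ht⟩
  indep hs := affineIndependent_of_unique (h _ hs _ hs)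
  inter_subset_convexHull {s t} hs ht := by
    classical
    rintro x ⟨hxs, hxt⟩
    obtain ⟨w, hw⟩ := mem_convexHull_iff_isBary.1 hxs
    obtain ⟨w', hw'⟩ := mem_convexHull_iff_isBary.1 hxt
    obtain rfl := h s hs t ht w w' x hw hw'
    rw [← Finset.coe_inter]
    refine (hw.of_support fun v hv => ?_).mem_convexHull
    rw [Finset.mem_inter, not_and_or] at hv
    exact hv.elim (hw.off v) (hw'.off v)

variable (K : SimplicialComplex ℝ E)

-- Weights are functions on all of `E` that vanish off their face, so those of different faces can
-- be compared. A common point lies in the hull of the common vertices, and its weights there serve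
-- for both faces. Hence `coord` depends on the point alone.
variable {K} in
theorem isBary_unique (hs : s ∈ K.faces) (ht : t ∈ K.faces) (h : IsBary s w x)
    (h' : IsBary t w' x) : w = w' := by
  classical
  have hx := K.inter_subset_convexHull hs ht ⟨h.mem_convexHull, h'.mem_convexHull⟩
  rw [← Finset.coe_inter] at hx
  obtain ⟨u, hu⟩ := mem_convexHull_iff_isBary.1 hx
  rw [h.unique (K.indep hs) (hu.mono Finset.inter_subset_left),
    h'.unique (K.indep ht) (hu.mono Finset.inter_subset_right)]

open Classical in
/-- The barycentric coordinates of a point of the polyhedron of a complex. -/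
noncomputable def coord (x : E) : E → ℝ :=
  if h : ∃ w, ∃ s ∈ K.faces, IsBary s w x then h.choose else 0

variable {K}

theorem coord_eq (hs : s ∈ K.faces) (h : IsBary s w x) : coord K x = w := by
  have hex : ∃ w, ∃ s ∈ K.faces, IsBary s w x := ⟨w, s, hs, h⟩
  rw [coord, dif_pos hex]
  obtain ⟨t, ht, h'⟩ := hex.choose_spec
  exact isBary_unique ht hs h' h

theorem isBary_coord (hs : s ∈ K.faces) (hx : x ∈ convexHull ℝ (s : Set E)) :
    IsBary s (coord K x) x := by
  obtain ⟨w, h⟩ := mem_convexHull_iff_isBary.1 hx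
  rwa [coord_eq hs h]

theorem coord_nonneg (K : SimplicialComplex ℝ E) (x v : E) : 0 ≤ coord K x v := by
  by_cases hex : ∃ w, ∃ s ∈ K.faces, IsBary s w x
  · obtain ⟨w, s, hs, h⟩ := hex
    rw [coord_eq hs h]
    exact h.nonneg v
  · rw [coord, dif_neg hex]; rfl

theorem mem_convexHull_iff_coord (hs : s ∈ K.faces) (hx : x ∈ K.space) :
    x ∈ convexHull ℝ (s : Set E) ↔ ∀ v, v ∉ s → coord K x v = 0 := by
  refine ⟨fun h => (isBary_coord hs h).off, fun h => ?_⟩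
  obtain ⟨t, ht, hxt⟩ := SimplicialComplex.mem_space_iff.1 hx
  exact ((isBary_coord ht hxt).of_support h).mem_convexHull

/-- Every point of the polyhedron lies in the relative interior of a face. -/
theorem exists_carrier (hx : x ∈ K.space) :
    ∃ s ∈ K.faces, IsBary s (coord K x) x ∧ ∀ v, v ∈ s ↔ 0 < coord K x v := by
  classical
  obtain ⟨t, ht, hxt⟩ := SimplicialComplex.mem_space_iff.1 hx
  have h := isBary_coord ht hxt
  have hmem : ∀ v, v ∈ t.filter (fun v => 0 < coord K x v) ↔ 0 < coord K x v := fun v => by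
    rw [Finset.mem_filter, and_iff_right_iff_imp]
    exact fun hv => by_contra fun hvt => hv.ne' (h.off v hvt)
  have hb : IsBary (t.filter fun v => 0 < coord K x v) (coord K x) x :=
    h.of_support fun v hv => le_antisymm (not_lt.1 fun h' => hv ((hmem v).2 h')) (h.nonneg v)
  refine ⟨_, K.down_closed ht (Finset.filter_subset _ _) ?_, hb, hmem⟩
  obtain ⟨v, hv, _⟩ := hb.exists_pos
  exact ⟨v, hv⟩

theorem mem_openSimplex_iff_coord (hs : s ∈ K.faces) (hx : x ∈ K.space) :
    x ∈ openSimplex s ↔ ∀ v, v ∈ s ↔ 0 < coord K x v := by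
  constructor
  · intro h
    have hb := isBary_coord hs h.1
    refine fun v => ⟨fun hv => (mem_openSimplex_iff (K.indep hs) hb).1 h v hv, fun hv => ?_⟩
    exact by_contra fun hvs => hv.ne' (hb.off v hvs)
  · intro h
    have hxs := (mem_convexHull_iff_coord hs hx).2 fun v hv =>
      le_antisymm (not_lt.1 fun h' => hv ((h v).2 h')) (coord_nonneg K x v)
    exact (mem_openSimplex_iff (K.indep hs) (isBary_coord hs hxs)).2 fun v hv => (h v).1 hv

theorem coord_vertex [DecidableEq E] (hs : s ∈ K.faces) (hx : x ∈ s) (v : E) :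
    coord K x v = if v = x then 1 else 0 := by
  rw [coord_eq hs (isBary_single hx)]

/-- The function which is affine on every face and has prescribed values at the vertices. -/
noncomputable def interp (K : SimplicialComplex ℝ E) (g : E → V) (x : E) : V :=
  ∑ᶠ v, coord K x v • g v

theorem interp_eq (g : E → V) (hs : s ∈ K.faces) (hx : x ∈ convexHull ℝ (s : Set E)) :
    interp K g x = ∑ v ∈ s, coord K x v • g v := by
  refine finsum_eq_sum_of_support_subset _ fun v hv => ?_
  by_contra hvs
  exact hv (by simp [(isBary_coord hs hx).off v hvs])

theorem interp_vertex (g : E → V) (hs : s ∈ K.faces) (hx : x ∈ s) : interp K g x = g x := by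
  classical
  rw [interp_eq g hs (subset_convexHull ℝ _ hx)]
  simp_rw [coord_vertex hs hx]
  simp [hx]

theorem exists_affineMap_interp (g : E → V) (hs : s ∈ K.faces) :
    ∃ A : E →ᵃ[ℝ] V, (∀ v ∈ s, A v = g v) ∧
      Set.EqOn (interp K g) A (convexHull ℝ (s : Set E)) := by
  obtain ⟨A, hA⟩ := exists_affineMap (p := id) (K.indep hs) g
  refine ⟨A, hA, fun x hx => ?_⟩
  rw [interp_eq g hs hx, (isBary_coord hs hx).map_affine A]
  exact Finset.sum_congr rfl fun v hv => by rw [← hA v hv]; rfl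

/-- A function is affine on every face of a complex. -/
def LinearOnFaces (K : SimplicialComplex ℝ E) (f : E → V) : Prop :=
  ∀ s ∈ K.faces, ∃ g : E →ᵃ[ℝ] V, Set.EqOn f g (convexHull ℝ (s : Set E))

theorem linearOnFaces_interp (K : SimplicialComplex ℝ E) (g : E → V) :
    LinearOnFaces K (interp K g) := fun _ hs =>
  (exists_affineMap_interp g hs).imp fun _ h => h.2

theorem linearOnFaces_coord (K : SimplicialComplex ℝ E) (v : E) :
    LinearOnFaces K (fun x => coord K x v) := by
  classical
  have h : (fun x => coord K x v) = interp K (fun u => if u = v then (1 : ℝ) else 0) := by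
    funext x
    rw [interp, finsum_eq_single _ v fun u hu => by simp [hu]]
    simp
  rw [h]
  exact linearOnFaces_interp K _

theorem LinearOnFaces.map_isBary {f : E → V} (hf : LinearOnFaces K f) (hs : s ∈ K.faces)
    (h : IsBary s w x) : f x = ∑ v ∈ s, w v • f v := by
  obtain ⟨g, hg⟩ := hf s hs
  rw [hg h.mem_convexHull, h.map_affine g]
  exact Finset.sum_congr rfl fun v hv => by rw [hg (subset_convexHull ℝ _ hv)]

theorem LinearOnFaces.sub {f g : E → V} (hf : LinearOnFaces K f) (hg : LinearOnFaces K g) :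
    LinearOnFaces K (f - g) := fun s hs => by
  obtain ⟨a, ha⟩ := hf s hs
  obtain ⟨b, hb⟩ := hg s hs
  exact ⟨a - b, fun x hx => by simp [ha hx, hb hx]⟩

theorem linearOnFaces_affineMap (K : SimplicialComplex ℝ E) (f : E →ᵃ[ℝ] V) :
    LinearOnFaces K f := fun _ _ => ⟨f, fun _ _ => rfl⟩

theorem LinearOnFaces.of_subset {L : SimplicialComplex ℝ E} {f : E → V} (hf : LinearOnFaces K f)
    (h : ∀ s ∈ L.faces, ∃ t ∈ K.faces, convexHull ℝ (s : Set E) ⊆ convexHull ℝ (t : Set E)) :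
    LinearOnFaces L f := fun s hs => by
  obtain ⟨t, ht, hst⟩ := h s hs
  obtain ⟨g, hg⟩ := hf t ht
  exact ⟨g, hg.mono hst⟩

end Complex

end PLWidth

namespace PLWidth

/-! ### Stellar subdivision of edges and cutting along zero sets. -/

section Stellar

variable {E : Type*} [AddCommGroup E] [Module ℝ E] {V : Type*} [AddCommGroup V] [Module ℝ V]
  {K L M : SimplicialComplex ℝ E} {s t r : Finset E} {w w' : E → ℝ} {x a b p : E} {μ : ℝ}

theorem IsSubdivision.refl (h : K.faces.Finite) : IsSubdivision K K :=
  ⟨h, rfl, fun s hs => ⟨s, hs, Set.Subset.rfl⟩⟩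

theorem IsSubdivision.trans (h : IsSubdivision M L) (h' : IsSubdivision L K) :
    IsSubdivision M K where
  finite := h.finite
  space_eq := h.space_eq.trans h'.space_eq
  subset s hs := by
    obtain ⟨t, ht, hst⟩ := h.subset s hs
    obtain ⟨u, hu, htu⟩ := h'.subset t ht
    exact ⟨u, hu, hst.trans htu⟩

open Classical in
/-- Barycentric coordinates before the stellar subdivision of an edge, in terms of the coordinates
after it. -/
theorem IsBary.of_stellar (hpa : p ≠ a) (hpb : p ≠ b) (hμ : μ ∈ Set.Ioo (0 : ℝ) 1)
    (hp : p = (1 - μ) • a + μ • b) (hpr : p ∉ r)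
    (h : IsBary (insert p r) w x) :
    IsBary (insert a (insert b r)) (fun v => (if v = p then 0 else w v) +
      w p * ((if v = a then 1 - μ else 0) + if v = b then μ else 0)) x := by
  -- `W v` holds the old coordinates of the vertex `v`; only those of `p` are not concentrated at
  -- `v`. The old coordinates of `x` are the `w`-average of the `W v`.
  let W : E → E → ℝ := fun v u =>
    if v = p then (if u = a then 1 - μ else 0) + (if u = b then μ else 0)
    else if u = v then 1 else 0
  have hW : ∀ v ∈ insert p r, IsBary (insert a (insert b r)) (W v) v := by
    intro v hv
    by_cases hvp : v = p
    · subst hvp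
      have e : W v = fun u => (if u = a then 1 - μ else 0) + (if u = b then μ else 0) := by
        funext u; simp [W]
      rw [e]
      refine ⟨fun u => ?_, fun u hu => ?_, ?_, ?_⟩
      · have := hμ.1; have := hμ.2
        split_ifs <;> linarith
      · simp only [Finset.mem_insert, not_or] at hu
        simp [hu.1, hu.2.1]
      · rw [Finset.sum_add_distrib]
        simp
      · simp_rw [add_smul, Finset.sum_add_distrib, ite_smul, zero_smul]
        simp [← hp]
    · have e : W v = fun u => if u = v then 1 else 0 := by
        funext u; simp [W, hvp]
      rw [e]
      refine isBary_single ?_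
      have : v ∈ r := (Finset.mem_insert.1 hv).resolve_left hvp
      simp [this]
  have key := IsBary.convex_comb (fun v _ => h.nonneg v) h.sum_eq hW
  rw [h.comb] at key
  convert key using 1
  funext u
  rw [Finset.sum_insert hpr]
  have e1 : ∑ v ∈ r, w v * W v u = if u = p then 0 else w u := by
    have : ∀ v ∈ r, w v * W v u = if u = v then w u else 0 := fun v hv => by
      have hvp : v ≠ p := fun h => hpr (h ▸ hv)
      simp only [W, hvp, if_false]
      split_ifs with huv
      · rw [huv, mul_one]
      · rw [mul_zero]
    rw [Finset.sum_congr rfl this, Finset.sum_ite_eq]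
    by_cases hup : u = p
    · simp [hup, hpr]
    · by_cases hur : u ∈ r
      · simp [hup, hur]
      · simp only [hur, hup, if_false]
        exact (h.off u (by simp [hup, hur])).symm
  rw [e1]
  simp only [W, if_true]
  ring

-- If `w p < w' p`, the vanishing of `w a` or `w b` forces `w'` to be negative at that same vertex,
-- and symmetrically. So the weights at `p` agree, and then all the others do.
omit [AddCommGroup E] [Module ℝ E] in
open Classical in
theorem stellar_weights_unique (hpa : p ≠ a) (hpb : p ≠ b) (hμ : μ ∈ Set.Ioo (0 : ℝ) 1)
    (hab : a ≠ b) (h0 : ∀ v, 0 ≤ w v) (h0' : ∀ v, 0 ≤ w' v)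
    (h1 : w a = 0 ∨ w b = 0) (h1' : w' a = 0 ∨ w' b = 0)
    (h : (fun v => (if v = p then 0 else w v) +
      w p * ((if v = a then 1 - μ else 0) + if v = b then μ else 0)) =
      (fun v => (if v = p then 0 else w' v) +
      w' p * ((if v = a then 1 - μ else 0) + if v = b then μ else 0))) : w = w' := by
  have ha := congrFun h a
  have hb := congrFun h b
  simp only [hpa.symm, hpb.symm, hab, hab.symm, if_true, if_false, add_zero, zero_add] at ha hb
  obtain ⟨hμ0, hμ1⟩ := hμ
  have hp : w p = w' p := by
    rcases lt_trichotomy (w p) (w' p) with hlt | heq | hgt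
    · have e1 : w p * (1 - μ) < w' p * (1 - μ) := mul_lt_mul_of_pos_right hlt (by linarith)
      have e2 : w p * μ < w' p * μ := mul_lt_mul_of_pos_right hlt hμ0
      rcases h1 with h | h
      · linarith [h0' a]
      · linarith [h0' b]
    · exact heq
    · have e1 : w' p * (1 - μ) < w p * (1 - μ) := mul_lt_mul_of_pos_right hgt (by linarith)
      have e2 : w' p * μ < w p * μ := mul_lt_mul_of_pos_right hgt hμ0
      rcases h1' with h | h
      · linarith [h0 a]
      · linarith [h0 b]
  funext v
  by_cases hv : v = p
  · rw [hv, hp]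
  · have := congrFun h v
    simp only [hv, if_false, hp] at this
    linarith

-- Weight is moved from `a` and `b` to `p` in the ratio `1 - μ` to `μ` until `a` has none left;
-- `hle` says that `b` does not run out first.
open Classical in
theorem mem_convexHull_stellar (hμ : μ ∈ Set.Ioo (0 : ℝ) 1)
    (hp : p = (1 - μ) • a + μ • b) (hps : p ∉ s) (hab : a ≠ b) (ha : a ∈ s) (hb : b ∈ s)
    (h : IsBary s w x) (hle : w a * μ ≤ w b * (1 - μ)) :
    x ∈ convexHull ℝ ((insert p (s.erase a) : Finset E) : Set E) := by
  obtain ⟨hμ0, hμ1⟩ := hμ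
  have hμ' : 0 < 1 - μ := by linarith
  have hpr : p ∉ s.erase a := fun h => hps (Finset.mem_of_mem_erase h)
  set q := w a / (1 - μ) with hq
  have hqa : q * (1 - μ) = w a := div_mul_cancel₀ _ hμ'.ne'
  have hq0 : 0 ≤ q := div_nonneg (h.nonneg a) hμ'.le
  have hqb : q * μ ≤ w b := by
    rw [hq, div_mul_eq_mul_div, div_le_iff₀ hμ']; exact hle
  have hbr : b ∈ s.erase a := Finset.mem_erase.2 ⟨hab.symm, hb⟩
  rw [Finset.mem_convexHull']
  refine ⟨fun v => if v = p then q else w v - if v = b then q * μ else 0, ?_, ?_, ?_⟩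
  · intro v _
    dsimp only
    split_ifs with h1 h2
    · exact hq0
    · rw [h2]; linarith
    · linarith [h.nonneg v]
  · rw [Finset.sum_insert hpr, if_pos rfl]
    have : ∀ v ∈ s.erase a, (if v = p then q else w v - if v = b then q * μ else 0) =
        w v - if v = b then q * μ else 0 := fun v hv => if_neg fun (h : v = p) => hpr (h ▸ hv)
    rw [Finset.sum_congr rfl this, Finset.sum_sub_distrib, Finset.sum_ite_eq', if_pos hbr]
    have := Finset.add_sum_erase s w ha
    rw [h.sum_eq] at this
    linarith
  · rw [Finset.sum_insert hpr]
    simp only [if_true]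
    have : ∀ v ∈ s.erase a, (if v = p then q else w v - if v = b then q * μ else 0) • v =
        w v • v - if v = b then (q * μ) • b else 0 := fun v hv => by
      rw [if_neg fun (h : v = p) => hpr (h ▸ hv), sub_smul]
      split_ifs with h1
      · rw [h1]
      · rw [zero_smul]
    rw [Finset.sum_congr rfl this, Finset.sum_sub_distrib, Finset.sum_ite_eq', if_pos hbr]
    have h3 := Finset.add_sum_erase s (fun v => w v • v) ha
    rw [h.comb] at h3
    rw [← h3, hp, ← hqa, smul_add, smul_smul, smul_smul]
    abel

/-- The stellar subdivision of an edge of a finite complex. -/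
theorem exists_stellar (hfin : K.faces.Finite) {s₀ : Finset E} (hs₀ : s₀ ∈ K.faces)
    (ha : a ∈ s₀) (hb : b ∈ s₀) (hab : a ≠ b) (hμ : μ ∈ Set.Ioo (0 : ℝ) 1)
    (hp : p = (1 - μ) • a + μ • b) :
    ∃ L : SimplicialComplex ℝ E, IsSubdivision L K ∧
      (∀ e ∈ L.faces, p ∉ e → e ∈ K.faces ∧ ¬ (a ∈ e ∧ b ∈ e)) ∧
      ∀ v ∈ L.vertices, v ∈ K.vertices ∨ v = p := by
  classical
  have hbary : IsBary s₀ (fun u => (if u = a then 1 - μ else 0) + (if u = b then μ else 0)) p := by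
    refine ⟨fun u => ?_, fun u hu => ?_, ?_, ?_⟩
    · have := hμ.1; have := hμ.2
      split_ifs <;> linarith
    · rw [if_neg fun (h : u = a) => hu (h ▸ ha), if_neg fun (h : u = b) => hu (h ▸ hb), add_zero]
    · rw [Finset.sum_add_distrib]
      simp [ha, hb]
    · simp_rw [add_smul, Finset.sum_add_distrib, ite_smul, zero_smul]
      simp [ha, hb, ← hp]
  -- A vertex has a single positive coordinate, whereas `p` has two.
  have hpK : ∀ s ∈ K.faces, p ∉ s := fun s hs hps => by
    have h1 := isBary_unique hs₀ hs hbary (isBary_single hps)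
    have ea := congrFun h1 a
    have eb := congrFun h1 b
    simp only [hab, hab.symm, if_true, if_false, add_zero, zero_add] at ea eb
    have := hμ.1; have := hμ.2
    split_ifs at ea eb with h1 h2
    · exact hab (h1.trans h2.symm)
    all_goals linarith
  have hpa : p ≠ a := fun h => hpK s₀ hs₀ (h ▸ ha)
  have hpb : p ≠ b := fun h => hpK s₀ hs₀ (h ▸ hb)
  -- `A` keeps the faces that do not contain the edge `ab`; `B` consists of the cones with apex `p`.
  -- An empty `r` is allowed and gives the vertex `p` itself.
  let A : Set (Finset E) := {s | s ∈ K.faces ∧ ¬ (a ∈ s ∧ b ∈ s)}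
  let B : Set (Finset E) :=
    {s | ∃ r, s = insert p r ∧ ¬ (a ∈ r ∧ b ∈ r) ∧ insert a (insert b r) ∈ K.faces}
  have hpr : ∀ {r}, insert a (insert b r) ∈ K.faces → p ∉ r := fun hr h =>
    hpK _ hr (by simp [h])
  have hrK : ∀ {r : Finset E}, insert a (insert b r) ∈ K.faces → r.Nonempty → r ∈ K.faces :=
    fun hr hne => K.down_closed hr (fun v hv => by simp [hv]) hne
  -- For both kinds of faces one formula recovers the old coordinates, and one of the weights at `a`
  -- and `b` vanishes. With `stellar_weights_unique` this is the uniqueness that makes `A ∪ B` a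
  -- complex.
  have hcoord : ∀ s ∈ A ∪ B, ∀ w x, IsBary s w x → (w a = 0 ∨ w b = 0) ∧
      (fun v => (if v = p then 0 else w v) +
      w p * ((if v = a then 1 - μ else 0) + if v = b then μ else 0)) = coord K x := by
    rintro s (⟨hsK, hs⟩ | ⟨r, rfl, hr, hrK⟩) w x h
    · have hwp : w p = 0 := h.off p (hpK s hsK)
      refine ⟨?_, ?_⟩
      · rw [not_and_or] at hs
        exact hs.imp (h.off a) (h.off b)
      · rw [coord_eq hsK h]
        funext v
        by_cases hv : v = p
        · simp [hv, hwp]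
        · simp [hv, hwp]
    · refine ⟨?_, ?_⟩
      · rw [not_and_or] at hr
        exact hr.imp (fun h' => h.off a (by simp [h', hpa.symm]))
          (fun h' => h.off b (by simp [h', hpb.symm]))
      · exact (coord_eq hrK (h.of_stellar hpa hpb hμ hp (hpr hrK))).symm
  let L : SimplicialComplex ℝ E := complexOfUnique (A ∪ B)
    (by
      rintro s (hs | ⟨r, rfl, -⟩)
      · exact K.nonempty_of_mem_faces hs.1
      · exact Finset.insert_nonempty _ _)
    (by
      rintro s (⟨hs, hs'⟩ | ⟨r, rfl, hr, hrK'⟩) t hts ht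
      · exact Or.inl ⟨K.down_closed hs hts ht, fun h => hs' ⟨hts h.1, hts h.2⟩⟩
      · by_cases hpt : p ∈ t
        · have hsub : t.erase p ⊆ r := by
            intro v hv
            rw [Finset.mem_erase] at hv
            exact (Finset.mem_insert.1 (hts hv.2)).resolve_left hv.1
          refine Or.inr ⟨t.erase p, (Finset.insert_erase hpt).symm,
            fun h => hr ⟨hsub h.1, hsub h.2⟩, K.down_closed hrK' ?_ (Finset.insert_nonempty _ _)⟩
          exact Finset.insert_subset_insert _ (Finset.insert_subset_insert _ hsub)
        · have hsub : t ⊆ r := (Finset.subset_insert_iff_of_notMem hpt).1 hts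
          exact Or.inl ⟨K.down_closed hrK' (fun v hv => by simp [hsub hv]) ht,
            fun h => hr ⟨hsub h.1, hsub h.2⟩⟩)
    (fun s hs t ht w w' x h h' => by
      obtain ⟨h1, h2⟩ := hcoord s hs w x h
      obtain ⟨h1', h2'⟩ := hcoord t ht w' x h'
      exact stellar_weights_unique hpa hpb hμ hab h.nonneg h'.nonneg h1 h1' (h2.trans h2'.symm))
  have hLf : L.faces = A ∪ B := rfl
  have hsub : ∀ s ∈ L.faces, ∃ t ∈ K.faces, convexHull ℝ (s : Set E) ⊆ convexHull ℝ (t : Set E) := by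
    intro s hs
    rw [hLf] at hs
    obtain ⟨hsK, hs⟩ | ⟨r, rfl, hr, hrK⟩ := hs
    · exact ⟨s, hsK, Set.Subset.rfl⟩
    · refine ⟨_, hrK, fun x hx => ?_⟩
      obtain ⟨w, h⟩ := mem_convexHull_iff_isBary.1 hx
      exact (h.of_stellar hpa hpb hμ hp (hpr hrK)).mem_convexHull
  refine ⟨L, ⟨?_, ?_, hsub⟩, ?_, ?_⟩
  · rw [hLf]
    refine (hfin.subset fun s hs => hs.1).union
      (((hfin.insert ∅).image fun r => insert p r).subset ?_)
    rintro s ⟨r, rfl, hr, hrK'⟩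
    refine ⟨r, ?_, rfl⟩
    rcases r.eq_empty_or_nonempty with h | h
    · exact Or.inl h
    · exact Or.inr (hrK hrK' h)
  · refine Set.Subset.antisymm (fun x hx => ?_) (fun x hx => ?_)
    · obtain ⟨s, hs, hxs⟩ := SimplicialComplex.mem_space_iff.1 hx
      obtain ⟨t, ht, hst⟩ := hsub s hs
      exact SimplicialComplex.mem_space_iff.2 ⟨t, ht, hst hxs⟩
    · obtain ⟨s, hs, hxs⟩ := SimplicialComplex.mem_space_iff.1 hx
      by_cases has : a ∈ s ∧ b ∈ s
      · have h := isBary_coord hs hxs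
        -- The end of the edge whose weight is used up first is replaced by `p`; the second case
        -- exchanges `a` with `b` and `μ` with `1 - μ`.
        rcases le_total (coord K x a * μ) (coord K x b * (1 - μ)) with hle | hle
        · refine SimplicialComplex.mem_space_iff.2 ⟨insert p (s.erase a),
            Or.inr ⟨s.erase a, rfl, by simp, ?_⟩,
            mem_convexHull_stellar hμ hp (hpK s hs) hab has.1 has.2 h hle⟩
          rwa [Finset.insert_eq_self.2 (Finset.mem_erase.2 ⟨hab.symm, has.2⟩),
            Finset.insert_erase has.1]
        · refine SimplicialComplex.mem_space_iff.2 ⟨insert p (s.erase b),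
            Or.inr ⟨s.erase b, rfl, by simp, ?_⟩,
            mem_convexHull_stellar (μ := 1 - μ) ⟨by linarith [hμ.2], by linarith [hμ.1]⟩
              (by rw [hp, sub_sub_cancel, add_comm]) (hpK s hs) hab.symm has.2 has.1 h
              (by rwa [sub_sub_cancel])⟩
          rwa [Finset.insert_erase has.2, Finset.insert_eq_self.2 has.1]
      · exact SimplicialComplex.mem_space_iff.2 ⟨s, Or.inl ⟨hs, has⟩, hxs⟩
  · intro e he hpe
    rw [hLf] at he
    obtain he | ⟨r, rfl, -⟩ := he
    · exact he
    · exact absurd (Finset.mem_insert_self _ _) hpe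
  · intro v hv
    rw [SimplicialComplex.mem_vertices, hLf] at hv
    obtain hv | ⟨r, hvr, -⟩ := hv
    · exact Or.inl hv.1
    · right
      have : p ∈ ({v} : Finset E) := hvr ▸ Finset.mem_insert_self _ _
      exact (Finset.mem_singleton.1 this).symm

/-- A finite complex can be subdivided along the zero set of a function which is affine on its
faces; the only new vertices are the zeros on the edges where the function changes sign. -/
theorem exists_cut (hfin : K.faces.Finite) {h : E → ℝ} (hl : LinearOnFaces K h) :
    ∃ L : SimplicialComplex ℝ E, IsSubdivision L K ∧
      (∀ s ∈ L.faces, (∀ v ∈ s, 0 ≤ h v) ∨ (∀ v ∈ s, h v ≤ 0)) ∧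
      ∀ v ∈ L.vertices, v ∈ K.vertices ∨ ∃ a b, ∃ μ ∈ Set.Ioo (0 : ℝ) 1, ∃ s ∈ K.faces,
        a ∈ s ∧ b ∈ s ∧ h a < 0 ∧ 0 < h b ∧ h v = 0 ∧ v = (1 - μ) • a + μ • b := by
  classical
  have hfinbad : ∀ K : SimplicialComplex ℝ E, K.faces.Finite →
      {q : E × E | ∃ s ∈ K.faces, q.1 ∈ s ∧ q.2 ∈ s ∧ h q.1 < 0 ∧ 0 < h q.2}.Finite := by
    intro K hK
    refine (hK.biUnion fun s _ => (s ×ˢ s).finite_toSet).subset ?_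
    rintro q ⟨s, hs, h1, h2, -⟩
    simp only [Set.mem_iUnion]
    exact ⟨s, hs, by simp [h1, h2]⟩
  -- Induction on the number of edges along which `h` changes sign. Subdividing one of them at the
  -- zero of `h` removes it and creates no other, since every new edge contains this zero.
  induction hn : {q : E × E | ∃ s ∈ K.faces, q.1 ∈ s ∧ q.2 ∈ s ∧ h q.1 < 0 ∧ 0 < h q.2}.ncard
    using Nat.strong_induction_on generalizing K with
  | _ n ih =>
  by_cases hbad : ∃ a b, ∃ s ∈ K.faces, a ∈ s ∧ b ∈ s ∧ h a < 0 ∧ 0 < h b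
  · obtain ⟨a, b, s₀, hs₀, ha, hb, hha, hhb⟩ := hbad
    have hab : a ≠ b := fun e => by rw [e] at hha; linarith
    set μ : ℝ := -h a / (h b - h a) with hμdef
    have hd : 0 < h b - h a := by linarith
    have hμ : μ ∈ Set.Ioo (0 : ℝ) 1 :=
      ⟨div_pos (by linarith) hd, by rw [div_lt_one hd]; linarith⟩
    obtain ⟨L, hLK, hLe, hLv⟩ := exists_stellar hfin hs₀ ha hb hab hμ rfl
    set p := (1 - μ) • a + μ • b with hp
    have hhp : h p = 0 := by
      obtain ⟨g, hg⟩ := hl s₀ hs₀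
      have h1 : p ∈ convexHull ℝ (s₀ : Set E) :=
        (convex_convexHull ℝ _) (subset_convexHull ℝ _ ha) (subset_convexHull ℝ _ hb)
          (by linarith [hμ.2]) hμ.1.le (by ring)
      have h2 : p = AffineMap.lineMap a b μ := by
        rw [AffineMap.lineMap_apply_module]
      rw [hg h1, h2, AffineMap.apply_lineMap, ← hg (subset_convexHull ℝ _ ha),
        ← hg (subset_convexHull ℝ _ hb), AffineMap.lineMap_apply_module, hμdef]
      simp only [smul_eq_mul]
      field_simp
      ring
    have hss : ∀ q : E × E, (∃ s ∈ L.faces, q.1 ∈ s ∧ q.2 ∈ s ∧ h q.1 < 0 ∧ 0 < h q.2) →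
        (∃ s ∈ K.faces, q.1 ∈ s ∧ q.2 ∈ s ∧ h q.1 < 0 ∧ 0 < h q.2) ∧ q ≠ (a, b) := by
      rintro ⟨c, d⟩ ⟨s, hs, hc, hd, hhc, hhd⟩
      have he : ({c, d} : Finset E) ∈ L.faces :=
        L.down_closed hs (by simp [Finset.insert_subset_iff, hc, hd]) (by simp)
      have hpe : p ∉ ({c, d} : Finset E) := by
        simp only [Finset.mem_insert, Finset.mem_singleton, not_or]
        refine ⟨fun e => ?_, fun e => ?_⟩
        · rw [← e] at hhc; linarith
        · rw [← e] at hhd; linarith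
      obtain ⟨h1, h2⟩ := hLe _ he hpe
      refine ⟨⟨_, h1, by simp, by simp, hhc, hhd⟩, ?_⟩
      rintro e
      rw [Prod.mk.injEq] at e
      exact h2 ⟨by simp [e.1], by simp [e.2]⟩
    have hlt : {q : E × E | ∃ s ∈ L.faces, q.1 ∈ s ∧ q.2 ∈ s ∧ h q.1 < 0 ∧ 0 < h q.2}.ncard < n := by
      rw [← hn]
      refine Set.ncard_lt_ncard ⟨fun q hq => (hss q hq).1, fun hc => ?_⟩ (hfinbad K hfin)
      exact (hss (a, b) (hc ⟨s₀, hs₀, ha, hb, hha, hhb⟩)).2 rfl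
    obtain ⟨M, hML, hMs, hMv⟩ := ih _ hlt hLK.finite (hl.of_subset hLK.subset) rfl
    refine ⟨M, hML.trans hLK, hMs, fun v hv => ?_⟩
    rcases hMv v hv with hv | ⟨c, d, ν, hν, s, hs, hc, hd, hhc, hhd, hhv, hve⟩
    · rcases hLv v hv with hv | rfl
      · exact Or.inl hv
      · exact Or.inr ⟨a, b, μ, hμ, s₀, hs₀, ha, hb, hha, hhb, hhp, hp⟩
    · obtain ⟨⟨s', hs', h1, h2, -⟩, -⟩ := hss (c, d) ⟨s, hs, hc, hd, hhc, hhd⟩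
      exact Or.inr ⟨c, d, ν, hν, s', hs', h1, h2, hhc, hhd, hhv, hve⟩
  · refine ⟨K, IsSubdivision.refl hfin, fun s hs => ?_, fun v hv => Or.inl hv⟩
    by_contra! hc
    obtain ⟨⟨a, ha, hha⟩, b, hb, hhb⟩ := hc
    exact hbad ⟨a, b, s, hs, ha, hb, hha, hhb⟩

end Stellar
end PLWidth

namespace PLWidth

/-! ### Carriers of simplices and adapted refinements. -/

section Refinement

variable {E : Type*} [AddCommGroup E] [Module ℝ E] {V : Type*} [AddCommGroup V] [Module ℝ V]
  {K K₁ L L₁ : SimplicialComplex ℝ E} {s t σ : Finset E} {w : E → ℝ} {x : E}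

theorem exists_isBary_pos (ht : t.Nonempty) : ∃ w x, IsBary t w x ∧ ∀ v ∈ t, 0 < w v := by
  classical
  have hc : (0 : ℝ) < t.card := Nat.cast_pos.2 ht.card_pos
  refine ⟨fun v => if v ∈ t then 1 / t.card else 0, _, ⟨fun v => ?_, fun v hv => by simp [hv], ?_, rfl⟩,
    fun v hv => by simp [hv, hc]⟩
  · by_cases hv : v ∈ t <;> simp [hv]
  · rw [Finset.sum_congr rfl fun v hv => if_pos hv]
    simp [hc.ne']

theorem coord_comb (hσ : σ ∈ K.faces) (ht : ∀ v ∈ t, v ∈ convexHull ℝ (σ : Set E))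
    (h : IsBary t w x) (u : E) : coord K x u = ∑ v ∈ t, w v * coord K v u := by
  have := IsBary.convex_comb (fun v _ => h.nonneg v) h.sum_eq fun v hv => isBary_coord hσ (ht v hv)
  rw [h.comb] at this
  rw [coord_eq hσ this]

/-- Nonnegative terms with positive weights cannot cancel. All interior points of a simplex thus
have the same carrier in `K`, the union of the carriers of the vertices. -/
theorem coord_comb_pos_iff (hσ : σ ∈ K.faces) (ht : ∀ v ∈ t, v ∈ convexHull ℝ (σ : Set E))
    (h : IsBary t w x) (hw : ∀ v ∈ t, 0 < w v) (u : E) :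
    0 < coord K x u ↔ ∃ v ∈ t, 0 < coord K v u := by
  rw [coord_comb hσ ht h u]
  constructor
  · intro hpos
    by_contra! hc
    exact hpos.not_ge (Finset.sum_nonpos fun v hv =>
      mul_nonpos_of_nonneg_of_nonpos (h.nonneg v) (hc v hv))
  · rintro ⟨v, hv, hpos⟩
    exact Finset.sum_pos' (fun i _ => mul_nonneg (h.nonneg i) (coord_nonneg K i u))
      ⟨v, hv, mul_pos (hw v hv) hpos⟩

/-- A simplex inside a face whose relative interior meets another face lies in that face. -/
theorem convexHull_subset_of_pos (hσ : σ ∈ K.faces) (ht : ∀ v ∈ t, v ∈ convexHull ℝ (σ : Set E))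
    (h : IsBary t w x) (hw : ∀ v ∈ t, 0 < w v) (hs : s ∈ K.faces)
    (hx : x ∈ convexHull ℝ (s : Set E)) :
    convexHull ℝ (t : Set E) ⊆ convexHull ℝ (s : Set E) := by
  refine convexHull_min (fun v hv => ?_) (convex_convexHull ℝ _)
  refine (mem_convexHull_iff_coord hs (SimplicialComplex.convexHull_subset_space hσ (ht v hv))).2
    fun u hu => le_antisymm (not_lt.1 fun hpos => ?_) (coord_nonneg K v u)
  exact ((coord_comb_pos_iff hσ ht h hw u).2 ⟨v, hv, hpos⟩).ne' ((isBary_coord hs hx).off u hu)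

theorem IsSubdivision.subset_convexHull (hL : IsSubdivision L K) (ht : t ∈ L.faces) :
    ∃ σ ∈ K.faces, ∀ v ∈ t, v ∈ convexHull ℝ (σ : Set E) := by
  obtain ⟨σ, hσ, h⟩ := hL.subset t ht
  exact ⟨σ, hσ, fun v hv => h (_root_.subset_convexHull ℝ _ hv)⟩

theorem IsSubdivision.mem_space (hL : IsSubdivision L K) (ht : t ∈ L.faces) {v : E} (hv : v ∈ t) :
    v ∈ K.space := by
  rw [← hL.space_eq]
  exact SimplicialComplex.subset_space ht hv

open Classical in
/-- The smallest face of `K` containing the simplex `t` of a subdivision. -/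
noncomputable def carrierFace (K : SimplicialComplex ℝ E) (t : Finset E) : Finset E :=
  if h : ∃ σ ∈ K.faces, ∀ u, u ∈ σ ↔ ∃ v ∈ t, 0 < coord K v u then h.choose else ∅

theorem IsSubdivision.carrierFace_spec (hL : IsSubdivision L K) (ht : t ∈ L.faces) :
    carrierFace K t ∈ K.faces ∧ ∀ u, u ∈ carrierFace K t ↔ ∃ v ∈ t, 0 < coord K v u := by
  have h : ∃ σ ∈ K.faces, ∀ u, u ∈ σ ↔ ∃ v ∈ t, 0 < coord K v u := by
    obtain ⟨σ, hσ, h1⟩ := hL.subset_convexHull ht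
    obtain ⟨w, x, hx, hw⟩ := exists_isBary_pos (L.nonempty_of_mem_faces ht)
    have hxσ : x ∈ K.space := SimplicialComplex.convexHull_subset_space hσ
      (convexHull_min (s := (t : Set E)) h1 (convex_convexHull ℝ _) hx.mem_convexHull)
    obtain ⟨ρ, hρ, -, h2⟩ := exists_carrier hxσ
    exact ⟨ρ, hρ, fun u => (h2 u).trans (coord_comb_pos_iff hσ h1 hx hw u)⟩
  rw [carrierFace, dif_pos h]
  exact h.choose_spec

theorem IsSubdivision.carrierFace_mem (hL : IsSubdivision L K) (ht : t ∈ L.faces) :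
    carrierFace K t ∈ K.faces := (hL.carrierFace_spec ht).1

theorem IsSubdivision.convexHull_subset_carrierFace (hL : IsSubdivision L K) (ht : t ∈ L.faces) :
    convexHull ℝ (t : Set E) ⊆ convexHull ℝ (carrierFace K t : Set E) := by
  obtain ⟨h1, h2⟩ := hL.carrierFace_spec ht
  refine convexHull_min (fun v hv => ?_) (convex_convexHull ℝ _)
  refine (mem_convexHull_iff_coord h1 (hL.mem_space ht hv)).2 fun u hu =>
    le_antisymm (not_lt.1 fun hpos => hu ((h2 u).2 ⟨v, hv, hpos⟩)) (coord_nonneg K v u)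

theorem IsSubdivision.carrierFace_subset_iff (hL : IsSubdivision L K) (ht : t ∈ L.faces)
    (hs : s ∈ K.faces) :
    carrierFace K t ⊆ s ↔ convexHull ℝ (t : Set E) ⊆ convexHull ℝ (s : Set E) := by
  refine ⟨fun h => (hL.convexHull_subset_carrierFace ht).trans (convexHull_mono h), fun h u hu => ?_⟩
  obtain ⟨v, hv, hpos⟩ := ((hL.carrierFace_spec ht).2 u).1 hu
  by_contra hus
  exact hpos.ne' ((isBary_coord hs (h (_root_.subset_convexHull ℝ _ hv))).off u hus)

theorem IsSubdivision.carrierFace_mono (hL : IsSubdivision L K) (ht : t ∈ L.faces)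
    (hs : s ∈ L.faces) (hst : s ⊆ t) : carrierFace K s ⊆ carrierFace K t :=
  (hL.carrierFace_subset_iff hs (hL.carrierFace_mem ht)).2
    ((convexHull_mono hst).trans (hL.convexHull_subset_carrierFace ht))

theorem IsSubdivision.openSimplex_subset (hL : IsSubdivision L K) (ht : t ∈ L.faces) :
    openSimplex t ⊆ openSimplex (carrierFace K t) := by
  intro x hx
  obtain ⟨h1, h2⟩ := hL.carrierFace_spec ht
  have hxL : x ∈ L.space := SimplicialComplex.convexHull_subset_space ht hx.1
  rw [mem_openSimplex_iff_coord h1 (hL.space_eq ▸ hxL)]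
  intro u
  have hsub := hL.convexHull_subset_carrierFace ht
  rw [h2, ← coord_comb_pos_iff h1 (fun v hv => hsub (_root_.subset_convexHull ℝ _ hv))
    (isBary_coord ht hx.1) ((mem_openSimplex_iff (L.indep ht) (isBary_coord ht hx.1)).1 hx)]

theorem openSimplex_injOn (hs : s ∈ K.faces) (ht : t ∈ K.faces) (hxs : x ∈ openSimplex s)
    (hxt : x ∈ openSimplex t) : s = t := by
  have hx := SimplicialComplex.convexHull_subset_space hs hxs.1
  ext v
  rw [(mem_openSimplex_iff_coord hs hx).1 hxs, (mem_openSimplex_iff_coord ht hx).1 hxt]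

theorem exists_mem_openSimplex (hx : x ∈ K.space) : ∃ s ∈ K.faces, x ∈ openSimplex s := by
  obtain ⟨s, hs, -, h⟩ := exists_carrier hx
  exact ⟨s, hs, (mem_openSimplex_iff_coord hs hx).2 h⟩

/-- The open simplices of a subdivision refine those of the complex. -/
theorem IsSubdivision.exists_openSimplex (hL : IsSubdivision L K) (hs : s ∈ K.faces)
    (hx : x ∈ openSimplex s) : ∃ t ∈ L.faces, carrierFace K t = s ∧ x ∈ openSimplex t := by
  have hxK : x ∈ L.space :=
    hL.space_eq ▸ SimplicialComplex.convexHull_subset_space hs hx.1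
  obtain ⟨t, ht, hxt⟩ := exists_mem_openSimplex hxK
  exact ⟨t, ht, openSimplex_injOn (hL.carrierFace_mem ht) hs (hL.openSimplex_subset ht hxt) hx, hxt⟩

/-- A finite complex can be subdivided so that finitely many functions which are affine on its
faces do not change sign on any simplex. -/
theorem exists_subdivision_sign (hfin : K.faces.Finite) (H : List (E → ℝ))
    (hl : ∀ h ∈ H, LinearOnFaces K h) :
    ∃ L : SimplicialComplex ℝ E, IsSubdivision L K ∧
      ∀ h ∈ H, ∀ s ∈ L.faces, (∀ v ∈ s, 0 ≤ h v) ∨ (∀ v ∈ s, h v ≤ 0) := by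
  induction H with
  | nil => exact ⟨K, IsSubdivision.refl hfin, by simp⟩
  | cons h H ih =>
    obtain ⟨L, hL, hH⟩ := ih fun g hg => hl g (List.mem_cons_of_mem _ hg)
    obtain ⟨M, hM, hMs, -⟩ := exists_cut hL.finite ((hl h (by simp)).of_subset hL.subset)
    refine ⟨M, hM.trans hL, fun g hg s hs => ?_⟩
    rcases List.mem_cons.1 hg with rfl | hg
    · exact hMs s hs
    -- The earlier functions are affine on `t`, so their sign at the vertices of `t` passes to every
    -- simplex inside `t`.
    · obtain ⟨t, ht, hst⟩ := hM.subset s hs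
      obtain ⟨f, hf⟩ := ((hl g (List.mem_cons_of_mem _ hg)).of_subset hL.subset) t ht
      have hb : ∀ v ∈ s, ∃ w, IsBary t w v := fun v hv =>
        mem_convexHull_iff_isBary.1 (hst (_root_.subset_convexHull ℝ _ hv))
      have hlin := (hl g (List.mem_cons_of_mem _ hg)).of_subset hL.subset
      refine (hH g hg t ht).imp (fun h v hv => ?_) fun h v hv => ?_
      · obtain ⟨w, hw⟩ := hb v hv
        rw [hlin.map_isBary ht hw]
        exact Finset.sum_nonneg fun u hu => mul_nonneg (hw.nonneg u) (h u hu)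
      · obtain ⟨w, hw⟩ := hb v hv
        rw [hlin.map_isBary ht hw]
        exact Finset.sum_nonpos fun u hu => mul_nonpos_of_nonneg_of_nonpos (hw.nonneg u) (h u hu)

/-- The coordinates of a basis of `S`, extended linearly to `E`. -/
theorem exists_separating (S : Submodule ℝ E) [FiniteDimensional ℝ S] :
    ∃ H : List (E →ₗ[ℝ] ℝ), ∀ y ∈ S, (∀ h ∈ H, h y = 0) → y = 0 := by
  let b := Module.finBasis ℝ S
  choose f hf using fun i => (b.coord i).exists_extend
  refine ⟨List.ofFn f, fun y hy h => ?_⟩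
  have : (⟨y, hy⟩ : S) = 0 := by
    rw [← b.forall_coord_eq_zero_iff]
    intro i
    rw [← hf i]
    exact h (f i) (List.mem_ofFn.2 ⟨i, rfl⟩)
  exact congrArg Subtype.val this

theorem eq_zero_of_comb_eq_zero {h : E → ℝ} (hb : IsBary t w x) (hw : ∀ v ∈ t, 0 < w v)
    (hsign : (∀ v ∈ t, 0 ≤ h v) ∨ (∀ v ∈ t, h v ≤ 0)) (h0 : ∑ v ∈ t, w v * h v = 0) :
    ∀ v ∈ t, h v = 0 := by
  intro v hv
  rcases hsign with hs | hs
  · have := (Finset.sum_eq_zero_iff_of_nonneg fun u hu => mul_nonneg (hb.nonneg u) (hs u hu)).1 h0 v hv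
    exact (mul_eq_zero.1 this).resolve_left (hw v hv).ne'
  · have := (Finset.sum_eq_zero_iff_of_nonpos fun u hu =>
      mul_nonpos_of_nonneg_of_nonpos (hb.nonneg u) (hs u hu)).1 h0 v hv
    exact (mul_eq_zero.1 this).resolve_left (hw v hv).ne'

/-- Inside a finite-dimensional subspace, a simplex is cut out by finitely many affine
functions. -/
theorem exists_affine_cutting (S : Submodule ℝ E) [FiniteDimensional ℝ S]
    (hs : AffineIndependent ℝ (fun v : s => (v : E))) (hsS : ∀ v ∈ s, v ∈ S) :
    ∃ H : List (E →ᵃ[ℝ] ℝ), ∀ (t : Finset E) (w : E → ℝ) (x : E), (∀ v ∈ t, v ∈ S) →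
      (∀ h ∈ H, (∀ v ∈ t, 0 ≤ h v) ∨ (∀ v ∈ t, h v ≤ 0)) → IsBary t w x → (∀ v ∈ t, 0 < w v) →
      x ∈ convexHull ℝ (s : Set E) → ∀ v ∈ t, v ∈ convexHull ℝ (s : Set E) := by
  classical
  obtain ⟨Φ, hΦ⟩ := exists_separating S
  choose β hβ using fun u : E =>
    exists_affineMap (p := id) hs (fun v => if v = u then (1 : ℝ) else 0)
  have hβ' : ∀ u, ∀ v ∈ s, β u v = if v = u then 1 else 0 := hβ
  let R : E →ᵃ[ℝ] E := AffineMap.id ℝ E -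
    ∑ u ∈ s, ((LinearMap.toSpanSingleton ℝ E u).toAffineMap.comp (β u))
  have sum_apply : ∀ (T : Finset E) (f : E → E →ᵃ[ℝ] E) (y : E), (∑ u ∈ T, f u) y = ∑ u ∈ T, f u y := by
    intro T f y
    induction T using Finset.induction_on with
    | empty => simp
    | insert a T ha ih => simp [Finset.sum_insert ha, ih]
  have sum_apply' : ∀ (T : Finset E) (f : E → E →ᵃ[ℝ] ℝ) (y : E), (∑ u ∈ T, f u) y = ∑ u ∈ T, f u y := by
    intro T f y
    induction T using Finset.induction_on with
    | empty => simp
    | insert a T ha ih => simp [Finset.sum_insert ha, ih]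
  have hR : ∀ y, R y = y - ∑ u ∈ s, β u y • u := fun y => by simp [R, sum_apply]
  let N : E →ᵃ[ℝ] ℝ := (∑ u ∈ s, β u) - AffineMap.const ℝ E 1
  have hN : ∀ y, N y = ∑ u ∈ s, β u y - 1 := fun y => by simp [N, sum_apply']
  -- The `β u` extend the barycentric coordinates of `s` to `E`, `N` tests whether they add up to
  -- one, and the functionals in `Φ` test whether the residual `R` vanishes. Within `S`, the simplex
  -- is given by `N = 0`, `R = 0` and `0 ≤ β u`.
  refine ⟨N :: (s.toList.map β ++ Φ.map fun φ => φ.toAffineMap.comp R), ?_⟩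
  intro t w x htS hsign hb hw hx
  obtain ⟨c, hc⟩ := mem_convexHull_iff_isBary.1 hx
  have hβx : ∀ u ∈ s, β u x = c u := fun u hu => by
    rw [hc.map_affine (β u), Finset.sum_congr rfl fun v hv => by rw [hβ' u v hv]]
    simp [hu]
  have zero_of : ∀ h : E →ᵃ[ℝ] ℝ, ((∀ v ∈ t, 0 ≤ h v) ∨ (∀ v ∈ t, h v ≤ 0)) → h x = 0 →
      ∀ v ∈ t, h v = 0 := fun h hs h0 =>
    eq_zero_of_comb_eq_zero hb hw hs (by rw [← h0, hb.map_affine h]; rfl)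
  have h1 : ∀ v ∈ t, ∑ u ∈ s, β u v = 1 := by
    have := zero_of N (hsign N (by simp)) (by
      rw [hN, Finset.sum_congr rfl hβx, hc.sum_eq, sub_self])
    intro v hv
    have := this v hv
    rw [hN] at this
    linarith
  have h2 : ∀ v ∈ t, v = ∑ u ∈ s, β u v • u := by
    intro v hv
    refine sub_eq_zero.1 (hΦ _ (S.sub_mem (htS v hv)
      (S.sum_mem fun u hu => S.smul_mem _ (hsS u hu))) fun φ hφ => ?_)
    rw [← hR]
    refine zero_of (φ.toAffineMap.comp R) (hsign _ ?_) ?_ v hv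
    · refine List.mem_cons_of_mem _ (List.mem_append_right _ (List.mem_map.2 ⟨φ, hφ, rfl⟩))
    · have : R x = 0 := by
        rw [hR, sub_eq_zero, Finset.sum_congr rfl fun u hu => by rw [hβx u hu], hc.comb]
      simp [this]
  have h3 : ∀ v ∈ t, ∀ u ∈ s, 0 ≤ β u v := by
    intro v hv u hu
    have hsg := hsign (β u) (List.mem_cons_of_mem _ (List.mem_append_left _
      (List.mem_map.2 ⟨u, Finset.mem_toList.2 hu, rfl⟩)))
    -- A coordinate that vanishes at the interior point `x` vanishes on `t`; one that is positive at
    -- `x` cannot be nonpositive on `t`.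
    rcases (hc.nonneg u).eq_or_lt with h0 | hpos
    · rw [zero_of (β u) hsg (by rw [hβx u hu, ← h0]) v hv]
    · rcases hsg with h | h
      · exact h v hv
      · exfalso
        have : β u x ≤ 0 := by
          rw [hb.map_affine (β u)]
          exact Finset.sum_nonpos fun v hv => mul_nonpos_of_nonneg_of_nonpos (hb.nonneg v) (h v hv)
        rw [hβx u hu] at this
        linarith
  intro v hv
  rw [Finset.mem_convexHull']
  exact ⟨fun u => β u v, h3 v hv, h1 v hv, (h2 v hv).symm⟩

/-- A finite complex has a subdivision which is adapted to finitely many given simplices in its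
polyhedron, and along which the barycentric coordinates are totally preordered on simplices. -/
theorem exists_refinement (hfin : K.faces.Finite) {P : Set (Finset E)} (hP : P.Finite)
    (hind : ∀ s ∈ P, AffineIndependent ℝ (fun v : s => (v : E)))
    (hPK : ∀ s ∈ P, (s : Set E) ⊆ K.space) :
    ∃ L : SimplicialComplex ℝ E, IsSubdivision L K ∧
      (∀ t ∈ L.faces, ∀ u ∈ K.vertices, ∀ u' ∈ K.vertices,
        (∀ v ∈ t, coord K v u ≤ coord K v u') ∨ (∀ v ∈ t, coord K v u' ≤ coord K v u)) ∧
      ∀ s ∈ P, ∀ t ∈ L.faces, ∀ w x, IsBary t w x → (∀ v ∈ t, 0 < w v) →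
        x ∈ convexHull ℝ (s : Set E) → convexHull ℝ (t : Set E) ⊆ convexHull ℝ (s : Set E) := by
  classical
  have hvfin : K.vertices.Finite := by
    rw [SimplicialComplex.vertices_eq]
    exact hfin.biUnion fun s _ => s.finite_toSet
  -- `E` may be infinite-dimensional, but the polyhedron lies in this span.
  let S : Submodule ℝ E := Submodule.span ℝ K.vertices
  have : FiniteDimensional ℝ S := FiniteDimensional.span_of_finite ℝ hvfin
  have hS : K.space ⊆ S := by
    intro x hx
    obtain ⟨s, hs, hxs⟩ := SimplicialComplex.mem_space_iff.1 hx
    refine convexHull_min (fun v hv => Submodule.subset_span ?_) S.convex hxs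
    rw [SimplicialComplex.vertices_eq]
    exact Set.mem_biUnion hs hv
  choose! H hH using fun s (hs : s ∈ P) =>
    exists_affine_cutting S (hind s hs) fun v hv => hS (hPK s hs hv)
  let vl := hvfin.toFinset.toList
  have hvl : ∀ u, u ∈ vl ↔ u ∈ K.vertices := fun u => by simp [vl]
  -- Fixing the signs of all differences of coordinates orders the coordinates on each simplex, as a
  -- barycentric subdivision does.
  let hats : List (E → ℝ) := (vl ×ˢ vl).map fun q =>
    (fun x => coord K x q.1) - fun x => coord K x q.2
  let cuts : List (E → ℝ) := hP.toFinset.toList.flatMap fun s => (H s).map fun h : E →ᵃ[ℝ] ℝ => (⇑h : E → ℝ)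
  obtain ⟨L, hL, hsign⟩ := exists_subdivision_sign hfin (hats ++ cuts) (by
    intro h hh
    rcases List.mem_append.1 hh with hh | hh
    · obtain ⟨q, -, rfl⟩ := List.mem_map.1 hh
      exact (linearOnFaces_coord K q.1).sub (linearOnFaces_coord K q.2)
    · obtain ⟨s, -, hh⟩ := List.mem_flatMap.1 hh
      obtain ⟨g, -, rfl⟩ := List.mem_map.1 hh
      exact linearOnFaces_affineMap K g)
  refine ⟨L, hL, fun t ht u hu u' hu' => ?_, fun s hs t ht w x hb hw hx => ?_⟩
  · have := hsign ((fun x => coord K x u) - fun x => coord K x u') (List.mem_append_left _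
      (List.mem_map.2 ⟨(u, u'), List.pair_mem_product.2 ⟨(hvl u).2 hu, (hvl u').2 hu'⟩, rfl⟩)) t ht
    rcases this with h | h
    · exact Or.inr fun v hv => by simpa using h v hv
    · exact Or.inl fun v hv => by simpa using h v hv
  · refine convexHull_min (fun v hv => ?_) (convex_convexHull ℝ _)
    refine hH s hs t w x (fun v hv => hS (hL.mem_space ht hv)) (fun h hh => ?_) hb hw hx v hv
    refine hsign h (List.mem_append_right _ (List.mem_flatMap.2 ⟨s, ?_, List.mem_map.2 ⟨h, hh, rfl⟩⟩)) t ht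
    simpa using hs

/-- The part of a subdivision of `K` lying in the polyhedron of a subcomplex `K₁`. -/
def subdivisionOf (L K₁ : SimplicialComplex ℝ E) : SimplicialComplex ℝ E where
  faces := {t | t ∈ L.faces ∧ ∃ s ∈ K₁.faces, convexHull ℝ (t : Set E) ⊆ convexHull ℝ (s : Set E)}
  isRelLowerSet_faces := by
    rintro t ⟨ht, s, hs, hts⟩
    refine ⟨L.nonempty_of_mem_faces ht, fun u hut hu => ⟨L.down_closed ht hut hu, s, hs, ?_⟩⟩
    exact (convexHull_mono hut).trans hts
  indep h := L.indep h.1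
  inter_subset_convexHull h h' := L.inter_subset_convexHull h.1 h'.1

theorem mem_subdivisionOf : t ∈ (subdivisionOf L K₁).faces ↔
    t ∈ L.faces ∧ ∃ s ∈ K₁.faces, convexHull ℝ (t : Set E) ⊆ convexHull ℝ (s : Set E) := Iff.rfl

theorem IsSubdivision.mem_subdivisionOf_iff (hL : IsSubdivision L K) (h : K₁ ≤ K)
    (ht : t ∈ L.faces) : t ∈ (subdivisionOf L K₁).faces ↔ carrierFace K t ∈ K₁.faces := by
  rw [mem_subdivisionOf, and_iff_right ht]
  constructor
  · rintro ⟨s, hs, hts⟩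
    exact K₁.down_closed hs ((hL.carrierFace_subset_iff ht (h hs)).2 hts)
      (K.nonempty_of_mem_faces (hL.carrierFace_mem ht))
  · exact fun hc => ⟨_, hc, hL.convexHull_subset_carrierFace ht⟩

theorem IsSubdivision.subdivisionOf (hL : IsSubdivision L K) (h : K₁ ≤ K) :
    IsSubdivision (subdivisionOf L K₁) K₁ where
  finite := hL.finite.subset fun _ ht => ht.1
  space_eq := by
    refine Set.Subset.antisymm (fun x hx => ?_) fun x hx => ?_
    · obtain ⟨t, ⟨-, s, hs, hts⟩, hxt⟩ := SimplicialComplex.mem_space_iff.1 hx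
      exact SimplicialComplex.mem_space_iff.2 ⟨s, hs, hts hxt⟩
    · obtain ⟨s, hs, hxs⟩ := exists_mem_openSimplex hx
      obtain ⟨t, ht, hts, hxt⟩ := hL.exists_openSimplex (h hs) hxs
      refine SimplicialComplex.mem_space_iff.2 ⟨t, ⟨ht, s, hs, ?_⟩, hxt.1⟩
      rw [← hts]
      exact hL.convexHull_subset_carrierFace ht
  subset _ ht := ht.2

/-- If `L` is adapted to the faces of a subdivision `L₁` of the subcomplex `K₁`, then the
corresponding part of `L` subdivides `L₁`. -/
theorem IsSubdivision.subdivisionOf_of_adapted (hL : IsSubdivision L K) (h : K₁ ≤ K)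
    (hL₁ : IsSubdivision L₁ K₁)
    (hadapt : ∀ s ∈ L₁.faces, ∀ t ∈ L.faces, ∀ w x, IsBary t w x → (∀ v ∈ t, 0 < w v) →
      x ∈ convexHull ℝ (s : Set E) → convexHull ℝ (t : Set E) ⊆ convexHull ℝ (s : Set E)) :
    IsSubdivision (PLWidth.subdivisionOf L K₁) L₁ where
  finite := (hL.subdivisionOf h).finite
  space_eq := (hL.subdivisionOf h).space_eq.trans hL₁.space_eq.symm
  subset t ht := by
    obtain ⟨w, x, hb, hw⟩ := exists_isBary_pos (L.nonempty_of_mem_faces ht.1)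
    have hx : x ∈ L₁.space := by
      rw [hL₁.space_eq, ← (hL.subdivisionOf h).space_eq]
      exact SimplicialComplex.convexHull_subset_space ht hb.mem_convexHull
    obtain ⟨s, hs, hxs⟩ := SimplicialComplex.mem_space_iff.1 hx
    exact ⟨s, hs, hadapt s hs t ht.1 w x hb hw hxs⟩

/-- Along a subdivision adapted to the order of the barycentric coordinates, every subcomplex is
full: a simplex with all its vertices in the subcomplex lies in the subcomplex. -/
theorem IsSubdivision.carrierFace_mem_of_vertices (hL : IsSubdivision L K) (h : K₁ ≤ K)
    (hord : ∀ t ∈ L.faces, ∀ u ∈ K.vertices, ∀ u' ∈ K.vertices,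
        (∀ v ∈ t, coord K v u ≤ coord K v u') ∨ (∀ v ∈ t, coord K v u' ≤ coord K v u))
    (ht : t ∈ L.faces) (hv : ∀ v ∈ t, v ∈ K₁.space) : carrierFace K t ∈ K₁.faces := by
  classical
  have hcar : ∀ v ∈ t, ∃ s ∈ K₁.faces, ∀ u, u ∈ s ↔ 0 < coord K v u := by
    intro v hvt
    obtain ⟨s, hs, hvs⟩ := exists_mem_openSimplex (hv v hvt)
    exact ⟨s, hs, (mem_openSimplex_iff_coord (h hs) (hL.mem_space ht hvt)).1 hvs⟩
  choose! c hc hcu using hcar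
  have hvert : ∀ v ∈ t, ∀ u ∈ c v, u ∈ K.vertices := fun v hvt u hu => by
    rw [SimplicialComplex.vertices_eq]
    exact Set.mem_biUnion (h (hc v hvt)) hu
  -- The carriers of the vertices form a chain: witnesses `u`, `z` against both inclusions would
  -- have their coordinates in opposite order at `v` and `v'`. The largest carrier is then that of
  -- `t`.
  have hchain : ∀ v ∈ t, ∀ v' ∈ t, c v ⊆ c v' ∨ c v' ⊆ c v := by
    intro v hvt v' hvt'
    by_contra! hcon
    obtain ⟨u, hu, hu'⟩ := Finset.not_subset.1 hcon.1
    obtain ⟨z, hz, hz'⟩ := Finset.not_subset.1 hcon.2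
    rw [hcu v' hvt', not_lt] at hu'
    rw [hcu v hvt, not_lt] at hz'
    have e1 := (hcu v hvt u).1 hu
    have e2 := (hcu v' hvt' z).1 hz
    rcases hord t ht u (hvert v hvt u hu) z (hvert v' hvt' z hz) with h1 | h1
    · linarith [h1 v hvt]
    · linarith [h1 v' hvt']
  obtain ⟨m, hm, hmax⟩ := Finset.exists_max_image t (fun v => (c v).card)
    (L.nonempty_of_mem_faces ht)
  have : carrierFace K t = c m := by
    ext u
    rw [(hL.carrierFace_spec ht).2 u]
    constructor
    · rintro ⟨v, hvt, hpos⟩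
      rcases hchain v hvt m hm with h1 | h1
      · exact h1 ((hcu v hvt u).2 hpos)
      · rw [Finset.eq_of_subset_of_card_le h1 (hmax v hvt)]
        exact (hcu v hvt u).2 hpos
    · exact fun hu => ⟨m, hm, (hcu m hm u).1 hu⟩
  rw [this]
  exact hc m hm

end Refinement
end PLWidth

namespace PLWidth

/-! ### The no-retraction theorem by polynomial volumes. -/

section Brouwer

open Metric

variable {n : ℕ}

local notation "𝔼" => EuclideanSpace ℝ (Fin n)

/-- `t ↦ det (1 + t A)` is a polynomial of degree at most the dimension. -/
theorem exists_polynomial_det (A : 𝔼 →L[ℝ] 𝔼) :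
    ∃ p : Polynomial ℝ, p.natDegree ≤ n ∧
      ∀ t : ℝ, p.eval t = (ContinuousLinearMap.id ℝ 𝔼 + t • A).det := by
  let b := (EuclideanSpace.basisFun (Fin n) ℝ).toBasis
  let M := LinearMap.toMatrix b b (A : 𝔼 →ₗ[ℝ] 𝔼)
  refine ⟨Matrix.det ((Polynomial.X : Polynomial ℝ) • M.map Polynomial.C +
    (1 : Matrix (Fin n) (Fin n) ℝ).map Polynomial.C), ?_, fun t => ?_⟩
  · simpa using Polynomial.natDegree_det_X_add_C_le M 1
  · rw [← Polynomial.coe_evalRingHom, RingHom.map_det]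
    have h1 : (ContinuousLinearMap.id ℝ 𝔼 + t • A).det =
        LinearMap.det (LinearMap.id + t • (A : 𝔼 →ₗ[ℝ] 𝔼)) := rfl
    have h2 : LinearMap.toMatrix b b (LinearMap.id + t • (A : 𝔼 →ₗ[ℝ] 𝔼)) = t • M + 1 := by
      rw [map_add, map_smul, LinearMap.toMatrix_id, add_comm]
    rw [h1, ← LinearMap.det_toMatrix b, h2]
    congr 1
    ext i j
    simp only [Matrix.one_apply, RingHom.mapMatrix_apply, Matrix.map_apply, Matrix.add_apply,
      Matrix.smul_apply, smul_eq_mul]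
    split_ifs <;> simp [mul_comm t]

/-- There is no `C¹` retraction of the closed ball onto its boundary sphere. -/
theorem no_retraction {U : Set 𝔼} (hU : IsOpen U) (hBU : closedBall 0 1 ⊆ U) {r : 𝔼 → 𝔼}
    (hr : ContDiffOn ℝ 1 r U) (hnorm : ∀ x ∈ closedBall (0 : 𝔼) 1, ‖r x‖ = 1)
    (hid : ∀ x ∈ sphere (0 : 𝔼) 1, r x = x) : False := by
  classical
  have hder : ∀ x ∈ U, HasFDerivAt r (fderiv ℝ r x) x := fun x hx =>
    ((hr.differentiableOn one_ne_zero).differentiableAt (hU.mem_nhds hx)).hasFDerivAt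
  have hcont : ContinuousOn (fderiv ℝ r) U := hr.continuousOn_fderiv_of_isOpen hU le_rfl
  have hball : ball (0 : 𝔼) 1 ⊆ closedBall 0 1 := ball_subset_closedBall
  -- the displacement is Lipschitz
  obtain ⟨K, hK⟩ : ∃ K, LipschitzOnWith K (fun x => r x - x) (closedBall (0 : 𝔼) 1) :=
    ((hr.mono hBU).sub contDiffOn_id).exists_lipschitzOnWith one_ne_zero (convex_closedBall _ _)
      (isCompact_closedBall _ _)
  let g : 𝔼 → 𝔼 := fun x => if x ∈ ball (0 : 𝔼) 1 then r x - x else 0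
  have hgB : ∀ x ∈ closedBall (0 : 𝔼) 1, g x = r x - x := by
    intro x hx
    by_cases h : x ∈ ball (0 : 𝔼) 1
    · simp only [g, if_pos h]
    · have : x ∈ sphere (0 : 𝔼) 1 := by
        rw [mem_closedBall] at hx
        rw [mem_ball, not_lt] at h
        exact le_antisymm hx h
      simp only [g, if_neg h]
      rw [hid x this, sub_self]
  have hgo : ∀ x, x ∉ ball (0 : 𝔼) 1 → g x = 0 := fun x h => if_neg h
  have hcross : ∀ x ∈ ball (0 : 𝔼) 1, ∀ y, y ∉ ball (0 : 𝔼) 1 → ‖g x - g y‖ ≤ K * ‖x - y‖ := by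
    intro x hx y hy
    -- The segment leaves the ball at a point `z` of the sphere, where the displacement vanishes
    -- because `r` fixes the sphere; `y` can be replaced by `z`.
    obtain ⟨t, ht, hts⟩ : ∃ t ∈ Set.Icc (0 : ℝ) 1, ‖AffineMap.lineMap x y t‖ = (1 : ℝ) := by
      have hc : ContinuousOn (fun t : ℝ => ‖AffineMap.lineMap x y t‖) (Set.Icc 0 1) := by
        have : Continuous (AffineMap.lineMap x y : ℝ → 𝔼) := AffineMap.lineMap_continuous
        exact this.norm.continuousOn
      have := intermediate_value_Icc zero_le_one hc
      obtain ⟨t, ht, h⟩ := this (show (1 : ℝ) ∈ _ by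
        simp only [AffineMap.lineMap_apply_zero, AffineMap.lineMap_apply_one, Set.mem_Icc]
        rw [mem_ball_zero_iff] at hx hy
        exact ⟨hx.le, not_lt.1 hy⟩)
      exact ⟨t, ht, h⟩
    set z := AffineMap.lineMap x y t
    have hz : z ∈ closedBall (0 : 𝔼) 1 := by rw [mem_closedBall_zero_iff, hts]
    have hz' : z ∉ ball (0 : 𝔼) 1 := by rw [mem_ball_zero_iff, hts]; exact lt_irrefl _
    rw [hgo y hy, ← hgo z hz', hgB x (hball hx), hgB z hz]
    refine (hK.norm_sub_le (hball hx) hz).trans (mul_le_mul_of_nonneg_left ?_ K.2)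
    rw [← dist_eq_norm, ← dist_eq_norm, dist_left_lineMap, Real.norm_of_nonneg ht.1]
    exact mul_le_of_le_one_left dist_nonneg ht.2
  have hg : LipschitzWith K g := by
    refine LipschitzWith.of_dist_le_mul fun x y => ?_
    rw [dist_eq_norm, dist_eq_norm]
    by_cases hx : x ∈ ball (0 : 𝔼) 1 <;> by_cases hy : y ∈ ball (0 : 𝔼) 1
    · rw [hgB x (hball hx), hgB y (hball hy)]
      exact hK.norm_sub_le (hball hx) (hball hy)
    · exact hcross x hx y hy
    · rw [norm_sub_rev, norm_sub_rev x]
      exact hcross y hy x hx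
    · rw [hgo x hx, hgo y hy, sub_self, norm_zero]
      positivity
  -- for small `t` the map `x ↦ x + t • g x` permutes the ball
  have hbij : ∀ t : ℝ, 0 ≤ t → t * K < 1 → Function.Injective (fun x => x + t • g x) ∧
      (fun x => x + t • g x) '' ball (0 : 𝔼) 1 = ball 0 1 := by
    intro t ht0 htK
    have hinj : Function.Injective (fun x => x + t • g x) := by
      intro x y hxy
      have h1 : x - y = t • (g y - g x) := by
        rw [smul_sub, sub_eq_sub_iff_add_eq_add]
        simpa [add_comm] using hxy
      have h2 : ‖x - y‖ ≤ t * (K * ‖x - y‖) := by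
        conv_lhs => rw [h1, norm_smul, Real.norm_of_nonneg ht0, norm_sub_rev]
        exact mul_le_mul_of_nonneg_left (hg.norm_sub_le x y) ht0
      have h3 : ‖x - y‖ = 0 := by
        by_contra h
        have : 0 < ‖x - y‖ := lt_of_le_of_ne (norm_nonneg _) (Ne.symm h)
        nlinarith
      exact sub_eq_zero.1 (norm_eq_zero.1 h3)
    have hsurj : Function.Surjective (fun x => x + t • g x) := by
      intro y
      -- A solution of `x + t • g x = y` is a fixed point of this contraction.
      have hc : ContractingWith (t.toNNReal * K) (fun x => y - t • g x) := by
        refine ⟨by rw [← NNReal.coe_lt_coe, NNReal.coe_mul, Real.coe_toNNReal _ ht0]; exact htK,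
          LipschitzWith.of_dist_le_mul fun x x' => ?_⟩
        rw [dist_eq_norm, sub_sub_sub_cancel_left, ← smul_sub, norm_smul, Real.norm_of_nonneg ht0,
          dist_comm, dist_eq_norm, NNReal.coe_mul, mul_assoc, Real.coe_toNNReal _ ht0]
        exact mul_le_mul_of_nonneg_left (hg.norm_sub_le _ _) ht0
      refine ⟨hc.fixedPoint _, ?_⟩
      have := hc.fixedPoint_isFixedPt
      rw [Function.IsFixedPt] at this
      dsimp only
      nth_rewrite 1 [← this]
      abel
    refine ⟨hinj, ?_⟩
    have hout : ∀ x, x ∉ ball (0 : 𝔼) 1 → x + t • g x = x := fun x hx => by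
      rw [hgo x hx, smul_zero, add_zero]
    refine Set.Subset.antisymm ?_ fun y hy => ?_
    · rintro _ ⟨x, hx, rfl⟩
      by_contra h
      have := hinj (hout _ h)
      dsimp only at h this
      rw [this] at h
      exact h hx
    · obtain ⟨x, rfl⟩ := hsurj y
      refine ⟨x, by_contra fun h => ?_, rfl⟩
      dsimp only at hy
      rw [hout x h] at hy
      exact h hy
  -- determinant integrals
  let A : 𝔼 → 𝔼 →L[ℝ] 𝔼 := fun x => fderiv ℝ r x - ContinuousLinearMap.id ℝ 𝔼
  let J : ℝ → 𝔼 → ℝ := fun t x => (ContinuousLinearMap.id ℝ 𝔼 + t • A x).det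
  have hA : ContinuousOn A (closedBall 0 1) := (hcont.mono hBU).sub continuousOn_const
  have hJc : ∀ t, ContinuousOn (J t) (closedBall 0 1) := fun t =>
    ContinuousLinearMap.continuous_det.comp_continuousOn
      (continuousOn_const.add (hA.const_smul t))
  have hJi : ∀ t, IntegrableOn (J t) (ball 0 1) := fun t =>
    ((hJc t).integrableOn_compact (isCompact_closedBall _ _)).mono_set hball
  obtain ⟨C, hC⟩ := (isCompact_closedBall (0 : 𝔼) 1).exists_bound_of_continuousOn hA
  have hCpos : 0 ≤ C := (norm_nonneg _).trans (hC 0 (by simp))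
  obtain ⟨δ, hδ, hdet⟩ : ∃ δ > 0, ∀ T : 𝔼 →L[ℝ] 𝔼, ‖T - ContinuousLinearMap.id ℝ 𝔼‖ < δ →
      0 < T.det := by
    have h1 : (0 : ℝ) < (ContinuousLinearMap.id ℝ 𝔼).det := by
      have : (ContinuousLinearMap.id ℝ 𝔼).det = LinearMap.det (LinearMap.id : 𝔼 →ₗ[ℝ] 𝔼) := rfl
      rw [this, LinearMap.det_id]; exact one_pos
    have := (ContinuousLinearMap.continuous_det (𝕜 := ℝ) (E := 𝔼)).continuousAt.eventually
      (lt_mem_nhds h1)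
    obtain ⟨δ, hδ, h⟩ := Metric.eventually_nhds_iff.1 this
    exact ⟨δ, hδ, fun T hT => h (by rwa [dist_eq_norm])⟩
  have hvol : ∀ t : ℝ, 0 ≤ t → t * K < 1 → t * C < δ →
      ∫ x in ball (0 : 𝔼) 1, J t x = volume.real (ball (0 : 𝔼) 1) := by
    intro t ht0 htK htC
    obtain ⟨hinj, himg⟩ := hbij t ht0 htK
    have hd : ∀ x ∈ ball (0 : 𝔼) 1, HasFDerivWithinAt (fun x => x + t • g x)
        (ContinuousLinearMap.id ℝ 𝔼 + t • A x) (ball 0 1) x := by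
      intro x hx
      have h1 : HasFDerivAt (fun x => x + t • (r x - x))
          (ContinuousLinearMap.id ℝ 𝔼 + t • A x) x :=
        (hasFDerivAt_id x).add (((hder x (hBU (hball hx))).sub (hasFDerivAt_id x)).const_smul t)
      exact h1.hasFDerivWithinAt.congr (fun y hy => by rw [hgB y (hball hy)])
        (by rw [hgB x (hball hx)])
    have hpos : ∀ x ∈ ball (0 : 𝔼) 1, 0 < J t x := fun x hx => hdet _ (by
      rw [add_sub_cancel_left, norm_smul, Real.norm_of_nonneg ht0]
      exact (mul_le_mul_of_nonneg_left (hC x (hball hx)) ht0).trans_lt htC)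
    have key := integral_image_eq_integral_abs_det_fderiv_smul volume measurableSet_ball hd
      hinj.injOn (fun _ => (1 : ℝ))
    rw [himg] at key
    rw [setIntegral_const, smul_eq_mul, mul_one] at key
    rw [key]
    refine setIntegral_congr_fun measurableSet_ball fun x hx => ?_
    change J t x = |J t x| • (1 : ℝ)
    rw [abs_of_pos (hpos x hx), smul_eq_mul, mul_one]
  -- interpolation
  obtain ⟨τ, hτ, hτK, hτC⟩ : ∃ τ : ℝ, 0 < τ ∧ τ * K < 1 ∧ τ * C < δ := by
    have hKnn : (0 : ℝ) ≤ K := K.2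
    refine ⟨min (1 / (K + 1)) (δ / (C + 1)), by positivity, ?_, ?_⟩
    · refine (mul_le_mul_of_nonneg_right (min_le_left _ _) hKnn).trans_lt ?_
      rw [one_div_mul_eq_div, div_lt_one (by positivity)]; linarith
    · refine (mul_le_mul_of_nonneg_right (min_le_right _ _) hCpos).trans_lt ?_
      rw [div_mul_eq_mul_div, div_lt_iff₀ (by positivity)]; nlinarith
  -- `J t x` is a polynomial in `t` of degree at most `n`, so its value at `1` is a combination of
  -- its values at `n + 1` small times, with coefficients independent of `x` and of sum one. At
  -- these times the integral of `J` is the volume of the ball, hence also at time `1`.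
  let node : ℕ → ℝ := fun i => τ / (i + 1)
  have hnode : ∀ i, 0 ≤ node i ∧ node i ≤ τ := fun i => by
    have : (0 : ℝ) ≤ i := Nat.cast_nonneg i
    exact ⟨by positivity, div_le_self hτ.le (by linarith)⟩
  have hnodeinj : Set.InjOn node (Finset.range (n + 1) : Set ℕ) := by
    intro i _ j _ hij
    simp only [node] at hij
    rw [div_eq_div_iff (by positivity) (by positivity)] at hij
    have := mul_left_cancel₀ hτ.ne' hij
    have h' : (j : ℝ) = i := by linarith
    exact_mod_cast h'.symm
  have hlag : ∀ x, J 1 x = ∑ i ∈ Finset.range (n + 1),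
      J (node i) x * (Lagrange.basis (Finset.range (n + 1)) node i).eval 1 := by
    intro x
    obtain ⟨p, hp, hpe⟩ := exists_polynomial_det (A x)
    have h1 := Lagrange.eq_interpolate (f := p) hnodeinj (by
      rw [Finset.card_range]
      exact (Polynomial.degree_le_natDegree).trans_lt (by exact_mod_cast Nat.lt_succ_of_le hp))
    have h2 := congrArg (Polynomial.eval 1) h1
    rw [Lagrange.interpolate_apply, Polynomial.eval_finsetSum, hpe] at h2
    refine h2.trans (Finset.sum_congr rfl fun i _ => ?_)
    rw [Polynomial.eval_mul, Polynomial.eval_C, hpe]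
  have hone : ∑ i ∈ Finset.range (n + 1),
      (Lagrange.basis (Finset.range (n + 1)) node i).eval 1 = 1 := by
    rw [← Polynomial.eval_finsetSum, Lagrange.sum_basis hnodeinj ⟨0, by simp⟩, Polynomial.eval_one]
  have hI1 : ∫ x in ball (0 : 𝔼) 1, J 1 x = volume.real (ball (0 : 𝔼) 1) := by
    simp_rw [hlag]
    rw [integral_finsetSum _ fun i _ => (hJi _).mul_const _]
    have : ∀ i ∈ Finset.range (n + 1), ∫ x in ball (0 : 𝔼) 1,
        J (node i) x * (Lagrange.basis (Finset.range (n + 1)) node i).eval 1 =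
        volume.real (ball (0 : 𝔼) 1) * (Lagrange.basis (Finset.range (n + 1)) node i).eval 1 := by
      intro i _
      rw [integral_mul_const, hvol (node i) (hnode i).1
        ((mul_le_mul_of_nonneg_right (hnode i).2 K.2).trans_lt hτK)
        ((mul_le_mul_of_nonneg_right (hnode i).2 hCpos).trans_lt hτC)]
    rw [Finset.sum_congr rfl this, ← Finset.mul_sum, hone, mul_one]
  -- but the differential of the retraction is degenerate
  have hJ1 : ∀ x ∈ ball (0 : 𝔼) 1, J 1 x = 0 := by
    intro x hx
    have hfd := hder x (hBU (hball hx))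
    have hx0 : ‖r x‖ = 1 := hnorm x (hball hx)
    -- Differentiating `‖r y‖ ^ 2 = 1`: the range of the differential is orthogonal to `r x`, so `r
    -- x` itself is not in it.
    have horth : ∀ v, inner ℝ (r x) (fderiv ℝ r x v) = 0 := by
      intro v
      have h1 : HasFDerivAt (fun y => ‖r y‖ ^ 2)
          (2 • (innerSL ℝ (r x)).comp (fderiv ℝ r x)) x := hfd.norm_sq
      have h2 : HasFDerivAt (fun y => ‖r y‖ ^ 2) (0 : 𝔼 →L[ℝ] ℝ) x := by
        refine (hasFDerivAt_const (1 : ℝ) x).congr_of_eventuallyEq ?_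
        filter_upwards [isOpen_ball.mem_nhds hx] with y hy
        rw [hnorm y (hball hy)]; norm_num
      have h3 := DFunLike.congr_fun (h1.unique h2) v
      simpa using h3
    have hJe : J 1 x = LinearMap.det (fderiv ℝ r x : 𝔼 →ₗ[ℝ] 𝔼) := by
      have : ContinuousLinearMap.id ℝ 𝔼 + (1 : ℝ) • A x = fderiv ℝ r x := by simp [A]
      simp only [J, this]
    rw [hJe]
    by_contra hne
    have hu : IsUnit (fderiv ℝ r x : 𝔼 →ₗ[ℝ] 𝔼) :=
      (LinearMap.isUnit_iff_isUnit_det _).2 (isUnit_iff_ne_zero.2 hne)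
    obtain ⟨v, hv⟩ := ((Module.End.isUnit_iff _).1 hu).2 (r x)
    have := horth v
    rw [show fderiv ℝ r x v = r x from hv, real_inner_self_eq_norm_sq, hx0] at this
    norm_num at this
  rw [setIntegral_congr_fun measurableSet_ball hJ1] at hI1
  have hpos : 0 < volume.real (ball (0 : 𝔼) 1) :=
    ENNReal.toReal_pos (measure_ball_pos _ _ one_pos).ne' measure_ball_lt_top.ne
  simp at hI1
  linarith

end Brouwer
end PLWidth

namespace PLWidth

/-! ### Zeros of outward vector fields and invariance of domain. -/

section Brouwer

open Metric

variable {n : ℕ}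

local notation "𝔼" => EuclideanSpace ℝ (Fin n)

theorem exists_continuous_extension {s : Set 𝔼} (hs : IsClosed s) {f : 𝔼 → 𝔼}
    (hf : ContinuousOn f s) : ∃ g : 𝔼 → 𝔼, Continuous g ∧ Set.EqOn g f s := by
  obtain ⟨g, hg⟩ := ContinuousMap.exists_restrict_eq hs (⟨s.domRestrict f, hf.domRestrict⟩ : C(s, 𝔼))
  exact ⟨g, g.continuous, fun x hx => congrArg (fun φ : C(s, 𝔼) => φ ⟨x, hx⟩) hg⟩

/-- A vector field on the closed unit ball which points outwards on the sphere has a zero. -/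
theorem exists_zero_of_inner_pos {G : 𝔼 → 𝔼} (hG : ContinuousOn G (closedBall 0 1))
    (hs : ∀ x ∈ sphere (0 : 𝔼) 1, 0 < inner ℝ x (G x)) : ∃ x ∈ closedBall (0 : 𝔼) 1, G x = 0 := by
  by_contra! hne
  obtain ⟨G', hG', hGG'⟩ := exists_continuous_extension isClosed_closedBall hG
  have hsub : sphere (0 : 𝔼) 1 ⊆ closedBall 0 1 := sphere_subset_closedBall
  obtain ⟨δ₁, hδ₁, h₁⟩ := (isCompact_closedBall (0 : 𝔼) 1).exists_forall_le' (a := 0)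
    hG'.norm.continuousOn fun x hx => by rw [hGG' hx]; exact norm_pos_iff.2 (hne x hx)
  obtain ⟨δ₂, hδ₂, h₂⟩ := (isCompact_sphere (0 : 𝔼) 1).exists_forall_le' (a := 0)
    (f := fun x => inner ℝ x (G' x)) (continuous_id.inner hG').continuousOn
    fun x hx => by rw [hGG' (hsub hx)]; exact hs x hx
  obtain ⟨H, hH, hHG, -⟩ := hG'.exists_contDiff_approx 1 (ε := fun _ => min δ₁ δ₂)
    continuous_const fun _ => lt_min hδ₁ hδ₂
  have hH0 : ∀ x ∈ closedBall (0 : 𝔼) 1, H x ≠ 0 := by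
    intro x hx h0
    have := (hHG x).trans_le (min_le_left _ _)
    rw [h0, dist_zero_left] at this
    exact (h₁ x hx).not_gt this
  have hHs : ∀ x ∈ sphere (0 : 𝔼) 1, 0 < inner ℝ x (H x) := by
    intro x hx
    have h1 := (hHG x).trans_le (min_le_right _ _)
    have h2 : |inner ℝ x (H x - G' x)| ≤ ‖x‖ * ‖H x - G' x‖ := abs_real_inner_le_norm _ _
    rw [mem_sphere_zero_iff_norm.1 hx, one_mul, ← dist_eq_norm, inner_sub_right] at h2
    have := (abs_le.1 h2).1
    linarith [h₂ x hx]
  have hH1 : ContDiff ℝ 1 H := hH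
  -- The retraction follows `H x` from `x` to the sphere. The equation `‖x + s • H x‖ = 1` reads `a
  -- s² + 2 b s - c = 0`, with larger root `(-b + √D) / a`. On the sphere `c = 0` and `b > 0`, so
  -- this root is `0`.
  let a : 𝔼 → ℝ := fun x => inner ℝ (H x) (H x)
  let b : 𝔼 → ℝ := fun x => inner ℝ x (H x)
  let c : 𝔼 → ℝ := fun x => 1 - inner ℝ x x
  let D : 𝔼 → ℝ := fun x => b x ^ 2 + a x * c x
  have ha : ContDiff ℝ 1 a := hH1.inner ℝ hH1
  have hb : ContDiff ℝ 1 b := contDiff_id.inner ℝ hH1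
  have hc : ContDiff ℝ 1 c := contDiff_const.sub (contDiff_id.inner ℝ contDiff_id)
  have hD : ContDiff ℝ 1 D := (hb.pow 2).add (ha.mul hc)
  have hapos : ∀ x ∈ closedBall (0 : 𝔼) 1, 0 < a x := fun x hx =>
    real_inner_self_pos.2 (hH0 x hx)
  have hDpos : ∀ x ∈ closedBall (0 : 𝔼) 1, 0 < D x := by
    intro x hx
    have hxn : ‖x‖ ≤ 1 := mem_closedBall_zero_iff.1 hx
    rcases hxn.lt_or_eq with hlt | heq
    · have : 0 < c x := by
        simp only [c, real_inner_self_eq_norm_sq]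
        nlinarith [norm_nonneg x]
      have := mul_pos (hapos x hx) this
      simp only [D]
      positivity
    · have h1 := hHs x (mem_sphere_zero_iff_norm.2 heq)
      have : c x = 0 := by simp [c, heq]
      simp only [D, this, mul_zero, add_zero]
      exact pow_pos h1 2
  let U : Set 𝔼 := {x | 0 < a x} ∩ {x | 0 < D x}
  have hU : IsOpen U := (isOpen_lt continuous_const ha.continuous).inter
    (isOpen_lt continuous_const hD.continuous)
  refine no_retraction hU (fun x hx => ⟨hapos x hx, hDpos x hx⟩)
    (r := fun x => x + ((-b x + √(D x)) / a x) • H x) ?_ ?_ ?_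
  · refine contDiffOn_id.add (ContDiffOn.smul (ContDiffOn.div ?_ ha.contDiffOn
      fun x hx => (hx.1 : 0 < a x).ne') hH1.contDiffOn)
    exact hb.neg.contDiffOn.add (hD.contDiffOn.sqrt fun x hx => (hx.2 : 0 < D x).ne')
  · intro x hx
    have h1 := hapos x hx
    have h2 := Real.sq_sqrt (hDpos x hx).le
    have h3 : ‖x + ((-b x + √(D x)) / a x) • H x‖ ^ 2 = 1 := by
      rw [norm_add_sq_real, norm_smul, mul_pow, inner_smul_right, ← real_inner_self_eq_norm_sq (H x),
        Real.norm_eq_abs, sq_abs, ← real_inner_self_eq_norm_sq x]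
      change inner ℝ x x + 2 * (((-b x + √(D x)) / a x) * b x) +
        ((-b x + √(D x)) / a x) ^ 2 * a x = 1
      have h4 : inner ℝ x x = 1 - c x := by simp [c]
      rw [h4]
      field_simp
      have h5 : √(D x) ^ 2 = b x ^ 2 + a x * c x := h2
      nlinarith
    exact (pow_eq_one_iff_of_nonneg (norm_nonneg _) two_ne_zero).1 h3
  · intro x hx
    have h1 : c x = 0 := by simp [c, mem_sphere_zero_iff_norm.1 hx]
    have h2 : D x = b x ^ 2 := by simp [D, h1]
    have h3 : 0 < b x := hHs x hx
    simp only [h2, Real.sqrt_sq h3.le, neg_add_cancel, zero_div, zero_smul, add_zero]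

/-- **Invariance of domain**: a continuous injective map on a ball has the image of the centre in
the interior of its image. -/
theorem mem_interior_image_closedBall {f : 𝔼 → 𝔼} (hf : ContinuousOn f (closedBall 0 1))
    (hinj : Set.InjOn f (closedBall 0 1)) : f 0 ∈ interior (f '' closedBall 0 1) := by
  classical
  -- Otherwise some `c` close to `f 0` is missed by the image. A perturbation `Q` of a continuous
  -- extension `G` of the inverse has no zero on `S₁` or on a small sphere about `c`, and `Φ`
  -- carries the image of `f` into the union of these two sets. Yet `Q ∘ Φ ∘ f` is so close to the
  -- identity that it must vanish somewhere.
  by_contra hint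
  set B : Set 𝔼 := closedBall 0 1 with hB
  have h0B : (0 : 𝔼) ∈ B := by simp [hB]
  have hBc : IsCompact B := isCompact_closedBall _ _
  have hfB : IsCompact (f '' B) := hBc.image_of_continuousOn hf
  -- a continuous extension of the inverse
  obtain ⟨G, hG, hGf⟩ : ∃ G : 𝔼 → 𝔼, Continuous G ∧ ∀ x ∈ B, G (f x) = x := by
    have hcont : ContinuousOn (Function.invFunOn f B) (f '' B) := by
      rw [continuousOn_iff_isClosed]
      intro C hC
      refine ⟨f '' (B ∩ C), ((hBc.inter_right hC).image_of_continuousOn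
        (hf.mono Set.inter_subset_left)).isClosed, ?_⟩
      ext y
      constructor
      · rintro ⟨hy, x, hx, rfl⟩
        refine ⟨⟨x, ⟨hx, ?_⟩, rfl⟩, ⟨x, hx, rfl⟩⟩
        rwa [Set.mem_preimage, hinj.leftInvOn_invFunOn hx] at hy
      · rintro ⟨⟨x, ⟨hx, hxC⟩, rfl⟩, -⟩
        refine ⟨?_, ⟨x, hx, rfl⟩⟩
        rwa [Set.mem_preimage, hinj.leftInvOn_invFunOn hx]
    obtain ⟨G, hG, hGe⟩ := exists_continuous_extension hfB.isClosed hcont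
    exact ⟨G, hG, fun x hx => by
      rw [hGe ⟨x, hx, rfl⟩, hinj.leftInvOn_invFunOn hx]⟩
  have hG0 : G (f 0) = 0 := hGf 0 h0B
  obtain ⟨ε, hε, hGε⟩ : ∃ ε > 0, ∀ y, dist y (f 0) < 2 * ε + ε → ‖G y‖ < 1 / 10 := by
    have := hG.continuousAt (x := f 0)
    rw [Metric.continuousAt_iff] at this
    obtain ⟨δ, hδ, h⟩ := this (1 / 10) (by norm_num)
    refine ⟨δ / 3, by positivity, fun y hy => ?_⟩
    have := h (show dist y (f 0) < δ by linarith)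
    rwa [hG0, dist_zero_right] at this
  obtain ⟨c, hc, hcB⟩ : ∃ c, dist c (f 0) < ε ∧ c ∉ f '' B := by
    rw [mem_interior_iff_mem_nhds, Metric.mem_nhds_iff] at hint
    push Not at hint
    obtain ⟨c, hc, hcB⟩ := Set.not_subset.1 (hint ε hε)
    exact ⟨c, hc, hcB⟩
  have hGc : ∀ y, dist y c ≤ ε → ‖G y‖ < 1 / 10 := fun y hy =>
    hGε y (by linarith [dist_triangle y c (f 0)])
  -- the compact set on which a smooth approximation of `G` is needed
  let S₁ : Set 𝔼 := f '' B ∩ {y | ε ≤ dist y c}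
  have hS₁ : IsCompact S₁ := hfB.inter_right (isClosed_le continuous_const (by fun_prop))
  have hGS₁ : ∀ y ∈ S₁, 0 < ‖G y‖ := by
    rintro _ ⟨⟨x, hx, rfl⟩, hy⟩
    rw [hGf x hx, norm_pos_iff]
    rintro rfl
    rw [Set.mem_ofPred_eq, dist_comm] at hy
    linarith
  obtain ⟨δ, hδ, hGδ⟩ := hS₁.exists_forall_le' (a := 0) hG.norm.continuousOn hGS₁
  set η := min (δ / 2) (1 / 20) with hη
  have hη0 : 0 < η := by positivity
  obtain ⟨P, hP, hPG, -⟩ := hG.exists_contDiff_approx 1 (ε := fun _ => η)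
    continuous_const fun _ => hη0
  -- shift it so that it has no zero on the sphere
  obtain ⟨p, hp, hpP⟩ : ∃ p : 𝔼, ‖p‖ < η ∧ p ∉ P '' sphere c ε := by
    -- This is where `P` has to be differentiable: a differentiable map sends the null sphere to a
    -- null set, which cannot contain a ball.
    have hnull : volume (P '' sphere c ε) = 0 :=
      addHaar_image_eq_zero_of_differentiableOn_of_addHaar_eq_zero volume
        (hP.differentiable one_ne_zero).differentiableOn (Measure.addHaar_sphere_of_ne_zero _ _ hε.ne')
    by_contra! hcon
    have hsub : ball (0 : 𝔼) η ⊆ P '' sphere c ε := fun p hp =>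
      hcon p (mem_ball_zero_iff.1 hp)
    exact (measure_ball_pos volume (0 : 𝔼) hη0).ne' (measure_mono_null hsub hnull)
  let Q : 𝔼 → 𝔼 := fun y => P y - p
  have hQ : Continuous Q := hP.continuous.sub continuous_const
  have hQG : ∀ y, ‖Q y - G y‖ < 2 * η := fun y => by
    have h1 : Q y - G y = (P y - G y) - p := by simp only [Q]; abel
    have h2 := hPG y
    rw [dist_eq_norm] at h2
    rw [h1]
    linarith [norm_sub_le (P y - G y) p]
  have hη1 : 2 * η ≤ δ := by linarith [min_le_left (δ / 2) (1 / 20 : ℝ)]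
  have hη2 : 2 * η ≤ 1 / 10 := by linarith [min_le_right (δ / 2) (1 / 20 : ℝ)]
  have hQ₁ : ∀ y ∈ S₁, Q y ≠ 0 := by
    intro y hy h0
    have := hQG y
    rw [h0, zero_sub, norm_neg] at this
    linarith [hGδ y hy]
  have hQ₂ : ∀ y ∈ sphere c ε, Q y ≠ 0 := fun y hy h0 =>
    hpP ⟨y, hy, sub_eq_zero.1 h0⟩
  -- push the image away from `c`
  let Φ : 𝔼 → 𝔼 := fun y => c + max 1 (ε / ‖y - c‖) • (y - c)
  have hΦout : ∀ y, ε ≤ dist y c → Φ y = y := by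
    intro y hy
    have hpos : 0 < dist y c := hε.trans_le hy
    rw [dist_eq_norm] at hy hpos
    simp only [Φ]
    rw [max_eq_left ((div_le_one hpos).2 hy), one_smul, add_sub_cancel]
  have hΦin : ∀ y, y ≠ c → dist y c ≤ ε → Φ y ∈ sphere c ε := by
    intro y hyc hy
    have hpos : 0 < ‖y - c‖ := norm_pos_iff.2 (sub_ne_zero.2 hyc)
    rw [dist_eq_norm] at hy
    simp only [Φ]
    rw [max_eq_right ((one_le_div hpos).2 hy), mem_sphere, dist_eq_norm, add_sub_cancel_left,
      norm_smul, Real.norm_of_nonneg (by positivity), div_mul_cancel₀ _ hpos.ne']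
  have hfc : ∀ x ∈ B, f x ≠ c := fun x hx h => hcB ⟨x, hx, h⟩
  have hΦc : ContinuousOn (fun x => Φ (f x)) B := by
    have h1 : ContinuousOn (fun x => ε / ‖f x - c‖) B :=
      continuousOn_const.div (hf.sub continuousOn_const).norm fun x hx =>
        (norm_pos_iff.2 (sub_ne_zero.2 (hfc x hx))).ne'
    have h2 : ContinuousOn (fun x => max 1 (ε / ‖f x - c‖)) B := continuousOn_const.sup h1
    exact continuousOn_const.add (h2.smul (hf.sub continuousOn_const))
  -- Away from `c` the map `Φ` does nothing and `Q` nearly inverts `f`. Near `c` both `x = G (f x)`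
  -- and `G (Φ (f x))` are smaller than `1 / 10`, because `c` is close to `f 0`.
  have hclose : ∀ x ∈ B, ‖Q (Φ (f x)) - x‖ < 1 / 2 := by
    intro x hx
    rcases le_total ε (dist (f x) c) with h | h
    · rw [hΦout _ h]
      have := hQG (f x)
      rw [hGf x hx] at this
      linarith
    · have h1 := hGc (f x) h
      have h2 := hΦin (f x) (hfc x hx) h
      have h3 := hGc (Φ (f x)) (mem_sphere.1 h2).le
      have h4 := hQG (Φ (f x))
      rw [hGf x hx] at h1
      have h5 : Q (Φ (f x)) - x = (Q (Φ (f x)) - G (Φ (f x))) + (G (Φ (f x)) - x) := by abel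
      rw [h5]
      linarith [norm_add_le (Q (Φ (f x)) - G (Φ (f x))) (G (Φ (f x)) - x),
        norm_sub_le (G (Φ (f x))) x]
  obtain ⟨x, hx, hx0⟩ := exists_zero_of_inner_pos (G := fun x => Q (Φ (f x)))
    (hQ.comp_continuousOn hΦc) (fun x hx => by
      have hxB : x ∈ B := sphere_subset_closedBall hx
      have h1 := abs_real_inner_le_norm x (Q (Φ (f x)) - x)
      rw [mem_sphere_zero_iff_norm.1 hx, one_mul, inner_sub_right, real_inner_self_eq_norm_sq,
        mem_sphere_zero_iff_norm.1 hx] at h1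
      have h2 := (abs_le.1 h1).1
      have h3 := hclose x hxB
      linarith)
  rcases le_total ε (dist (f x) c) with h | h
  · rw [hΦout _ h] at hx0
    exact hQ₁ _ ⟨⟨x, hx, rfl⟩, h⟩ hx0
  · exact hQ₂ _ (hΦin (f x) (hfc x hx) h) hx0

end Brouwer
end PLWidth

namespace PLWidth

/-! ### Cofaces of simplices in a triangulated manifold. -/

section Book

open Metric Filter Topology

variable {E : Type*} [NormedAddCommGroup E] [NormedSpace ℝ E] {n : ℕ}

local notation "𝔼" => EuclideanSpace ℝ (Fin n)

-- The half-space sits in `ℝⁿ`, and only a continuous injection into `ℝⁿ` is wanted, so boundary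
-- points need no separate treatment.
omit [NormedSpace ℝ E] in
theorem exists_local_embedding [NeZero n] {X : Set E} {M : Type*} [TopologicalSpace M]
    [ChartedSpace (EuclideanHalfSpace n) M] (e : X ≃ₜ M) {x₀ : E} (hx₀ : x₀ ∈ X) :
    ∃ Ψ : E → 𝔼, ∃ ε > 0, ContinuousOn Ψ (X ∩ ball x₀ ε) ∧ Set.InjOn Ψ (X ∩ ball x₀ ε) := by
  classical
  let φ := chartAt (EuclideanHalfSpace n) (e ⟨x₀, hx₀⟩)
  let O : Set X := e ⁻¹' φ.source
  have hO : IsOpen O := φ.open_source.preimage e.continuous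
  have hxO : (⟨x₀, hx₀⟩ : X) ∈ O := mem_chart_source _ _
  let ψ : X → 𝔼 := fun x => (φ (e x)).val
  have hψc : ContinuousOn ψ O :=
    continuous_subtype_val.comp_continuousOn
      (φ.continuousOn.comp e.continuous.continuousOn fun x hx => hx)
  have hψi : Set.InjOn ψ O := fun x hx y hy hxy =>
    e.injective (φ.injOn hx hy (Subtype.ext hxy))
  let Ψ : E → 𝔼 := fun x => if h : x ∈ X then ψ ⟨x, h⟩ else 0
  have hΨ : Ψ ∘ (Subtype.val : X → E) = ψ := by
    funext x
    simp [Ψ]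
  obtain ⟨ε, hε, hball⟩ := Metric.isOpen_iff.1 hO _ hxO
  have hsub : X ∩ ball x₀ ε ⊆ Subtype.val '' O := fun x hx => ⟨⟨x, hx.1⟩, hball hx.2, rfl⟩
  refine ⟨Ψ, ε, hε, ContinuousOn.mono ?_ hsub, Set.InjOn.mono hsub ?_⟩
  · rw [Topology.IsInducing.subtypeVal.continuousOn_image_iff, hΨ]
    exact hψc
  · rintro _ ⟨x, hx, rfl⟩ _ ⟨y, hy, rfl⟩ hxy
    have h1 := congrFun hΨ x
    have h2 := congrFun hΨ y
    simp only [Function.comp_apply] at h1 h2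
    rw [h1, h2] at hxy
    rw [hψi hx hy hxy]

variable {K : SimplicialComplex ℝ E} {a : Finset E}

/-- In a triangulated `n`-manifold with boundary no `(n-1)`-simplex is a face of three distinct
`n`-simplices. -/
theorem not_three_cofaces [NeZero n] {M : Type*} [TopologicalSpace M]
    [ChartedSpace (EuclideanHalfSpace n) M] (e : K.space ≃ₜ M) [DecidableEq E] (ha : a.card = n)
    {p₁ p₂ p₃ : E} (h₁ : p₁ ∉ a) (h₂ : p₂ ∉ a) (h₃ : p₃ ∉ a) (h₁₂ : p₁ ≠ p₂) (h₁₃ : p₁ ≠ p₃)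
    (h₂₃ : p₂ ≠ p₃) (hf₁ : insert p₁ a ∈ K.faces) (hf₂ : insert p₂ a ∈ K.faces)
    (hf₃ : insert p₃ a ∈ K.faces) : False := by
  have hn : (0 : ℝ) < n := Nat.cast_pos.2 (Nat.pos_of_neZero n)
  let α := a.equivFinOfCardEq ha
  let ζ : 𝔼 → E → ℝ := fun z v => if h : v ∈ a then z (α ⟨v, h⟩) else 0
  let σ : 𝔼 → ℝ := fun z => ∑ i, z i
  have hζσ : ∀ z, ∑ v ∈ a, ζ z v = σ z := by
    intro z
    rw [← Finset.sum_coe_sort]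
    have : ∀ v : a, ζ z v = z (α v) := fun v => by simp [ζ]
    simp_rw [this]
    exact Equiv.sum_comp α fun i => z i
  have hζle : ∀ z v, |ζ z v| ≤ ‖z‖ := by
    intro z v
    by_cases h : v ∈ a
    · simp only [ζ, h, dite_true]
      rw [← Real.norm_eq_abs]
      exact PiLp.norm_apply_le z _
    · simp [ζ, h]
  have hσle : ∀ z, |σ z| ≤ n * ‖z‖ := by
    intro z
    refine (Finset.abs_sum_le_sum_abs _ _).trans ?_
    refine (Finset.sum_le_card_nsmul _ _ ‖z‖ fun i _ => ?_).trans (by simp)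
    rw [← Real.norm_eq_abs]
    exact PiLp.norm_apply_le z _
  have hζc : ∀ v, Continuous fun z => ζ z v := by
    intro v
    by_cases h : v ∈ a
    · simp only [ζ, h, dite_true]
      fun_prop
    · simp only [ζ, h, dite_false]
      fun_prop
  have hσc : Continuous σ := by fun_prop
  -- A neighbourhood of the barycentre of `a` in the union of the first two simplices is
  -- parametrised by `ℝⁿ`. The weight `|σ z|` goes to `p₁` or `p₂` according to the sign of `σ z`,
  -- and `lam z` distributes the remaining `1 - |σ z|` over `a`. The radius `1 / (3 * n)` keeps all
  -- weights nonnegative.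
  let lam : 𝔼 → E → ℝ := fun z v => 1 / n + ζ z v - (σ z + |σ z|) / n
  have hlam : ∀ z, ∑ v ∈ a, lam z v = 1 - |σ z| := by
    intro z
    simp only [lam]
    rw [Finset.sum_sub_distrib, Finset.sum_add_distrib, hζσ]
    simp only [Finset.sum_const, ha, nsmul_eq_mul]
    field_simp
    ring
  have hlam0 : ∀ z, ‖z‖ ≤ 1 / (3 * n) → ∀ v, 0 ≤ lam z v := by
    intro z hz v
    have e1 := (abs_le.1 (hζle z v)).1
    have e2 := hσle z
    have e3 : σ z ≤ |σ z| := le_abs_self _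
    have e4 : (σ z + |σ z|) / n ≤ 2 * ‖z‖ := by
      rw [div_le_iff₀ hn]; nlinarith
    have e5 : 3 * ‖z‖ ≤ 1 / n := by
      rw [le_div_iff₀ (by positivity)] at hz
      rw [le_div_iff₀ hn]; linarith
    simp only [lam]
    linarith
  let W : 𝔼 → E → ℝ := fun z v =>
    if v = p₁ then max (σ z) 0 else if v = p₂ then max (-σ z) 0 else if v ∈ a then lam z v else 0
  let g : 𝔼 → E := fun z => ∑ v ∈ a, lam z v • v + max (σ z) 0 • p₁ + max (-σ z) 0 • p₂
  have hWa : ∀ z, ∀ v ∈ a, W z v = lam z v := fun z v hv => by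
    have e1 : v ≠ p₁ := fun h => h₁ (h ▸ hv)
    have e2 : v ≠ p₂ := fun h => h₂ (h ▸ hv)
    simp [W, e1, e2, hv]
  have hWp₁ : ∀ z, W z p₁ = max (σ z) 0 := fun z => by simp [W]
  have hWp₂ : ∀ z, W z p₂ = max (-σ z) 0 := fun z => by simp [W, h₁₂.symm]
  have hWo : ∀ z v, v ≠ p₁ → v ≠ p₂ → v ∉ a → W z v = 0 := fun z v e1 e2 e3 => by
    simp [W, e1, e2, e3]
  have hW0 : ∀ z, ‖z‖ ≤ 1 / (3 * n) → ∀ v, 0 ≤ W z v := fun z hz v => by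
    simp only [W]
    split_ifs
    · exact le_max_right _ _
    · exact le_max_right _ _
    · exact hlam0 z hz v
    · exact le_rfl
  have hb₁ : ∀ z, ‖z‖ ≤ 1 / (3 * n) → 0 ≤ σ z → IsBary (insert p₁ a) (W z) (g z) := by
    intro z hz hs
    refine ⟨hW0 z hz, fun v hv => ?_, ?_, ?_⟩
    · rw [Finset.mem_insert, not_or] at hv
      by_cases hvp : v = p₂
      · rw [hvp, hWp₂, max_eq_right (by linarith)]
      · exact hWo z v hv.1 hvp hv.2
    · rw [Finset.sum_insert h₁, hWp₁, Finset.sum_congr rfl (hWa z), hlam, max_eq_left hs,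
        abs_of_nonneg hs]
      ring
    · rw [Finset.sum_insert h₁, hWp₁, Finset.sum_congr rfl fun v hv => by rw [hWa z v hv]]
      simp only [g]
      rw [max_eq_right (show -σ z ≤ 0 by linarith), zero_smul, add_zero, add_comm]
  have hb₂ : ∀ z, ‖z‖ ≤ 1 / (3 * n) → σ z ≤ 0 → IsBary (insert p₂ a) (W z) (g z) := by
    intro z hz hs
    refine ⟨hW0 z hz, fun v hv => ?_, ?_, ?_⟩
    · rw [Finset.mem_insert, not_or] at hv
      by_cases hvp : v = p₁
      · rw [hvp, hWp₁, max_eq_right (by linarith)]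
      · exact hWo z v hvp hv.1 hv.2
    · rw [Finset.sum_insert h₂, hWp₂, Finset.sum_congr rfl (hWa z), hlam, max_eq_left (by linarith),
        abs_of_nonpos hs]
      ring
    · rw [Finset.sum_insert h₂, hWp₂, Finset.sum_congr rfl fun v hv => by rw [hWa z v hv]]
      simp only [g]
      rw [max_eq_right hs, zero_smul, add_zero, add_comm]
  have hgcoord : ∀ z, ‖z‖ ≤ 1 / (3 * n) → g z ∈ K.space ∧ coord K (g z) = W z := by
    intro z hz
    rcases le_total 0 (σ z) with hs | hs
    · exact ⟨SimplicialComplex.mem_space_iff.2 ⟨_, hf₁, (hb₁ z hz hs).mem_convexHull⟩,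
        coord_eq hf₁ (hb₁ z hz hs)⟩
    · exact ⟨SimplicialComplex.mem_space_iff.2 ⟨_, hf₂, (hb₂ z hz hs).mem_convexHull⟩,
        coord_eq hf₂ (hb₂ z hz hs)⟩
  have hginj : ∀ z z', ‖z‖ ≤ 1 / (3 * n) → ‖z'‖ ≤ 1 / (3 * n) → g z = g z' → z = z' := by
    intro z z' hz hz' hgz
    have hW : W z = W z' := by rw [← (hgcoord z hz).2, ← (hgcoord z' hz').2, hgz]
    have e1 := congrFun hW p₁
    have e2 := congrFun hW p₂
    rw [hWp₁, hWp₁] at e1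
    rw [hWp₂, hWp₂] at e2
    have hs : σ z = σ z' := by
      rw [← max_zero_sub_max_neg_zero_eq_self (σ z), ← max_zero_sub_max_neg_zero_eq_self (σ z'), e1, e2]
    ext i
    have e3 := congrFun hW (α.symm i)
    rw [hWa z _ (α.symm i).2, hWa z' _ (α.symm i).2] at e3
    simp only [lam, hs] at e3
    have e4 : ζ z (α.symm i) = ζ z' (α.symm i) := by linarith
    simpa [ζ] using e4
  have hgc : Continuous g := by
    refine ((continuous_finsetSum _ fun v _ => ?_).add ?_).add ?_
    · exact Continuous.smul ((continuous_const.add (hζc v)).sub ((hσc.add hσc.abs).div_const _))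
        continuous_const
    · exact (hσc.max continuous_const).smul continuous_const
    · exact (hσc.neg.max continuous_const).smul continuous_const
  have hr0 : (0 : ℝ) < 1 / (3 * n) := by positivity
  have hx₀ := (hgcoord 0 (by simp)).1
  obtain ⟨Ψ, ε, hε, hΨc, hΨi⟩ := exists_local_embedding (n := n) e hx₀
  obtain ⟨δ, hδ, hgδ⟩ := Metric.continuousAt_iff.1 (hgc.continuousAt (x := 0)) ε hε
  set ρ : ℝ := min (1 / (3 * n)) (δ / 2) with hρ
  have hρ0 : 0 < ρ := by positivity
  have hsmall : ∀ z ∈ closedBall (0 : 𝔼) 1, ‖ρ • z‖ ≤ 1 / (3 * n) ∧ g (ρ • z) ∈ K.space ∩ ball (g 0) ε := by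
    intro z hz
    have e1 : ‖ρ • z‖ ≤ ρ := by
      rw [norm_smul, Real.norm_of_nonneg hρ0.le]
      exact mul_le_of_le_one_right hρ0.le (mem_closedBall_zero_iff.1 hz)
    have e2 : ‖ρ • z‖ ≤ 1 / (3 * n) := e1.trans (min_le_left _ _)
    refine ⟨e2, (hgcoord _ e2).1, hgδ ?_⟩
    rw [dist_zero_right]
    linarith [min_le_right (1 / (3 * n : ℝ)) (δ / 2)]
  -- By invariance of domain the first two simplices already fill a neighbourhood of `Ψ (g 0)` in
  -- `ℝⁿ`. Points of the third simplex close to `g 0` also map there, so by injectivity of `Ψ` they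
  -- would lie in the first two.
  have hint := mem_interior_image_closedBall (n := n) (f := fun z => Ψ (g (ρ • z)))
    (hΨc.comp (hgc.comp (continuous_const_smul ρ)).continuousOn fun z hz => (hsmall z hz).2)
    (fun z hz z' hz' h => by
      have h1 := hΨi (hsmall z hz).2 (hsmall z' hz').2 h
      have h2 := hginj _ _ (hsmall z hz).1 (hsmall z' hz').1 h1
      exact (smul_right_injective 𝔼 hρ0.ne') h2)
  simp only [smul_zero] at hint
  -- points of the third simplex converging to the centre
  let q : ℝ → E := fun t => AffineMap.lineMap (g 0) p₃ t
  have hqc : Continuous q := AffineMap.lineMap_continuous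
  have hq0 : q 0 = g 0 := AffineMap.lineMap_apply_zero _ _
  have hg0a : g 0 ∈ convexHull ℝ ((insert p₃ a : Finset E) : Set E) := by
    have e1 := hb₁ 0 (by simp) (by simp [σ])
    refine (e1.of_support fun v hv => ?_).mem_convexHull
    rw [Finset.mem_insert, not_or] at hv
    by_cases hvp : v = p₁
    · rw [hvp, hWp₁]; simp [σ]
    · exact e1.off v (by simp [hvp, hv.2])
  have hb3 := isBary_coord hf₃ hg0a
  have hqb : ∀ t ∈ Set.Icc (0 : ℝ) 1, q t ∈ K.space ∧ t ≤ coord K (q t) p₃ := by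
    intro t ht
    have hmem : p₃ ∈ insert p₃ a := Finset.mem_insert_self _ _
    have hp3 := isBary_single hmem
    have key : IsBary (insert p₃ a) (fun v => ∑ i : Fin 2, (![1 - t, t]) i *
        (![coord K (g 0), fun v => if v = p₃ then 1 else 0]) i v)
        (∑ i : Fin 2, (![1 - t, t]) i • (![g 0, p₃]) i) := by
      refine IsBary.convex_comb (fun i _ => ?_) ?_ (fun i _ => ?_)
      · fin_cases i
        · simpa using ht.2
        · simpa using ht.1
      · simp
      · fin_cases i
        · exact hb3
        · exact hp3
    have hqt : (∑ i : Fin 2, (![1 - t, t]) i • (![g 0, p₃]) i) = q t := by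
      simp [q, AffineMap.lineMap_apply_module]
    rw [hqt] at key
    refine ⟨SimplicialComplex.mem_space_iff.2 ⟨_, hf₃, key.mem_convexHull⟩, ?_⟩
    rw [coord_eq hf₃ key]
    simp only [Fin.sum_univ_two, Matrix.cons_val_zero, Matrix.cons_val_one, if_true, mul_one]
    have := mul_nonneg (sub_nonneg.2 ht.2) (coord_nonneg K (g 0) p₃)
    linarith
  have hqlim : Tendsto q (𝓝[>] 0) (𝓝[K.space ∩ ball (g 0) ε] (g 0)) := by
    refine tendsto_nhdsWithin_iff.2 ⟨?_, ?_⟩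
    · have := hqc.tendsto 0
      rw [hq0] at this
      exact this.mono_left nhdsWithin_le_nhds
    · have h1 : ∀ᶠ t in 𝓝[>] (0 : ℝ), t ∈ Set.Ioo (0 : ℝ) 1 := Ioo_mem_nhdsGT one_pos
      have h2 : ∀ᶠ t in 𝓝[>] (0 : ℝ), q t ∈ ball (g 0) ε := by
        have := hqc.tendsto 0
        rw [hq0] at this
        exact (this.mono_left nhdsWithin_le_nhds).eventually (ball_mem_nhds _ hε)
      filter_upwards [h1, h2] with t ht ht2
      exact ⟨(hqb t ⟨ht.1.le, ht.2.le⟩).1, ht2⟩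
  have hΨq : Tendsto (fun t => Ψ (q t)) (𝓝[>] 0) (𝓝 (Ψ (g 0))) :=
    (hΨc (g 0) ⟨hx₀, mem_ball_self hε⟩).tendsto.comp hqlim
  have hev := hΨq.eventually (mem_interior_iff_mem_nhds.1 hint)
  have hev2 : ∀ᶠ t in 𝓝[>] (0 : ℝ), t ∈ Set.Ioo (0 : ℝ) 1 := Ioo_mem_nhdsGT one_pos
  have hev3 := (tendsto_nhdsWithin_iff.1 hqlim).2
  obtain ⟨t, ⟨⟨z, hz, hzq⟩, ht, htq⟩⟩ := (hev.and (hev2.and hev3)).exists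
  have heq : g (ρ • z) = q t := hΨi (hsmall z hz).2 htq hzq
  have h1 := (hqb t ⟨ht.1.le, ht.2.le⟩).2
  rw [← heq, (hgcoord _ (hsmall z hz).1).2, hWo _ _ h₁₃.symm h₂₃.symm h₃] at h1
  linarith [ht.1]

/-- In a triangulated `n`-manifold with boundary, an `(n-1)`-simplex is a face of at most two
`n`-simplices. -/
theorem card_cofaces_le_two [NeZero n] {M : Type*} [TopologicalSpace M]
    [ChartedSpace (EuclideanHalfSpace n) M] (e : K.space ≃ₜ M) (ha : a.card = n)
    (T : Finset (Finset E)) (hT : ∀ t ∈ T, t ∈ K.faces ∧ t.card = n + 1 ∧ a ⊆ t) : T.card ≤ 2 := by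
  classical
  by_contra! hc
  obtain ⟨t₁, t₂, t₃, h₁, h₂, h₃, h₁₂, h₁₃, h₂₃⟩ := Finset.two_lt_card_iff.1 hc
  have hins : ∀ t ∈ T, ∃ p, p ∉ a ∧ insert p a = t := by
    intro t ht
    obtain ⟨-, hcard, hsub⟩ := hT t ht
    exact Finset.exists_eq_insert_iff.2 ⟨hsub, by rw [ha, hcard]⟩ |>.imp fun p h => h
  obtain ⟨p₁, hp₁, rfl⟩ := hins t₁ h₁
  obtain ⟨p₂, hp₂, rfl⟩ := hins t₂ h₂
  obtain ⟨p₃, hp₃, rfl⟩ := hins t₃ h₃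
  exact not_three_cofaces e ha hp₁ hp₂ hp₃ (fun h => h₁₂ (by rw [h])) (fun h => h₁₃ (by rw [h]))
    (fun h => h₂₃ (by rw [h])) (hT _ h₁).1 (hT _ h₂).1 (hT _ h₃).1

end Book
end PLWidth

namespace PLWidth

/-! ### Hausdorff measure of hyperplane sections. -/

section HausdorffMeasure

open Metric Filter Topology

/-- On `X` the map `p` factors through `q` by a `C`-Lipschitz map. The form with two maps allows
charts to be compared without inverting them. -/
theorem euclideanHausdorffMeasure_image_le {α Y Z : Type*} [MetricSpace Y] [MeasurableSpace Y]
    [BorelSpace Y] [MetricSpace Z] [MeasurableSpace Z] [BorelSpace Z] {X : Set α} {p : α → Y}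
    {q : α → Z} {C : NNReal} (h : ∀ x ∈ X, ∀ y ∈ X, dist (p x) (p y) ≤ C * dist (q x) (q y))
    (d : ℕ) : μHE[d] (p '' X) ≤ (C : ℝ≥0∞) ^ d * μHE[d] (q '' X) := by
  classical
  rcases X.eq_empty_or_nonempty with rfl | ⟨x₀, hx₀⟩
  · simp
  have : Nonempty α := ⟨x₀⟩
  let r : Z → Y := p ∘ Function.invFunOn q X
  have hr : ∀ x ∈ X, r (q x) = p x := by
    intro x hx
    have hex : ∃ y ∈ X, q y = q x := ⟨x, hx, rfl⟩
    have h1 := h _ (Function.invFunOn_mem hex) x hx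
    rw [Function.invFunOn_eq hex, dist_self, mul_zero] at h1
    exact dist_le_zero.1 h1
  have himg : p '' X = r '' (q '' X) := by
    rw [Set.image_image]
    exact Set.image_congr fun x hx => (hr x hx).symm
  have hlip : LipschitzOnWith C r (q '' X) := by
    refine LipschitzOnWith.of_dist_le_mul ?_
    rintro _ ⟨x, hx, rfl⟩ _ ⟨y, hy, rfl⟩
    rw [hr x hx, hr y hy]
    exact h x hx y hy
  rw [himg]
  have := hlip.hausdorffMeasure_image_le (Nat.cast_nonneg d)
  rw [ENNReal.rpow_natCast] at this
  simp only [Measure.euclideanHausdorffMeasure_def, Measure.smul_apply]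
  rw [mul_smul_comm]
  gcongr

theorem euclideanHausdorffMeasure_image_eq {α Y Z : Type*} [MetricSpace Y] [MeasurableSpace Y]
    [BorelSpace Y] [MetricSpace Z] [MeasurableSpace Z] [BorelSpace Z] {X : Set α} {p : α → Y}
    {q : α → Z} (h : ∀ x ∈ X, ∀ y ∈ X, dist (p x) (p y) = dist (q x) (q y)) (d : ℕ) :
    μHE[d] (p '' X) = μHE[d] (q '' X) := by
  refine le_antisymm ?_ ?_
  · simpa using euclideanHausdorffMeasure_image_le (C := 1)
      (fun x hx y hy => by simpa using (h x hx y hy).le) d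
  · simpa using euclideanHausdorffMeasure_image_le (C := 1)
      (fun x hx y hy => by simpa using (h x hx y hy).ge) d

variable {m : ℕ}

/-- Forget a coordinate. -/
noncomputable def dropCoord (i : Fin (m + 1)) (x : EuclideanSpace ℝ (Fin (m + 1))) :
    EuclideanSpace ℝ (Fin m) := WithLp.toLp 2 fun j => x (i.succAbove j)

theorem norm_sq_dropCoord (i : Fin (m + 1)) (x : EuclideanSpace ℝ (Fin (m + 1))) :
    ‖x‖ ^ 2 = x i ^ 2 + ‖dropCoord i x‖ ^ 2 := by
  rw [EuclideanSpace.real_norm_sq_eq, EuclideanSpace.real_norm_sq_eq, Fin.sum_univ_succAbove _ i]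
  rfl

theorem dropCoord_sub (i : Fin (m + 1)) (x y : EuclideanSpace ℝ (Fin (m + 1))) :
    dropCoord i (x - y) = dropCoord i x - dropCoord i y := rfl

theorem norm_dropCoord_le (i : Fin (m + 1)) (x : EuclideanSpace ℝ (Fin (m + 1))) :
    ‖dropCoord i x‖ ≤ ‖x‖ := by
  have := norm_sq_dropCoord i x
  exact abs_le_of_sq_le_sq' (by nlinarith [sq_nonneg (x i)]) (norm_nonneg _) |>.2

theorem dist_dropCoord_le (i : Fin (m + 1)) (x y : EuclideanSpace ℝ (Fin (m + 1))) :
    dist (dropCoord i x) (dropCoord i y) ≤ dist x y := by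
  rw [dist_eq_norm, dist_eq_norm, ← dropCoord_sub]
  exact norm_dropCoord_le i _

theorem continuous_dropCoord (i : Fin (m + 1)) :
    Continuous (dropCoord i : EuclideanSpace ℝ (Fin (m + 1)) → EuclideanSpace ℝ (Fin m)) :=
  (LipschitzWith.of_dist_le_mul (K := 1) fun x y => by simpa using dist_dropCoord_le i x y).continuous

/-- On a hyperplane whose normal vector is bounded by a multiple of its `i`-th coordinate,
forgetting this coordinate is bi-Lipschitz. -/
theorem norm_le_of_inner_eq_zero {i : Fin (m + 1)} {ν w : EuclideanSpace ℝ (Fin (m + 1))} {C : ℝ}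
    (hi : ν i ≠ 0) (hC : ‖dropCoord i ν‖ ≤ C * |ν i|) (h : inner ℝ ν w = 0) :
    ‖w‖ ≤ (1 + C) * ‖dropCoord i w‖ := by
  have hνi : 0 < |ν i| := abs_pos.2 hi
  have hC0 : 0 ≤ C := by
    by_contra hc
    have : C * |ν i| < 0 := mul_neg_of_neg_of_pos (not_le.1 hc) hνi
    linarith [norm_nonneg (dropCoord i ν)]
  have h1 : inner ℝ ν w = ν i * w i + inner ℝ (dropCoord i ν) (dropCoord i w) := by
    simp only [PiLp.inner_apply, Fin.sum_univ_succAbove _ i]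
    simp [dropCoord, mul_comm]
  have h2 : |ν i| * |w i| ≤ |ν i| * (C * ‖dropCoord i w‖) := by
    rw [← abs_mul, show ν i * w i = - inner ℝ (dropCoord i ν) (dropCoord i w) by linarith, abs_neg]
    refine (abs_real_inner_le_norm _ _).trans ?_
    have := mul_le_mul_of_nonneg_right hC (norm_nonneg (dropCoord i w))
    linarith
  have h3 := le_of_mul_le_mul_left h2 hνi
  refine abs_le_of_sq_le_sq' ?_ (by positivity) |>.2
  rw [norm_sq_dropCoord i w, ← sq_abs (w i)]
  have h4 := pow_le_pow_left₀ (abs_nonneg _) h3 2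
  nlinarith [sq_nonneg ‖dropCoord i w‖, mul_nonneg hC0 (sq_nonneg ‖dropCoord i w‖)]

/-- The section is a Lipschitz graph over its projection, which stays in the thickened projection of
`a`. -/
theorem measure_section_le {i : Fin (m + 1)} {ν : EuclideanSpace ℝ (Fin (m + 1))} {C : NNReal}
    (hi : ν i ≠ 0) (hC : ‖dropCoord i ν‖ ≤ C * |ν i|) {X a : Set (EuclideanSpace ℝ (Fin (m + 1)))}
    {d δ : ℝ} (hX : ∀ x ∈ X, inner ℝ ν x = d) (ha : ∀ x ∈ X, ∃ y ∈ a, dist x y ≤ δ) :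
    μHE[m] X ≤ ((1 + C : NNReal) : ℝ≥0∞) ^ m * volume (cthickening δ (dropCoord i '' a)) := by
  have h1 : μHE[m] (id '' X) ≤ ((1 + C : NNReal) : ℝ≥0∞) ^ m * μHE[m] (dropCoord i '' X) := by
    refine euclideanHausdorffMeasure_image_le (fun x hx y hy => ?_) m
    rw [dist_eq_norm, dist_eq_norm, ← dropCoord_sub]
    push_cast
    exact norm_le_of_inner_eq_zero hi hC (by simp [inner_sub_right, hX x hx, hX y hy])
  rw [Set.image_id] at h1
  refine h1.trans (mul_le_mul_right ?_ _)
  rw [EuclideanSpace.euclideanHausdorffMeasure_eq_volume]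
  refine measure_mono ?_
  rintro _ ⟨x, hx, rfl⟩
  obtain ⟨y, hy, hxy⟩ := ha x hx
  exact mem_cthickening_of_dist_le _ _ _ _ ⟨y, hy, rfl⟩ ((dist_dropCoord_le i x y).trans hxy)

/-- There are two cases for the normal `ν`. If the section is nearly parallel to the hyperplane of
`a`, forgetting coordinate `0` distorts it by at most `1 + κ`, and its projection lies in a thin
neighbourhood of that of `a`. If it is steep, some other coordinate can be forgotten with distortion
at most `1 + C`; the projection of `a` is then a null set, with thickenings of small volume. As `κ`
and `C` do not depend on the section, one `δ` serves for all. -/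
theorem exists_thin_coord {a : Set (EuclideanSpace ℝ (Fin (m + 1)))} (ha : IsCompact a) {c : ℝ}
    (hac : ∀ x ∈ a, x 0 = c) {ε : ℝ≥0∞} (hε : ε ≠ 0) (hε' : ε ≠ ∞) :
    ∃ δ : ℝ, 0 < δ ∧ ∀ X : Set (EuclideanSpace ℝ (Fin (m + 1))), ∀ ν, ν ≠ 0 → ∀ d : ℝ,
      (∀ x ∈ X, inner ℝ ν x = d) → (∀ x ∈ X, ∃ y ∈ a, dist x y ≤ δ) →
      μHE[m] X ≤ μHE[m] a + ε := by
  have hcomp : ∀ i, IsCompact (dropCoord i '' a) := fun i => ha.image (continuous_dropCoord i)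
  have hV : volume (dropCoord 0 '' a) ≤ μHE[m] a := by
    have := euclideanHausdorffMeasure_image_le (X := a) (p := dropCoord 0) (q := id) (C := 1)
      (fun x _ y _ => by simpa using dist_dropCoord_le 0 x y) m
    rwa [ENNReal.coe_one, one_pow, one_mul, Set.image_id,
      EuclideanSpace.euclideanHausdorffMeasure_eq_volume] at this
  set V := volume (dropCoord 0 '' a) with hVdef
  have hVfin : V ≠ ∞ := (hcomp 0).measure_lt_top.ne
  -- the slope below which sections are compared with `a`
  obtain ⟨κ, hκ0, hκ⟩ : ∃ κ : NNReal, 0 < κ ∧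
      ((1 + κ : NNReal) : ℝ≥0∞) ^ m * (V + ε / 2) ≤ V + ε := by
    have hlim : Tendsto (fun κ : NNReal => ((1 + κ : NNReal) : ℝ≥0∞) ^ m * (V + ε / 2)) (𝓝 0)
        (𝓝 ((((1 + 0 : NNReal) : ℝ≥0∞)) ^ m * (V + ε / 2))) := by
      refine ENNReal.Tendsto.mul_const ?_ (Or.inl (by simp))
      have hc : Continuous fun κ : NNReal => ((1 + κ : NNReal) : ℝ≥0∞) ^ m :=
        (ENNReal.continuous_pow m).comp (ENNReal.continuous_coe.comp (continuous_const.add continuous_id))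
      exact hc.tendsto 0
    rw [add_zero, ENNReal.coe_one, one_pow, one_mul] at hlim
    have hlt : V + ε / 2 < V + ε := ENNReal.add_lt_add_left hVfin (ENNReal.half_lt_self hε hε')
    have h1 : ∀ᶠ κ : NNReal in 𝓝[>] 0, ((1 + κ : NNReal) : ℝ≥0∞) ^ m * (V + ε / 2) < V + ε :=
      (hlim.mono_left nhdsWithin_le_nhds).eventually (gt_mem_nhds hlt)
    obtain ⟨κ, h, hκ⟩ := (h1.and self_mem_nhdsWithin).exists
    exact ⟨κ, hκ, h.le⟩
  -- the other coordinate projections of `a` are null sets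
  have hnull : ∀ i : Fin (m + 1), i ≠ 0 → volume (dropCoord i '' a) = 0 := by
    intro i hi
    obtain ⟨k, hk⟩ := Fin.exists_succAbove_eq (x := 0) (y := i) hi.symm
    have hsub : dropCoord i '' a ⊆ (WithLp.ofLp : EuclideanSpace ℝ (Fin m) → _) ⁻¹' {f | f k = c} := by
      rintro _ ⟨x, hx, rfl⟩
      simp only [Set.mem_preimage, Set.mem_ofPred_eq, dropCoord, hk]
      exact hac x hx
    refine measure_mono_null hsub ?_
    have hms : MeasurableSet {f : Fin m → ℝ | f k = c} :=
      measurableSet_eq_fun (measurable_pi_apply k) measurable_const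
    rw [(PiLp.volume_preserving_ofLp (Fin m)).measure_preimage hms.nullMeasurableSet]
    exact Measure.pi_hyperplane (fun _ : Fin m => (volume : Measure ℝ)) k c
  set C : NNReal := (m + 1) / κ + (m + 1) with hC
  have hev : ∀ i : Fin (m + 1), ∀ᶠ δ : ℝ in 𝓝[>] 0, i ≠ 0 →
      ((1 + C : NNReal) : ℝ≥0∞) ^ m * volume (cthickening δ (dropCoord i '' a)) ≤ ε := by
    intro i
    by_cases hi : i = 0
    · exact Eventually.of_forall fun _ h => absurd hi h
    have hlim := ENNReal.Tendsto.const_mul (a := ((1 + C : NNReal) : ℝ≥0∞) ^ m)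
      (tendsto_measure_cthickening_of_isCompact (μ := volume) (hcomp i))
      (Or.inr (ENNReal.pow_ne_top ENNReal.coe_ne_top))
    rw [hnull i hi, mul_zero] at hlim
    filter_upwards [(hlim.mono_left nhdsWithin_le_nhds).eventually
      (gt_mem_nhds (pos_iff_ne_zero.2 hε))] with δ h _ using h.le
  have hev0 : ∀ᶠ δ : ℝ in 𝓝[>] 0, volume (cthickening δ (dropCoord 0 '' a)) ≤ V + ε / 2 := by
    have hlim := tendsto_measure_cthickening_of_isCompact (μ := volume) (hcomp 0)
    have hlt : V < V + ε / 2 :=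
      ENNReal.lt_add_right hVfin (ENNReal.half_pos hε).ne'
    filter_upwards [(hlim.mono_left nhdsWithin_le_nhds).eventually (gt_mem_nhds hlt)] with δ h
      using h.le
  obtain ⟨δ, ⟨h1, h0⟩, hδ⟩ := ((eventually_all.2 hev).and hev0 |>.and self_mem_nhdsWithin).exists
  refine ⟨δ, hδ, fun X ν hν d hX hXa => ?_⟩
  by_cases hcase : ‖dropCoord 0 ν‖ ≤ κ * |ν 0|
  · have hν0 : ν 0 ≠ 0 := by
      intro h
      rw [h, abs_zero, mul_zero] at hcase
      have := norm_sq_dropCoord 0 ν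
      rw [h, le_antisymm hcase (norm_nonneg _)] at this
      exact hν (norm_eq_zero.1 (by simpa using this))
    calc μHE[m] X ≤ _ := measure_section_le hν0 hcase hX hXa
      _ ≤ ((1 + κ : NNReal) : ℝ≥0∞) ^ m * (V + ε / 2) := mul_le_mul_right h0 _
      _ ≤ V + ε := hκ
      _ ≤ _ := add_le_add_left hV _
  · rw [not_le] at hcase
    have hκ0' : (0 : ℝ) < κ := hκ0
    have hm1 : (0 : ℝ) ≤ m := Nat.cast_nonneg m
    -- The largest entry of `ν` away from index `0`, whose own entry is replaced by zero. Were `0`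
    -- the maximiser, all other entries would vanish, against `hcase`.
    obtain ⟨i, -, hi⟩ := Finset.exists_max_image (Finset.univ : Finset (Fin (m + 1)))
      (fun i => if i = 0 then 0 else |ν i|) ⟨0, Finset.mem_univ _⟩
    have hle : ∀ j : Fin (m + 1), j ≠ 0 → |ν j| ≤ if i = 0 then 0 else |ν i| := fun j hj => by
      have := hi j (Finset.mem_univ j)
      simpa only [hj, if_false] using this
    have hsum : ‖dropCoord 0 ν‖ ≤ m * if i = 0 then 0 else |ν i| := by
      have e1 : ‖dropCoord 0 ν‖ ≤ ∑ j : Fin m, |ν j.succ| := by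
        have := EuclideanSpace.real_norm_sq_eq (dropCoord 0 ν)
        refine abs_le_of_sq_le_sq' ?_ (Finset.sum_nonneg fun _ _ => abs_nonneg _) |>.2
        rw [this]
        refine le_trans (le_of_eq ?_) (Finset.sum_sq_le_sq_sum_of_nonneg (s := Finset.univ)
          (f := fun j : Fin m => |ν j.succ|) fun _ _ => abs_nonneg _)
        exact Finset.sum_congr rfl fun j _ => by simp [dropCoord, sq_abs]
      refine e1.trans ((Finset.sum_le_card_nsmul _ _ _ fun j _ =>
        hle j.succ (Fin.succ_ne_zero j)).trans (by simp))
    have hi0 : i ≠ 0 := by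
      intro h
      rw [if_pos h, mul_zero] at hsum
      have : 0 ≤ κ * |ν 0| := by positivity
      linarith
    rw [if_neg hi0] at hsum
    have hνi : 0 < |ν i| := by
      by_contra h
      have h' : |ν i| = 0 := le_antisymm (not_lt.1 h) (abs_nonneg _)
      rw [h', mul_zero] at hsum
      have : 0 ≤ κ * |ν 0| := by positivity
      linarith
    have hν0 : |ν 0| ≤ m / κ * |ν i| := by
      rw [div_mul_eq_mul_div, le_div_iff₀ hκ0']
      linarith
    have hCle : ‖dropCoord i ν‖ ≤ C * |ν i| := by
      have e1 : ‖dropCoord i ν‖ ≤ ‖ν‖ := norm_dropCoord_le i ν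
      have e2 : ‖ν‖ ≤ |ν 0| + ‖dropCoord 0 ν‖ := by
        refine abs_le_of_sq_le_sq' ?_ (by positivity) |>.2
        rw [norm_sq_dropCoord 0 ν, ← sq_abs (ν 0)]
        nlinarith [mul_nonneg (abs_nonneg (ν 0)) (norm_nonneg (dropCoord 0 ν))]
      have e3 : (C : ℝ) = (m + 1) / κ + (m + 1) := by simp [hC]
      have e4 : (m : ℝ) / κ * |ν i| ≤ (m + 1) / κ * |ν i| := by gcongr; linarith
      rw [e3]
      nlinarith
    calc μHE[m] X ≤ _ := measure_section_le (abs_pos.1 hνi) hCle hX hXa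
      _ ≤ ε := h1 i hi0
      _ ≤ _ := le_add_self

/-- Hyperplane sections of small neighbourhoods of a compact subset `a` of a hyperplane have
`(n-1)`-volume at most slightly larger than that of `a`, uniformly in the section. -/
theorem exists_thin {n : ℕ} [NeZero n] {a : Set (EuclideanSpace ℝ (Fin n))} (ha : IsCompact a)
    {e : EuclideanSpace ℝ (Fin n)} (he : e ≠ 0) {c : ℝ} (hac : ∀ x ∈ a, inner ℝ e x = c)
    {ε : ℝ≥0∞} (hε : ε ≠ 0) (hε' : ε ≠ ∞) :
    ∃ δ : ℝ, 0 < δ ∧ ∀ X : Set (EuclideanSpace ℝ (Fin n)), ∀ ν, ν ≠ 0 → ∀ d : ℝ,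
      (∀ x ∈ X, inner ℝ ν x = d) → (∀ x ∈ X, ∃ y ∈ a, dist x y ≤ δ) →
      μHE[n - 1] X ≤ μHE[n - 1] a + ε := by
  obtain ⟨m, rfl⟩ := Nat.exists_eq_succ_of_ne_zero (NeZero.ne n)
  simp only [Nat.succ_eq_add_one, Nat.add_sub_cancel] at *
  have hne : ‖e‖ ≠ 0 := norm_ne_zero_iff.2 he
  -- A rotation taking `e` to the direction of axis `0` reduces the claim to `exists_thin_coord`.
  obtain ⟨b, hb⟩ := Orthonormal.exists_orthonormalBasis_extension_of_card_eq (𝕜 := ℝ)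
    (E := EuclideanSpace ℝ (Fin (m + 1))) (ι := Fin (m + 1)) (by simp)
    (v := fun _ => ‖e‖⁻¹ • e) (s := {0}) (by
      refine ⟨fun i => ?_, fun i j hij => absurd (Subsingleton.elim i j) hij⟩
      simp [Set.domRestrict, norm_smul, hne])
  have hb0 : b 0 = ‖e‖⁻¹ • e := hb 0 rfl
  let T := b.repr
  have hT0 : ∀ x ∈ a, T x 0 = ‖e‖⁻¹ * c := fun x hx => by
    rw [b.repr_apply_apply, hb0, real_inner_smul_left, hac x hx]
  obtain ⟨δ, hδ, h⟩ := exists_thin_coord (a := T '' a) (ha.image T.continuous) (c := ‖e‖⁻¹ * c)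
    (by rintro _ ⟨x, hx, rfl⟩; exact hT0 x hx) hε hε'
  have himg : ∀ X : Set (EuclideanSpace ℝ (Fin (m + 1))), μHE[m] (T '' X) = μHE[m] X := fun X => by
    have := euclideanHausdorffMeasure_image_eq (X := X) (p := T) (q := id)
      (fun x _ y _ => T.dist_map x y) m
    rwa [Set.image_id] at this
  refine ⟨δ, hδ, fun X ν hν d hX hXa => ?_⟩
  have := h (T '' X) (T ν) (by simpa using hν) d
    (by rintro _ ⟨x, hx, rfl⟩; rw [T.inner_map_map]; exact hX x hx)
    (by
      rintro _ ⟨x, hx, rfl⟩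
      obtain ⟨y, hy, hxy⟩ := hXa x hx
      exact ⟨T y, ⟨y, hy, rfl⟩, by rwa [T.dist_map]⟩)
  rwa [himg, himg] at this

/-- The convex hull of at most `d` points is a null set for the `d`-dimensional measure. -/
theorem euclideanHausdorffMeasure_convexHull_eq_zero {E : Type*} [AddCommGroup E] [Module ℝ E]
    {n d : ℕ} {t : Finset E} (ht : t.card ≤ d) (f : E →ᵃ[ℝ] EuclideanSpace ℝ (Fin n)) :
    μHE[d] (f '' convexHull ℝ (t : Set E)) = 0 := by
  classical
  rcases t.eq_empty_or_nonempty with rfl | ⟨v₀, hv₀⟩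
  · simp
  obtain ⟨s, hs⟩ : ∃ s, s = t.erase v₀ := ⟨_, rfl⟩
  -- The weight of `v₀` is determined by the others, so the hull is parametrised smoothly by `t.card
  -- - 1` parameters and has dimension below `d`.
  let g : (s → ℝ) → EuclideanSpace ℝ (Fin n) := fun w => f v₀ + ∑ v : s, w v • (f (v : E) - f v₀)
  have hg : ContDiff ℝ 1 g := by fun_prop
  have hsub : f '' convexHull ℝ (t : Set E) ⊆ Set.range g := by
    rintro _ ⟨x, hx, rfl⟩
    obtain ⟨w, hw⟩ := mem_convexHull_iff_isBary.1 hx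
    refine ⟨fun v => w v, ?_⟩
    simp only [g]
    rw [Finset.sum_coe_sort s fun v => w v • (f v - f v₀), hs, hw.map_affine f]
    have h1 : ∑ v ∈ t.erase v₀, w v • (f v - f v₀) = ∑ v ∈ t, w v • (f v - f v₀) := by
      rw [← Finset.add_sum_erase t _ hv₀]
      simp
    rw [h1]
    simp_rw [smul_sub]
    rw [Finset.sum_sub_distrib, ← Finset.sum_smul, hw.sum_eq]
    simp
  have hdim : dimH (f '' convexHull ℝ (t : Set E)) < d := by
    refine (dimH_mono hsub).trans_lt ((hg.dimH_range_le).trans_lt ?_)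
    rw [Module.finrank_fintype_fun_eq_card, Fintype.card_coe, hs, Finset.card_erase_of_mem hv₀]
    have := Finset.card_pos.2 ⟨v₀, hv₀⟩
    exact_mod_cast (by omega : t.card - 1 < d)
  have : μH[d] (f '' convexHull ℝ (t : Set E)) = 0 := by
    have := hausdorffMeasure_of_dimH_lt (d := (d : NNReal)) (s := f '' convexHull ℝ (t : Set E))
      (by simpa using hdim)
    simpa using this
  simp [Measure.euclideanHausdorffMeasure_def, this]

end HausdorffMeasure
end PLWidth

namespace PLWidth

/-! ### Metric properties of the charts. -/

section Charts

variable {E : Type*} [AddCommGroup E] [Module ℝ E] {n : ℕ}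
  {K L : SimplicialComplex ℝ E} {s t : Finset E} {w w' : E → ℝ} {x y : E}

theorem FlatStructure.chart_injOn (F : FlatStructure n K) (hs : s ∈ K.faces) :
    Set.InjOn (F.chart s) (convexHull ℝ (s : Set E)) := by
  intro x hx y hy hxy
  have h := isBary_coord hs hx
  have h' := isBary_coord hs hy
  rw [h.map_affine, h'.map_affine] at hxy
  have := weights_unique (F.affineIndependent_chart s hs) h.off h'.off
    (h.sum_eq.trans h'.sum_eq.symm) hxy
  rw [← h.comb, ← h'.comb, this]

theorem FlatStructure.chart_apply_eq_affineCombination (F : FlatStructure n K) {σ : Finset E}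
    (h : IsBary s w x) : F.chart σ x =
      Finset.univ.affineCombination ℝ (fun v : s => F.chart σ v) (fun v : s => w v) := by
  rw [Finset.affineCombination_eq_linear_combination _ _ _ (by
    rw [Finset.sum_coe_sort s w]; exact h.sum_eq), h.map_affine]
  exact (Finset.sum_coe_sort s fun v => w v • F.chart σ v).symm

/-- The charts of a simplex and of its faces induce the same distances. -/
theorem FlatStructure.dist_chart_eq (F : FlatStructure n K) (hs : s ∈ K.faces) (ht : t ∈ K.faces)
    (hst : s ⊆ t) (hx : x ∈ convexHull ℝ (s : Set E)) (hy : y ∈ convexHull ℝ (s : Set E)) :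
    dist (F.chart s x) (F.chart s y) = dist (F.chart t x) (F.chart t y) := by
  have h := isBary_coord hs hx
  have h' := isBary_coord hs hy
  have h1 : ∑ v : s, coord K x v = 1 := by
    rw [Finset.sum_coe_sort s (coord K x)]; exact h.sum_eq
  have h2 : ∑ v : s, coord K y v = 1 := by
    rw [Finset.sum_coe_sort s (coord K y)]; exact h'.sum_eq
  rw [F.chart_apply_eq_affineCombination h, F.chart_apply_eq_affineCombination h',
    F.chart_apply_eq_affineCombination h, F.chart_apply_eq_affineCombination h']
  refine (mul_self_inj dist_nonneg dist_nonneg).1 ?_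
  -- The distance of two affine combinations depends only on the weights and on the distances
  -- between the vertices.
  rw [EuclideanGeometry.dist_affineCombination _ h1 h2,
    EuclideanGeometry.dist_affineCombination _ h1 h2]
  congr 2
  refine Finset.sum_congr rfl fun u _ => Finset.sum_congr rfl fun v _ => ?_
  rw [F.dist_chart s hs t ht hst u u.2 v v.2]

/-- The charts are affine isomorphisms on simplices inside a face. -/
theorem FlatStructure.affineIndependent_of_subset (F : FlatStructure n K) (hs : s ∈ K.faces)
    (ht : AffineIndependent ℝ (fun v : t => (v : E)))
    (hts : convexHull ℝ (t : Set E) ⊆ convexHull ℝ (s : Set E)) :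
    AffineIndependent ℝ (fun v : t => F.chart s v) := by
  refine affineIndependent_of_unique_weights fun w w' h0 h0' h1 h1' h2 h2' h3 => ?_
  have hb : IsBary t w (∑ v ∈ t, w v • v) := ⟨h0, h1, h2, rfl⟩
  have hb' : IsBary t w' (∑ v ∈ t, w' v • v) := ⟨h0', h1', h2', rfl⟩
  have := F.chart_injOn hs (hts hb.mem_convexHull) (hts hb'.mem_convexHull)
    (by rw [hb.map_affine, hb'.map_affine, h3])
  rw [← this] at hb'
  exact hb.unique ht hb'

theorem FlatStructure.card_le_of_subset (F : FlatStructure n K) (hs : s ∈ K.faces)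
    (ht : AffineIndependent ℝ (fun v : t => (v : E)))
    (hts : convexHull ℝ (t : Set E) ⊆ convexHull ℝ (s : Set E)) : t.card ≤ n + 1 := by
  have h := (F.affineIndependent_of_subset hs ht hts).card_le_finrank_succ
  have h2 := Submodule.finrank_le (vectorSpan ℝ (Set.range fun v : t => F.chart s v))
  rw [finrank_euclideanSpace_fin] at h2
  rw [Fintype.card_coe] at h
  omega

theorem FlatStructure.isCompact_chart_image (F : FlatStructure n K) (s t : Finset E) :
    IsCompact (F.chart s '' convexHull ℝ (t : Set E)) := by
  rw [AffineMap.image_convexHull]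
  exact (t.finite_toSet.image (F.chart s)).isCompact_convexHull (𝕜 := ℝ)

/-- As the chart is injective, the image is a compact set minus finitely many compact sets. This
serves to add the volumes of disjoint open simplices. -/
theorem FlatStructure.measurableSet_chart_image (F : FlatStructure n K) (hs : s ∈ K.faces)
    (hts : convexHull ℝ (t : Set E) ⊆ convexHull ℝ (s : Set E)) :
    MeasurableSet (F.chart s '' openSimplex t) := by
  have hsub : ∀ u ⊂ t, convexHull ℝ (u : Set E) ⊆ convexHull ℝ (t : Set E) := fun u hu =>
    convexHull_mono hu.1
  have h : F.chart s '' openSimplex t = F.chart s '' convexHull ℝ (t : Set E) \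
      ⋃ u ∈ {u : Finset E | u ⊂ t}, F.chart s '' convexHull ℝ (u : Set E) := by
    have h1 : (⋃ u ∈ {u : Finset E | u ⊂ t}, convexHull ℝ (u : Set E)) ⊆ convexHull ℝ (t : Set E) :=
      Set.iUnion₂_subset hsub
    rw [openSimplex, ((F.chart_injOn hs).mono hts).image_sdiff_subset h1, Set.image_iUnion₂]
  rw [h]
  refine (F.isCompact_chart_image s t).measurableSet.diff (MeasurableSet.biUnion ?_ fun u _ =>
    (F.isCompact_chart_image s u).measurableSet)
  refine (t.powerset.finite_toSet.subset fun u hu => ?_).countable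
  exact Finset.mem_coe.2 (Finset.mem_powerset.2 hu.1)

theorem FlatStructure.vol_eq_sum (F : FlatStructure n K) (hfin : K.faces.Finite) (k : ℕ)
    (A : Set E) : F.vol k A = ∑ s ∈ hfin.toFinset, μHE[k] (F.chart s '' (A ∩ openSimplex s)) := by
  classical
  rw [FlatStructure.vol, tsum_subtype K.faces fun s => μHE[k] (F.chart s '' (A ∩ openSimplex s)),
    tsum_eq_sum (s := hfin.toFinset)]
  · exact Finset.sum_congr rfl fun s hs => Set.indicator_of_mem (hfin.mem_toFinset.1 hs) _
  · intro s hs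
    exact Set.indicator_of_notMem (fun h => hs (hfin.mem_toFinset.2 h)) _

end Charts

/-! ### Lipschitz bounds for piecewise affine maps. -/

section Lipschitz

open Filter Topology

/-- A map which is Lipschitz on each of finitely many closed pieces of an interval is Lipschitz. -/
theorem norm_sub_le_of_closed_cover {V ι : Type*} [NormedAddCommGroup V] [Finite ι]
    {P : ι → Set ℝ} (hP : ∀ i, IsClosed (P i)) (hcov : Set.Icc (0 : ℝ) 1 ⊆ ⋃ i, P i) {h : ℝ → V}
    {C : ℝ} (hlip : ∀ i, ∀ a ∈ P i, ∀ b ∈ P i, ‖h a - h b‖ ≤ C * |a - b|) :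
    ‖h 1 - h 0‖ ≤ C := by
  have hcont : ContinuousOn h (Set.Icc 0 1) := by
    refine ContinuousOn.mono ?_ hcov
    refine (locallyFinite_of_finite P).continuousOn_iUnion hP fun i => ?_
    have : LipschitzOnWith C.toNNReal h (P i) := by
      refine LipschitzOnWith.of_dist_le_mul fun a ha b hb => ?_
      rw [dist_eq_norm, Real.dist_eq]
      refine (hlip i a ha b hb).trans (mul_le_mul_of_nonneg_right ?_ (abs_nonneg _))
      exact Real.le_coe_toNNReal C
    exact this.continuousOn
  refine le_of_forall_pos_le_add fun η hη => ?_
  have key := image_norm_le_of_liminf_right_slope_norm_lt_deriv_boundary (a := 0) (b := 1)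
    (f := fun τ => h τ - h 0) (f' := fun _ => C) (B := fun τ => (C + η) * τ)
    (B' := fun _ => C + η) (hcont.sub continuousOn_const) ?_ (by simp) (by fun_prop)
    (fun x _ => by simpa using ((hasDerivAt_id x).const_mul (C + η)).hasDerivWithinAt)
    (fun _ _ _ => by linarith) (x := 1) (by simp)
  · simpa using key
  intro x hx r hr
  have hev : ∀ᶠ z in 𝓝[>] x, z ∈ Set.Ioo x 1 := Ioo_mem_nhdsGT hx.2
  -- One of the finitely many pieces recurs immediately to the right of `x`; being closed it
  -- contains `x`, and it bounds the slope along a sequence, which the mean value inequality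
  -- requires.
  obtain ⟨i, hi⟩ : ∃ i, ∃ᶠ z in 𝓝[>] x, z ∈ P i := by
    by_contra! hc
    obtain ⟨z, hz, hz'⟩ := (hev.and (eventually_all.2 hc)).exists
    obtain ⟨i, hi⟩ := Set.mem_iUnion.1 (hcov ⟨hx.1.trans hz.1.le, hz.2.le⟩)
    exact hz' i hi
  have hxi : x ∈ P i := by
    rw [← (hP i).closure_eq, mem_closure_iff_frequently]
    exact hi.filter_mono nhdsWithin_le_nhds
  refine (hi.and_eventually hev).mono fun z hz => ?_
  have hzx : 0 < z - x := sub_pos.2 hz.2.1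
  rw [slope_def_field, Function.comp_apply, Function.comp_apply, div_lt_iff₀ hzx]
  have h1 := hlip i z hz.1 x hxi
  rw [abs_of_pos hzx] at h1
  have h2 := norm_sub_norm_le (h z - h 0) (h x - h 0)
  rw [sub_sub_sub_cancel_right] at h2
  have h3 : C * (z - x) < r * (z - x) := mul_lt_mul_of_pos_right hr hzx
  linarith

variable {E : Type*} [AddCommGroup E] [Module ℝ E] {n : ℕ}
  {K L : SimplicialComplex ℝ E} {s t : Finset E} {w w' : E → ℝ} {x y : E}

/-- In a chart, maps which are affine on the simplices of a subdivision are Lipschitz. -/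
theorem FlatStructure.exists_lipschitz (F : FlatStructure n K) (hL : IsSubdivision L K)
    (hs : s ∈ K.faces) {V : Type*} [NormedAddCommGroup V] [NormedSpace ℝ V] (g : E → V) :
    ∃ C : ℝ, ∀ x ∈ convexHull ℝ (s : Set E), ∀ y ∈ convexHull ℝ (s : Set E),
      ‖interp L g x - interp L g y‖ ≤ C * dist (F.chart s x) (F.chart s y) := by
  classical
  let I := {t : Finset E // t ∈ L.faces ∧ convexHull ℝ (t : Set E) ⊆ convexHull ℝ (s : Set E)}
  have : Finite I := (hL.finite.subset fun t (ht : t ∈ L.faces ∧ _) => ht.1).to_subtype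
  have hB : ∀ t : I, ∃ C : NNReal, ∀ x ∈ convexHull ℝ (t.1 : Set E),
      ∀ y ∈ convexHull ℝ (t.1 : Set E),
      ‖interp L g x - interp L g y‖ ≤ C * dist (F.chart s x) (F.chart s y) := by
    rintro ⟨t, ht, hts⟩
    obtain ⟨B, hB⟩ := exists_affineMap (F.affineIndependent_of_subset hs (L.indep ht) hts) g
    have hBi : ∀ x ∈ convexHull ℝ (t : Set E), interp L g x = B (F.chart s x) := by
      intro x hx
      have hb := isBary_coord ht hx
      rw [interp_eq g ht hx]
      have := hb.map_affine (B.comp (F.chart s))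
      rw [AffineMap.comp_apply] at this
      rw [this]
      exact Finset.sum_congr rfl fun v hv => by rw [AffineMap.comp_apply, hB v hv]
    refine ⟨‖LinearMap.toContinuousLinearMap B.linear‖₊, fun x hx y hy => ?_⟩
    rw [hBi x hx, hBi y hy, ← vsub_eq_sub, ← B.linearMap_vsub, dist_eq_norm, vsub_eq_sub]
    exact (LinearMap.toContinuousLinearMap B.linear).le_opNorm _
  choose C hC using hB
  obtain ⟨M, hM⟩ := (Set.finite_range C).bddAbove
  have hCM : ∀ t, C t ≤ M := fun t => hM ⟨t, rfl⟩
  refine ⟨M, fun x hx y hy => ?_⟩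
  -- The simplices of `L` inside `s` cut the segment into finitely many closed pieces, on each of
  -- which the map is affine in the chart.
  let γ : ℝ → E := fun τ => AffineMap.lineMap y x τ
  have hγ : ∀ τ, F.chart s (γ τ) = AffineMap.lineMap (F.chart s y) (F.chart s x) τ := fun τ =>
    AffineMap.apply_lineMap _ _ _ _
  have hγs : ∀ τ ∈ Set.Icc (0 : ℝ) 1, γ τ ∈ convexHull ℝ (s : Set E) := fun τ hτ =>
    (convex_convexHull ℝ _).lineMap_mem hy hx hτ
  have hγd : ∀ a b, dist (F.chart s (γ a)) (F.chart s (γ b)) =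
      |a - b| * dist (F.chart s x) (F.chart s y) := fun a b => by
    rw [hγ, hγ, dist_lineMap_lineMap, Real.dist_eq, dist_comm (F.chart s y)]
  have key := norm_sub_le_of_closed_cover (P := fun t : I =>
      Set.Icc (0 : ℝ) 1 ∩ {τ | F.chart s (γ τ) ∈ F.chart s '' convexHull ℝ (t.1 : Set E)})
    (fun t => isClosed_Icc.inter ((F.isCompact_chart_image s t.1).isClosed.preimage (by
      simp_rw [hγ]; exact AffineMap.lineMap_continuous)))
    (fun τ hτ => by
      have h1 : γ τ ∈ K.space := SimplicialComplex.convexHull_subset_space hs (hγs τ hτ)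
      obtain ⟨r, hr, hτr⟩ := exists_mem_openSimplex (K := L) (hL.space_eq ▸ h1)
      obtain ⟨ρ, hρ, hrρ⟩ := hL.subset_convexHull hr
      exact Set.mem_iUnion.2 ⟨⟨r, hr, convexHull_subset_of_pos hρ hrρ (isBary_coord hr hτr.1)
        ((mem_openSimplex_iff (L.indep hr) (isBary_coord hr hτr.1)).1 hτr) hs (hγs τ hτ)⟩,
        hτ, γ τ, hτr.1, rfl⟩)
    (h := fun τ => interp L g (γ τ)) (C := M * dist (F.chart s x) (F.chart s y))
    (fun t a ha b hb => by
      have hmem : ∀ τ ∈ Set.Icc (0 : ℝ) 1 ∩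
          {τ | F.chart s (γ τ) ∈ F.chart s '' convexHull ℝ (t.1 : Set E)},
          γ τ ∈ convexHull ℝ (t.1 : Set E) := by
        rintro τ ⟨hτ, z, hz, hzτ⟩
        rwa [← F.chart_injOn hs (t.2.2 hz) (hγs τ hτ) hzτ]
      refine (hC t _ (hmem a ha) _ (hmem b hb)).trans ?_
      rw [hγd, mul_comm |a - b|, ← mul_assoc]
      have := hCM t
      gcongr)
  simpa [γ] using key

end Lipschitz
end PLWidth

namespace PLWidth

/-! ### Small perturbations of PL Morse functions. -/

section Perturbation

open Filter Topology

variable {E : Type*} [AddCommGroup E] [Module ℝ E] {n : ℕ}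
  {K L L₁ : SimplicialComplex ℝ E} {s t : Finset E} {f : E → ℝ}

theorem mem_vertices_of_mem (hs : s ∈ K.faces) {v : E} (hv : v ∈ s) : v ∈ K.vertices :=
  K.mem_vertices.2 (K.down_closed hs (Finset.singleton_subset_iff.2 hv) (Finset.singleton_nonempty v))

theorem finite_vertices (h : K.faces.Finite) : K.vertices.Finite := by
  refine (h.biUnion fun s _ => s.finite_toSet).subset fun v hv => ?_
  exact Set.mem_biUnion (K.mem_vertices.1 hv) (by simp)

/-- Directions in which the vertices of a subdivision can be moved, inside the faces which contain
them, so that the values of a PL Morse function at them become distinct. -/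
theorem IsPLMorse.exists_directions (hK : IsSubdivision L₁ K) (hf : IsPLMorse L₁ f)
    (hL : IsSubdivision L L₁) :
    ∃ (w : E → E) (l : E → ℝ), (∀ v, 0 ≤ l v) ∧
      (∀ v ∈ L.vertices, ∀ s ∈ L₁.faces, v ∈ convexHull ℝ (s : Set E) →
        w v ∈ convexHull ℝ (s : Set E)) ∧
      (∀ v ∈ L.vertices, ∀ s ∈ K.faces, v ∈ convexHull ℝ (s : Set E) →
        w v ∈ convexHull ℝ (s : Set E)) ∧
      ∀ v ∈ L.vertices, ∀ v' ∈ L.vertices, v ≠ v' → f v = f v' →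
        l v * (f (w v) - f v) ≠ l v' * (f (w v') - f v') := by
  classical
  obtain ⟨ι, hι⟩ := Set.countable_iff_exists_injOn.1 (finite_vertices hL.finite).countable
  have key : ∀ v, ∃ (w : E) (l : ℝ), 0 ≤ l ∧ (v ∈ L.vertices →
      (∀ s ∈ L₁.faces, v ∈ convexHull ℝ (s : Set E) → w ∈ convexHull ℝ (s : Set E)) ∧
      (∀ s ∈ K.faces, v ∈ convexHull ℝ (s : Set E) → w ∈ convexHull ℝ (s : Set E)) ∧
      ((v ∈ L₁.vertices ∧ l = 0) ∨ |l * (f w - f v)| = ι v + 1)) := by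
    intro v
    by_cases hv : v ∈ L.vertices; swap
    · exact ⟨v, 0, le_rfl, fun h => absurd h hv⟩
    by_cases hv1 : v ∈ L₁.vertices
    · exact ⟨v, 0, le_rfl, fun _ => ⟨fun _ _ h => h, fun _ _ h => h, Or.inl ⟨hv1, rfl⟩⟩⟩
    obtain ⟨s, hs, hb, hpos⟩ := exists_carrier (hL.mem_space hv (Finset.mem_singleton_self v))
    -- If `f` took the value `f v` at every vertex of the carrier, injectivity would leave a single
    -- vertex, namely `v`.
    obtain ⟨w, hws, hwv⟩ : ∃ w ∈ s, f w ≠ f v := by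
      by_contra! hc
      obtain ⟨u, hu⟩ := L₁.nonempty_of_mem_faces hs
      have hsu : s = {u} := by
        refine Finset.eq_singleton_iff_unique_mem.2 ⟨hu, fun u' hu' => ?_⟩
        exact hf.injOn (mem_vertices_of_mem hs hu') (mem_vertices_of_mem hs hu)
          ((hc u' hu').trans (hc u hu).symm)
      have := hb.mem_convexHull
      rw [hsu, Finset.coe_singleton, convexHull_singleton, Set.mem_singleton_iff] at this
      exact hv1 (this ▸ mem_vertices_of_mem hs hu)
    have h0 : 0 < |f w - f v| := abs_pos.2 (sub_ne_zero.2 hwv)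
    -- With this speed the value of `f` changes at a rate of absolute value `ι v + 1`, different for
    -- each moving vertex and nonzero, while the vertices of `L₁` stay fixed.
    refine ⟨w, (ι v + 1) / |f w - f v|, by positivity, fun _ => ⟨fun s' hs' hvs' => ?_,
      fun s' hs' hvs' => ?_, Or.inr ?_⟩⟩
    · refine subset_convexHull ℝ _ ?_
      by_contra hw
      exact ((hpos w).1 hws).ne' ((isBary_coord hs' hvs').off w hw)
    · obtain ⟨σ, hσ, hsσ⟩ := hK.subset_convexHull hs
      exact convexHull_subset_of_pos hσ hsσ hb (fun u hu => (hpos u).1 hu) hs' hvs'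
        (subset_convexHull ℝ _ hws)
    · rw [abs_mul, abs_div, abs_abs, div_mul_cancel₀ _ h0.ne', abs_of_nonneg (by positivity)]
  choose w l hl0 hl using key
  refine ⟨w, l, hl0, fun v hv => (hl v hv).1, fun v hv => (hl v hv).2.1,
    fun v hv v' hv' hne hfv heq => ?_⟩
  rcases (hl v hv).2.2 with ⟨h1, h2⟩ | h1 <;> rcases (hl v' hv').2.2 with ⟨h1', h2'⟩ | h1'
  · exact hne (hf.injOn h1 h1' hfv)
  · rw [← heq, h2, zero_mul, abs_zero] at h1'
    linarith [Nat.cast_nonneg (α := ℝ) (ι v')]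
  · rw [heq, h2', zero_mul, abs_zero] at h1
    linarith [Nat.cast_nonneg (α := ℝ) (ι v)]
  · rw [heq, h1'] at h1
    exact hne (hι hv hv' (by exact_mod_cast (add_right_cancel h1).symm))

theorem exists_one_lt_pow_mul_le {W ε : ℝ≥0∞} (hW : W ≠ ∞) (hε : ε ≠ 0) (k : ℕ) :
    ∃ C : NNReal, 1 < C ∧ (C : ℝ≥0∞) ^ k * W ≤ W + ε := by
  have h : Tendsto (fun C : NNReal => (C : ℝ≥0∞) ^ k * W) (𝓝[>] 1) (𝓝 (1 ^ k * W)) := by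
    refine ENNReal.Tendsto.mul_const ?_ (Or.inr hW)
    refine Tendsto.mono_left ?_ nhdsWithin_le_nhds
    have : Continuous fun C : NNReal => (C : ℝ≥0∞) ^ k := by
      simp_rw [← ENNReal.coe_pow]
      exact ENNReal.continuous_coe.comp (continuous_pow k)
    simpa using this.tendsto 1
  rw [one_pow, one_mul] at h
  have h2 := h.eventually (gt_mem_nhds (ENNReal.lt_add_right hW hε))
  obtain ⟨C, hC, hC1⟩ := (h2.and self_mem_nhdsWithin).exists
  exact ⟨C, hC1, hC.le⟩

/-- A PL Morse function on a subdivision can be perturbed to a PL Morse function on a finer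
subdivision, with an arbitrarily small change of the volumes of the level sets. -/
theorem IsPLMorse.exists_perturbation (F : FlatStructure n K) (hfin : K.faces.Finite)
    (hK : IsSubdivision L₁ K) (hf : IsPLMorse L₁ f) (hL : IsSubdivision L L₁)
    {ε : ℝ≥0∞} (hε : ε ≠ 0) (hW : F.levelWidth f ≠ ∞) :
    ∃ f', IsPLMorse L f' ∧ F.levelWidth f' ≤ F.levelWidth f + ε := by
  classical
  obtain ⟨w, l, hl0, hw1, hw, hinj⟩ := hf.exists_directions hK hL
  obtain ⟨C, hC1, hC⟩ := exists_one_lt_pow_mul_le hW hε (n - 1)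
  have hLK := hL.trans hK
  set d : E → E := fun v => l v • (w v - v) with hd
  have hVfin := finite_vertices hL.finite
  have hlip : ∀ s, ∃ B : ℝ, s ∈ K.faces → ∀ x ∈ convexHull ℝ (s : Set E),
      ∀ y ∈ convexHull ℝ (s : Set E),
      ‖interp L (fun v => (F.chart s).linear (d v)) x -
        interp L (fun v => (F.chart s).linear (d v)) y‖ ≤ B * dist (F.chart s x) (F.chart s y) := by
    intro s
    by_cases hs : s ∈ K.faces
    · obtain ⟨B, hB⟩ := F.exists_lipschitz hLK hs (fun v => (F.chart s).linear (d v))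
      exact ⟨B, fun _ x hx y hy => hB x hx y hy⟩
    · exact ⟨0, fun h => absurd h hs⟩
  choose B hB using hlip
  have ht0 : Tendsto (fun θ : ℝ => θ) (𝓝[>] 0) (𝓝 0) := nhdsWithin_le_nhds
  have ev1 : ∀ᶠ θ : ℝ in 𝓝[>] 0, ∀ v ∈ L.vertices, θ * l v < 1 :=
    (eventually_all_finite hVfin).2 fun v _ =>
      (by simpa using ht0.mul_const (l v) : Tendsto (fun θ : ℝ => θ * l v) (𝓝[>] 0)
        (𝓝 0)).eventually (gt_mem_nhds one_pos)
  have ev2 : ∀ᶠ θ : ℝ in 𝓝[>] 0, ∀ s ∈ K.faces, 1 < C * (1 - θ * B s) :=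
    (eventually_all_finite hfin).2 fun s _ =>
      (by simpa using ((ht0.mul_const (B s)).const_sub 1).const_mul (C : ℝ) :
        Tendsto (fun θ : ℝ => C * (1 - θ * B s)) (𝓝[>] 0) (𝓝 (C : ℝ))).eventually
        (lt_mem_nhds (by exact_mod_cast hC1))
  have ev3 : ∀ᶠ θ : ℝ in 𝓝[>] 0, ∀ v ∈ L.vertices, ∀ v' ∈ L.vertices, v ≠ v' →
      f v + θ * (l v * (f (w v) - f v)) ≠ f v' + θ * (l v' * (f (w v') - f v')) := by
    refine (eventually_all_finite hVfin).2 fun v hv => (eventually_all_finite hVfin).2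
      fun v' hv' => ?_
    by_cases hne : v = v'
    · exact Eventually.of_forall fun _ h => absurd hne h
    by_cases hfv : f v = f v'
    · filter_upwards [self_mem_nhdsWithin] with θ hθ _ heq
      rw [hfv] at heq
      have := mul_left_cancel₀ (ne_of_gt hθ) (add_left_cancel heq)
      exact hinj v hv v' hv' hne hfv (by rw [hfv]; exact this)
    · have h1 : Tendsto (fun θ : ℝ => f v + θ * (l v * (f (w v) - f v)) -
          (f v' + θ * (l v' * (f (w v') - f v')))) (𝓝[>] 0) (𝓝 (f v - f v')) := by
        simpa using ((ht0.mul_const _).const_add (f v)).sub ((ht0.mul_const _).const_add (f v'))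
      filter_upwards [h1.eventually_ne (sub_ne_zero.2 hfv)] with θ hθ _
      exact sub_ne_zero.1 hθ
  obtain ⟨θ, ⟨h1, h2, h3⟩, hθ⟩ := ((ev1.and (ev2.and ev3)).and self_mem_nhdsWithin).exists
  have hθ0 : 0 < θ := hθ
  refine ⟨interp L fun v => f v + θ * (l v * (f (w v) - f v)),
    ⟨linearOnFaces_interp L _, fun v hv v' hv' heq => ?_⟩, ?_⟩
  · rw [interp_vertex _ (L.mem_vertices.1 hv) (by simp),
      interp_vertex _ (L.mem_vertices.1 hv') (by simp)] at heq
    exact by_contra fun hne => h3 v hv v' hv' hne heq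
  -- The new function is `f ∘ φ`. As `φ` preserves the open simplices of `K` and contracts chart
  -- distances by at most the factor `C`, the new level set is at most `C ^ (n - 1)` times as large
  -- as the old one.
  set φ : E → E := fun x => x + θ • interp L d x with hφ
  have hφ_eq : ∀ t ∈ L.faces, ∀ x ∈ convexHull ℝ (t : Set E), φ x =
      ∑ v ∈ t, coord L x v • ((1 - θ * l v) • v + (θ * l v) • w v) := by
    intro t ht x hx
    rw [hφ]
    dsimp only
    rw [interp_eq d ht hx]
    nth_rw 1 [← (isBary_coord ht hx).comb]
    rw [Finset.smul_sum, ← Finset.sum_add_distrib]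
    refine Finset.sum_congr rfl fun v _ => ?_
    rw [hd]; module
  have hφ_val : ∀ t ∈ L.faces, ∀ x ∈ convexHull ℝ (t : Set E), f (φ x) =
      interp L (fun v => f v + θ * (l v * (f (w v) - f v))) x := by
    intro t ht x hx
    have hbx := isBary_coord ht hx
    obtain ⟨σ, hσ, htσ⟩ := hL.subset_convexHull ht
    obtain ⟨g, hg⟩ := hf.linear σ hσ
    have hvert : ∀ v ∈ t, v ∈ L.vertices := fun v hv => mem_vertices_of_mem ht hv
    have hmem : ∀ v ∈ t, (1 - θ * l v) • v + (θ * l v) • w v ∈ convexHull ℝ (σ : Set E) :=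
      fun v hv => convex_convexHull ℝ _ (htσ v hv) (hw1 v (hvert v hv) σ hσ (htσ v hv))
        (by linarith [h1 v (hvert v hv)]) (mul_nonneg hθ0.le (hl0 v)) (by ring)
    have hφσ : φ x ∈ convexHull ℝ (σ : Set E) := by
      rw [hφ_eq t ht x hx]
      exact (convex_convexHull ℝ _).sum_mem (fun v _ => hbx.nonneg v) hbx.sum_eq hmem
    rw [hg hφσ, interp_eq _ ht hx, hφ]
    dsimp only
    rw [interp_eq d ht hx, ← vadd_eq_add, vadd_eq_add, add_comm, ← vadd_eq_add, g.map_vadd,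
      hbx.map_affine g, map_smul, map_sum, vadd_eq_add, Finset.smul_sum, ← Finset.sum_add_distrib]
    refine Finset.sum_congr rfl fun v hv => ?_
    rw [hg (htσ v hv), hg (hw1 v (hvert v hv) σ hσ (htσ v hv)), map_smul, hd, map_smul,
      ← vsub_eq_sub, g.linearMap_vsub]
    simp only [vsub_eq_sub, smul_eq_mul]
    ring
  have hφ_mem : ∀ s ∈ K.faces, ∀ x ∈ openSimplex s, φ x ∈ openSimplex s := by
    intro s hs x hx
    obtain ⟨t, ht, rfl, hxt⟩ := hLK.exists_openSimplex hs hx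
    have hbx := isBary_coord ht hxt.1
    have hts := fun v (hv : v ∈ t) =>
      hLK.convexHull_subset_carrierFace ht (subset_convexHull ℝ _ hv)
    have hvert : ∀ v ∈ t, v ∈ L.vertices := fun v hv => mem_vertices_of_mem ht hv
    rw [hφ_eq t ht x hxt.1]
    have hW := fun v (hv : v ∈ t) => isBary_coord hs (hw v (hvert v hv) _ hs (hts v hv))
    have hb : ∀ v ∈ t, IsBary (carrierFace K t)
        (fun u => (1 - θ * l v) * coord K v u + (θ * l v) * coord K (w v) u)
        ((1 - θ * l v) • v + (θ * l v) • w v) := by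
      intro v hv
      have := IsBary.convex_comb (T := Finset.univ) (c := ![1 - θ * l v, θ * l v])
        (W := ![coord K v, coord K (w v)]) (X := ![v, w v]) (s := carrierFace K t)
        (by
          intro i _
          fin_cases i
          · simpa using (h1 v (hvert v hv)).le
          · simpa using mul_nonneg hθ0.le (hl0 v))
        (by simp)
        (by
          intro i _
          fin_cases i
          · exact isBary_coord hs (hts v hv)
          · exact hW v hv)
      simpa using this
    rw [mem_openSimplex_iff (K.indep hs) (IsBary.convex_comb (fun v _ => hbx.nonneg v) hbx.sum_eq hb)]
    intro u hu
    have hxu : 0 < coord K x u :=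
      (mem_openSimplex_iff (K.indep hs) (isBary_coord hs hx.1)).1 hx u hu
    rw [coord_comb hs hts hbx] at hxu
    obtain ⟨v, hv, hpos⟩ := Finset.exists_lt_of_sum_lt (s := t) (f := fun _ => (0 : ℝ))
      (by simpa using hxu)
    have hnn : ∀ v, 0 ≤ (θ * l v) * coord K (w v) u := fun v =>
      mul_nonneg (mul_nonneg hθ0.le (hl0 v)) (coord_nonneg K _ u)
    refine Finset.sum_pos' (fun v' hv' => mul_nonneg (hbx.nonneg v') ((hb v' hv').nonneg u))
      ⟨v, hv, ?_⟩
    have hc : 0 < coord L x v := (hbx.nonneg v).lt_of_ne fun h => by simp [← h] at hpos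
    have hc' : 0 < coord K v u := pos_of_mul_pos_right hpos (hbx.nonneg v)
    refine mul_pos hc (add_pos_of_pos_of_nonneg (mul_pos ?_ hc') (hnn v))
    linarith [h1 v (hvert v hv)]
  have hchart : ∀ s ∈ K.faces, ∀ x ∈ convexHull ℝ (s : Set E), F.chart s (φ x) =
      F.chart s x + θ • interp L (fun v => (F.chart s).linear (d v)) x := by
    intro s hs x hx
    have hxK : x ∈ L.space := hLK.space_eq ▸ SimplicialComplex.convexHull_subset_space hs hx
    obtain ⟨t, ht, hxt⟩ := SimplicialComplex.mem_space_iff.1 hxK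
    rw [hφ]
    dsimp only
    rw [interp_eq d ht hxt, interp_eq _ ht hxt, add_comm, ← vadd_eq_add, AffineMap.map_vadd,
      map_smul, map_sum, vadd_eq_add, add_comm]
    simp_rw [map_smul]
  have hdist : ∀ s ∈ K.faces, ∀ x ∈ convexHull ℝ (s : Set E), ∀ y ∈ convexHull ℝ (s : Set E),
      dist (F.chart s x) (F.chart s y) ≤ C * dist (F.chart s (φ x)) (F.chart s (φ y)) := by
    intro s hs x hx y hy
    have hb := hB s hs x hx y hy
    set gx := interp L (fun v => (F.chart s).linear (d v)) x
    set gy := interp L (fun v => (F.chart s).linear (d v)) y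
    have e1 : dist (F.chart s x) (F.chart s y) ≤
        dist (F.chart s (φ x)) (F.chart s (φ y)) + θ * ‖gx - gy‖ := by
      rw [hchart s hs x hx, hchart s hs y hy, dist_eq_norm, dist_eq_norm]
      calc ‖F.chart s x - F.chart s y‖ =
          ‖(F.chart s x + θ • gx - (F.chart s y + θ • gy)) - θ • (gx - gy)‖ := by
            congr 1; module
        _ ≤ _ := norm_sub_le _ _
        _ = _ := by rw [norm_smul, Real.norm_of_nonneg hθ0.le]
    have e2 : (1 - θ * B s) * dist (F.chart s x) (F.chart s y) ≤
        dist (F.chart s (φ x)) (F.chart s (φ y)) := by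
      nlinarith [mul_le_mul_of_nonneg_left hb hθ0.le]
    have e3 := h2 s hs
    have e4 := mul_le_mul_of_nonneg_left e2 C.coe_nonneg
    nlinarith [dist_nonneg (x := F.chart s x) (y := F.chart s y)]
  refine iSup_le fun c => ?_
  refine le_trans ?_ hC
  refine le_trans ?_ (mul_le_mul_right (le_iSup (fun c => F.vol (n - 1) {x ∈ K.space | f x = c}) c) _)
  rw [F.vol_eq_sum hfin, F.vol_eq_sum hfin, Finset.mul_sum]
  refine Finset.sum_le_sum fun s hs => ?_
  rw [hfin.mem_toFinset] at hs
  refine (euclideanHausdorffMeasure_image_le (p := F.chart s) (q := fun x => F.chart s (φ x))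
    (fun x hx y hy => hdist s hs x hx.2.1 y hy.2.1) (n - 1)).trans ?_
  refine mul_le_mul_right (measure_mono ?_) _
  rintro _ ⟨x, ⟨⟨hxK, hxc⟩, hxs⟩, rfl⟩
  refine ⟨φ x, ⟨⟨?_, ?_⟩, hφ_mem s hs x hxs⟩, rfl⟩
  · exact SimplicialComplex.convexHull_subset_space hs (hφ_mem s hs x hxs).1
  · obtain ⟨t, ht, hxt⟩ := SimplicialComplex.mem_space_iff.1 (hLK.space_eq ▸ hxK : x ∈ L.space)
    exact (hφ_val t ht x hxt).trans hxc

end Perturbation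
end PLWidth

namespace PLWidth

/-! ### Slices of steep cones and their total volume. -/

section Slices

open Filter Topology

variable {E : Type*} [AddCommGroup E] [Module ℝ E] {n : ℕ}
  {K L D D₁ D₂ : SimplicialComplex ℝ E} {s t τ a : Finset E} {S : Finset (Finset E)}

/-- In an affine chart of a simplex, a nonconstant affine function is given by an inner product. -/
theorem exists_inner_eq {χ : E →ᵃ[ℝ] EuclideanSpace ℝ (Fin n)}
    (hp : AffineIndependent ℝ (fun v : t => χ v)) {g : E → ℝ} {v v' : E} (hv : v ∈ t)
    (hv' : v' ∈ t) (hne : g v ≠ g v') :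
    ∃ ν ≠ 0, ∃ d, ∀ w x, IsBary t w x → inner ℝ ν (χ x) = ∑ v ∈ t, w v * g v + d := by
  classical
  obtain ⟨G, hG⟩ := exists_affineMap hp g
  set ν := (InnerProductSpace.toDual ℝ (EuclideanSpace ℝ (Fin n))).symm
    (LinearMap.toContinuousLinearMap G.linear) with hν
  have hin : ∀ y, inner ℝ ν y = G y - G 0 := fun y => by
    rw [hν, InnerProductSpace.toDual_symm_apply, LinearMap.coe_toContinuousLinearMap']
    rw [eq_sub_iff_add_eq]
    exact (congrFun G.decomp y).symm
  have hval : ∀ w x, IsBary t w x → inner ℝ ν (χ x) = ∑ v ∈ t, w v * g v + - G 0 := by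
    intro w x hx
    have := hx.map_affine (G.comp χ)
    rw [AffineMap.comp_apply] at this
    rw [hin, this, sub_eq_add_neg]
    congr 1
    exact Finset.sum_congr rfl fun v hv => by rw [AffineMap.comp_apply, hG v hv, smul_eq_mul]
  refine ⟨ν, fun h0 => hne ?_, -G 0, hval⟩
  have h1 := hin (χ v)
  have h2 := hin (χ v')
  rw [h0, inner_zero_left, hG _ hv] at h1
  rw [h0, inner_zero_left, hG _ hv'] at h2
  linarith

/-- The slices of a simplex by the level sets of an affine function, which is bounded on a proper
face and very large at the other vertices, have at most about the volume of that face. -/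
theorem FlatStructure.eventually_slice_le [NeZero n] (F : FlatStructure n K) (hs : s ∈ K.faces)
    (ht : AffineIndependent ℝ (fun v : t => (v : E)))
    (hts : convexHull ℝ (t : Set E) ⊆ convexHull ℝ (s : Set E)) (hat : a ⊂ t) {B : ℝ} (hB : 0 ≤ B)
    {ε : ℝ≥0∞} (hε : ε ≠ 0) (hε' : ε ≠ ∞) :
    ∀ᶠ M : ℝ in atTop, ∀ g : E → ℝ, (∀ v ∈ a, |g v| ≤ B) → (∀ v ∈ t, v ∉ a → g v = M) →
      ∀ c ≤ B, ∀ X : Set E, (∀ x ∈ X, ∃ w, IsBary t w x ∧ ∑ v ∈ t, w v * g v = c) →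
      μHE[n - 1] (F.chart s '' X) ≤ μHE[n - 1] (F.chart s '' convexHull ℝ (a : Set E)) + ε := by
  classical
  set χ := F.chart s
  have hχ : AffineIndependent ℝ (fun v : t => χ v) := F.affineIndependent_of_subset hs ht hts
  obtain ⟨b, hbt, hba⟩ := Finset.exists_of_ssubset hat
  rcases a.eq_empty_or_nonempty with rfl | ⟨a₀, ha₀⟩
  · filter_upwards [eventually_gt_atTop B] with M hM g _ hg c hc X hX
    have : X = ∅ := by
      refine Set.eq_empty_of_forall_notMem fun x hx => ?_
      obtain ⟨w, hw, hwc⟩ := hX x hx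
      rw [Finset.sum_congr rfl fun v hv => by rw [hg v hv (Finset.notMem_empty v)],
        ← Finset.sum_mul, hw.sum_eq, one_mul] at hwc
      linarith
    simp [this]
  obtain ⟨e, he0, c₀, he⟩ := exists_inner_eq (g := fun v => if v ∈ a then (0 : ℝ) else 1) hχ
    (hat.1 ha₀) hbt (by simp [ha₀, hba])
  have hea : ∀ y ∈ χ '' convexHull ℝ (a : Set E), inner ℝ e y = c₀ := by
    rintro _ ⟨x, hx, rfl⟩
    obtain ⟨w, hw⟩ := mem_convexHull_iff_isBary.1 hx
    rw [he w x (hw.mono hat.1), add_eq_right]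
    refine Finset.sum_eq_zero fun v _ => ?_
    by_cases hv : v ∈ a
    · simp [hv]
    · simp [hw.off v hv]
  obtain ⟨δ, hδ, hthin⟩ := exists_thin (F.isCompact_chart_image s a) he0 hea hε hε'
  -- `Φ` collapses the vertices outside `a` to `a₀`; in the chart it moves a point by at most `R`
  -- times its weight outside `a`.
  obtain ⟨Φ, hΦ⟩ := exists_affineMap (p := id) ht (fun v => if v ∈ a then v else a₀)
  simp only [id] at hΦ
  set R : ℝ := ∑ v ∈ t, ‖χ v - χ a₀‖ with hR
  have hR0 : 0 ≤ R := Finset.sum_nonneg fun _ _ => norm_nonneg _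
  filter_upwards [eventually_gt_atTop B, eventually_ge_atTop (2 * B * R / δ)] with M hMB hMR g hga
    hgt c hc X hX
  have hM0 : 0 < M := hB.trans_lt hMB
  obtain ⟨ν, hν0, d, hν⟩ := exists_inner_eq (g := g) hχ (hat.1 ha₀) hbt (by
    rw [hgt b hbt hba]
    exact ((le_abs_self _).trans (hga a₀ ha₀) |>.trans_lt hMB).ne)
  refine hthin _ ν hν0 (c + d) ?_ ?_
  · rintro _ ⟨x, hx, rfl⟩
    obtain ⟨w, hw, hwc⟩ := hX x hx
    rw [hν w x hw, hwc]
  rintro _ ⟨x, hx, rfl⟩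
  obtain ⟨w, hw, hwc⟩ := hX x hx
  refine ⟨χ (Φ x), ⟨Φ x, ?_, rfl⟩, ?_⟩
  · rw [hw.map_affine Φ]
    refine (convex_convexHull ℝ _).sum_mem (fun v _ => hw.nonneg v) hw.sum_eq fun v hv => ?_
    rw [hΦ v hv]
    refine subset_convexHull ℝ _ ?_
    split_ifs with h
    exacts [h, ha₀]
  have hsplit : ∀ k : E → ℝ, ∑ v ∈ t, k v = ∑ v ∈ t \ a, k v + ∑ v ∈ a, k v := fun k =>
    (Finset.sum_sdiff hat.1).symm
  -- At a level `c ≤ B` the weight outside `a` is at most `2 * B / M`; the threshold `2 * B * R / δ`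
  -- for `M` thus brings the slice within `δ` of the face.
  have hm : (∑ v ∈ t \ a, w v) * M ≤ 2 * B := by
    rw [hsplit] at hwc
    have h1 : ∑ v ∈ t \ a, w v * g v = (∑ v ∈ t \ a, w v) * M := by
      rw [Finset.sum_mul]
      exact Finset.sum_congr rfl fun v hv => by
        rw [hgt v (Finset.mem_sdiff.1 hv).1 (Finset.mem_sdiff.1 hv).2]
    have h2 : -B ≤ ∑ v ∈ a, w v * g v := by
      calc -B ≤ (∑ v ∈ a, w v) * (-B) := by
            have : ∑ v ∈ a, w v ≤ 1 := by
              rw [← hw.sum_eq]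
              exact Finset.sum_le_sum_of_subset_of_nonneg hat.1 fun v _ _ => hw.nonneg v
            nlinarith
        _ ≤ _ := by
            rw [Finset.sum_mul]
            exact Finset.sum_le_sum fun v hv =>
              mul_le_mul_of_nonneg_left (abs_le.1 (hga v hv)).1 (hw.nonneg v)
    linarith
  have hdist : dist (χ x) (χ (Φ x)) ≤ (∑ v ∈ t \ a, w v) * R := by
    have h2 := hw.map_affine (χ.comp Φ)
    rw [AffineMap.comp_apply] at h2
    rw [dist_eq_norm, h2, hw.map_affine χ, ← Finset.sum_sub_distrib]
    refine (norm_sum_le _ _).trans ?_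
    rw [hsplit, Finset.sum_eq_zero (s := a) (fun v hv => by simp [hΦ v (hat.1 hv), hv]), add_zero,
      Finset.sum_mul]
    refine Finset.sum_le_sum fun v hv => ?_
    obtain ⟨hvt, hva⟩ := Finset.mem_sdiff.1 hv
    rw [AffineMap.comp_apply, hΦ v hvt, if_neg hva, ← smul_sub, norm_smul,
      Real.norm_of_nonneg (hw.nonneg v)]
    exact mul_le_mul_of_nonneg_left
      (Finset.single_le_sum (f := fun v => ‖χ v - χ a₀‖) (fun _ _ => norm_nonneg _) hvt)
      (hw.nonneg v)
  refine hdist.trans ?_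
  rw [div_le_iff₀ hδ] at hMR
  have : (∑ v ∈ t \ a, w v) * R * M ≤ δ * M := by nlinarith
  exact le_of_mul_le_mul_right this hM0

theorem IsSubdivision.card_le_card_carrierFace (hL : IsSubdivision L K) (ht : t ∈ L.faces) :
    t.card ≤ (carrierFace K t).card :=
  (L.indep ht).card_le_card_of_subset_affineSpan fun _ hv => convexHull_subset_affineSpan _
    (hL.convexHull_subset_carrierFace ht (_root_.subset_convexHull ℝ _ hv))

/-- Passing to open simplices loses only proper faces, which are null sets since `a.card ≤ k + 1`;
the open simplices are disjoint and lie in that of `τ`. -/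
theorem FlatStructure.sum_convexHull_le_vol (F : FlatStructure n K) (hL : IsSubdivision L K)
    (hτ : τ ∈ K.faces) {k : ℕ} {A : Finset (Finset E)}
    (hA : ∀ a ∈ A, a ∈ L.faces ∧ carrierFace K a = τ ∧ a.card ≤ k + 1) :
    ∑ a ∈ A, μHE[k] (F.chart τ '' convexHull ℝ (a : Set E)) ≤
      F.vol k (convexHull ℝ (τ : Set E)) := by
  classical
  have hsub : ∀ a ∈ A, convexHull ℝ (a : Set E) ⊆ convexHull ℝ (τ : Set E) := fun a ha =>
    (hA a ha).2.1 ▸ hL.convexHull_subset_carrierFace (hA a ha).1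
  have h1 : ∀ a ∈ A, μHE[k] (F.chart τ '' convexHull ℝ (a : Set E)) ≤
      μHE[k] (F.chart τ '' openSimplex a) := by
    intro a ha
    have hcov : F.chart τ '' convexHull ℝ (a : Set E) ⊆ F.chart τ '' openSimplex a ∪
        ⋃ u ∈ (a.ssubsets : Set (Finset E)), F.chart τ '' convexHull ℝ (u : Set E) := by
      rintro _ ⟨x, hx, rfl⟩
      by_cases hxo : x ∈ openSimplex a
      · exact Or.inl ⟨x, hxo, rfl⟩
      · right
        obtain ⟨u, hu, hxu⟩ : ∃ u : Finset E, u ⊂ a ∧ x ∈ convexHull ℝ (u : Set E) := by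
          by_contra! hc
          refine hxo ⟨hx, fun h => ?_⟩
          obtain ⟨u, hu, hxu⟩ := Set.mem_iUnion₂.1 h
          exact hc u hu hxu
        exact Set.mem_biUnion (Finset.mem_coe.2 (Finset.mem_ssubsets.2 hu)) ⟨x, hxu, rfl⟩
    refine (measure_mono hcov).trans ((measure_union_le _ _).trans ?_)
    rw [(measure_biUnion_null_iff (μ := μHE[k]) (Finset.countable_toSet a.ssubsets)).2 fun u hu =>
      euclideanHausdorffMeasure_convexHull_eq_zero (t := u) (by
        have := Finset.card_lt_card (Finset.mem_ssubsets.1 (Finset.mem_coe.1 hu))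
        have := (hA a ha).2.2
        omega) _, add_zero]
  refine (Finset.sum_le_sum h1).trans ?_
  rw [← measure_biUnion_finset]
  · refine le_trans (measure_mono ?_) (ENNReal.le_tsum (⟨τ, hτ⟩ : K.faces))
    refine Set.iUnion₂_subset fun a ha => Set.image_mono fun x hx => ⟨hsub a ha hx.1, ?_⟩
    have := hL.openSimplex_subset (hA a ha).1 hx
    rwa [(hA a ha).2.1] at this
  · intro a ha b hb hne
    refine Set.disjoint_left.2 ?_
    rintro _ ⟨x, hx, rfl⟩ ⟨y, hy, hxy⟩
    have := F.chart_injOn hτ (hsub b hb hy.1) (hsub a ha hx.1) hxy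
    exact hne (openSimplex_injOn (hA a ha).1 (hA b hb).1 hx (this ▸ hy))
  · exact fun a ha => F.measurableSet_chart_image hτ (hsub a ha)

-- By fullness a simplex `t` outside `D₁` has a vertex outside `D₁`, so its part in `D₁` has at most
-- `n` vertices and only those with exactly `n` contribute. Such a part is carried by both `D₁` and
-- `D₂`, hence by a face of some `τ ∈ S`, and by dimension by `τ` itself. Each part occurs for at
-- most two `t`, and distinct parts over one `τ` do not overlap.
open scoped Classical in
theorem FlatStructure.sum_slices_le (F : FlatStructure n D) [NeZero n]
    (h : Decomposes n D D₁ D₂ S) (hL : IsSubdivision L D)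
    (hfull : ∀ t ∈ L.faces, (∀ v ∈ t, v ∈ D₁.space) → carrierFace D t ∈ D₁.faces)
    (hcof : ∀ a : Finset E, a.card = n → ∀ T : Finset (Finset E),
      (∀ t ∈ T, t ∈ L.faces ∧ t.card = n + 1 ∧ a ⊆ t) → T.card ≤ 2) :
    ∑ t ∈ hL.finite.toFinset.filter (fun t => carrierFace D t ∉ D₁.faces),
      μHE[n - 1] (F.chart (carrierFace D t) ''
        convexHull ℝ ((t.filter fun v => v ∈ D₁.space : Finset E) : Set E)) ≤
      2 * F.chainVol S := by
  have hn : 0 < n := Nat.pos_of_ne_zero (NeZero.ne n)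
  set α : Finset E → Finset E := fun t => t.filter fun v => v ∈ D₁.space with hα
  set T := hL.finite.toFinset.filter (fun t => carrierFace D t ∉ D₁.faces) with hT
  set A := hL.finite.toFinset.filter (fun a => a.card = n ∧ carrierFace D a ∈ S) with hA
  have hTmem : ∀ t ∈ T, t ∈ L.faces ∧ carrierFace D t ∉ D₁.faces := fun t ht => by
    rwa [hT, Finset.mem_filter, Set.Finite.mem_toFinset] at ht
  have hcard : ∀ t ∈ T, t.card ≤ n + 1 := fun t ht =>
    F.card_le_of_subset (hL.carrierFace_mem (hTmem t ht).1) (L.indep (hTmem t ht).1)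
      (hL.convexHull_subset_carrierFace (hTmem t ht).1)
  have hss : ∀ t ∈ T, α t ⊂ t := fun t ht => by
    refine Finset.ssubset_iff_subset_ne.2 ⟨Finset.filter_subset _ _, fun heq => ?_⟩
    refine (hTmem t ht).2 (hfull t (hTmem t ht).1 fun v hv => ?_)
    rw [← heq] at hv
    exact (Finset.mem_filter.1 hv).2
  have hface : ∀ t ∈ T, (α t).card = n → α t ∈ L.faces := fun t ht hc =>
    L.down_closed (hTmem t ht).1 (Finset.filter_subset _ _) (Finset.card_pos.1 (hc ▸ hn))
  have hmaps : ∀ t ∈ T, (α t).card = n → α t ∈ A := by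
    intro t ht hc
    have hf := hface t ht hc
    refine Finset.mem_filter.2 ⟨hL.finite.mem_toFinset.2 hf, hc, ?_⟩
    have hc1 : carrierFace D (α t) ∈ D₁.faces :=
      hfull _ hf fun v hv => (Finset.mem_filter.1 hv).2
    have hc0 := hL.carrierFace_mem hf
    have hct := hL.carrierFace_mem (hTmem t ht).1
    have ht2 : carrierFace D t ∈ D₂.faces := (h.cover _ hct).resolve_left (hTmem t ht).2
    have hc2 : carrierFace D (α t) ∈ D₂.faces :=
      D₂.down_closed ht2 (hL.carrierFace_mono (hTmem t ht).1 hf (Finset.filter_subset _ _))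
        (D.nonempty_of_mem_faces hc0)
    obtain ⟨τ, hτ, hsub⟩ := (h.inter _ hc0).1 ⟨hc1, hc2⟩
    have := hL.card_le_card_carrierFace hf
    have h3 := (h.isChain τ hτ).2
    rw [Finset.eq_of_subset_of_card_le hsub (by omega)]
    exact hτ
  calc ∑ t ∈ T, μHE[n - 1] (F.chart (carrierFace D t) '' convexHull ℝ (α t : Set E))
      = ∑ t ∈ T.filter (fun t => (α t).card = n),
        μHE[n - 1] (F.chart (carrierFace D t) '' convexHull ℝ (α t : Set E)) := by
        refine (Finset.sum_filter_of_ne fun t ht hne => ?_).symm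
        by_contra hc
        refine hne (euclideanHausdorffMeasure_convexHull_eq_zero ?_ _)
        have := Finset.card_lt_card (hss t ht)
        have := hcard t ht
        omega
    _ = ∑ t ∈ T.filter (fun t => (α t).card = n),
        μHE[n - 1] (F.chart (carrierFace D (α t)) '' convexHull ℝ (α t : Set E)) := by
        refine Finset.sum_congr rfl fun t ht => ?_
        obtain ⟨ht, hc⟩ := Finset.mem_filter.1 ht
        have hf := hface t ht hc
        refine euclideanHausdorffMeasure_image_eq (fun x hx y hy => ?_) _
        exact (F.dist_chart_eq (hL.carrierFace_mem hf) (hL.carrierFace_mem (hTmem t ht).1)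
          (hL.carrierFace_mono (hTmem t ht).1 hf (Finset.filter_subset _ _))
          (hL.convexHull_subset_carrierFace hf hx) (hL.convexHull_subset_carrierFace hf hy)).symm
    _ = ∑ a ∈ A, ∑ t ∈ (T.filter (fun t => (α t).card = n)).filter (fun t => α t = a),
        μHE[n - 1] (F.chart (carrierFace D (α t)) '' convexHull ℝ (α t : Set E)) := by
        refine (Finset.sum_fiberwise_of_maps_to (fun t ht => ?_) _).symm
        exact hmaps t (Finset.mem_filter.1 ht).1 (Finset.mem_filter.1 ht).2
    _ ≤ ∑ a ∈ A, 2 * μHE[n - 1] (F.chart (carrierFace D a) '' convexHull ℝ (a : Set E)) := by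
        refine Finset.sum_le_sum fun a ha => ?_
        rw [Finset.sum_congr rfl fun t ht => by rw [(Finset.mem_filter.1 ht).2], Finset.sum_const,
          nsmul_eq_mul]
        refine mul_le_mul_left ?_ _
        have hac : a.card = n := (Finset.mem_filter.1 ha).2.1
        refine Nat.cast_le_ofNat.2 (hcof a hac _ fun t ht => ?_)
        obtain ⟨ht', rfl⟩ := Finset.mem_filter.1 ht
        replace ht := (Finset.mem_filter.1 ht').1
        refine ⟨(hTmem t ht).1, ?_, Finset.filter_subset _ _⟩
        have := Finset.card_lt_card (hss t ht)
        have := hcard t ht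
        omega
    _ = 2 * ∑ τ ∈ S, ∑ a ∈ A.filter (fun a => carrierFace D a = τ),
        μHE[n - 1] (F.chart (carrierFace D a) '' convexHull ℝ (a : Set E)) := by
        rw [← Finset.mul_sum, Finset.sum_fiberwise_of_maps_to]
        exact fun a ha => (Finset.mem_filter.1 ha).2.2
    _ ≤ 2 * F.chainVol S := by
        refine mul_le_mul_right (Finset.sum_le_sum fun τ hτ => ?_) _
        rw [Finset.sum_congr rfl fun a ha => by rw [(Finset.mem_filter.1 ha).2]]
        refine F.sum_convexHull_le_vol hL (h.isChain τ hτ).1 fun a ha => ?_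
        obtain ⟨ha, hc⟩ := Finset.mem_filter.1 ha
        obtain ⟨ha, hc', -⟩ := Finset.mem_filter.1 ha
        exact ⟨hL.finite.mem_toFinset.1 ha, hc, by omega⟩

end Slices
end PLWidth

namespace PLWidth

/-! ### Gluing the two Morse functions. -/

section Gluing

open Filter Topology

variable {E : Type*} [AddCommGroup E] [Module ℝ E] {n : ℕ}
  {L D D₁ D₂ : SimplicialComplex ℝ E} {s t : Finset E} {S : Finset (Finset E)}
  {f₁ f₂ : E → ℝ} {B M : ℝ} {x : E}

theorem IsBary.sum_mul_le {w g : E → ℝ} {c : ℝ} (h : IsBary s w x) (hg : ∀ v ∈ s, g v ≤ c) :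
    ∑ v ∈ s, w v * g v ≤ c := by
  calc ∑ v ∈ s, w v * g v ≤ ∑ v ∈ s, w v * c :=
        Finset.sum_le_sum fun v hv => mul_le_mul_of_nonneg_left (hg v hv) (h.nonneg v)
    _ = c := by rw [← Finset.sum_mul, h.sum_eq, one_mul]

theorem IsBary.le_sum_mul {w g : E → ℝ} {c : ℝ} (h : IsBary s w x) (hg : ∀ v ∈ s, c ≤ g v) :
    c ≤ ∑ v ∈ s, w v * g v := by
  calc c = ∑ v ∈ s, w v * c := by rw [← Finset.sum_mul, h.sum_eq, one_mul]
    _ ≤ _ := Finset.sum_le_sum fun v hv => mul_le_mul_of_nonneg_left (hg v hv) (h.nonneg v)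

open scoped Classical in
/-- The function which equals `f` on `A` and is constant elsewhere. -/
noncomputable def extendBy (A : Set E) (f : E → ℝ) (M : ℝ) (v : E) : ℝ :=
  if v ∈ A then f v else M

omit [AddCommGroup E] [Module ℝ E] in
theorem extendBy_of_mem {A : Set E} {f : E → ℝ} {v : E} (h : v ∈ A) : extendBy A f M v = f v :=
  if_pos h

omit [AddCommGroup E] [Module ℝ E] in
theorem extendBy_of_notMem {A : Set E} {f : E → ℝ} {v : E} (h : v ∉ A) :
    extendBy A f M v = M := if_neg h

/-- Two PL Morse functions with values in `[-B, B]`, on the parts of a common subdivision `L` over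
two subcomplexes which cover `D`. -/
structure Gluing (D D₁ D₂ L : SimplicialComplex ℝ E) (f₁ f₂ : E → ℝ) (B : ℝ) : Prop where
  sub : IsSubdivision L D
  left_le : D₁ ≤ D
  right_le : D₂ ≤ D
  cover : ∀ s ∈ D.faces, s ∈ D₁.faces ∨ s ∈ D₂.faces
  left_full : ∀ t ∈ L.faces, (∀ v ∈ t, v ∈ D₁.space) → carrierFace D t ∈ D₁.faces
  left_morse : IsPLMorse (subdivisionOf L D₁) f₁
  right_morse : IsPLMorse (subdivisionOf L D₂) f₂
  nonneg : 0 ≤ B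
  left_bound : ∀ v ∈ L.vertices, v ∈ D₁.space → |f₁ v| ≤ B
  right_bound : ∀ v ∈ L.vertices, v ∈ D₂.space → |f₂ v| ≤ B

/-- The first function, extended by steep cones with apex value `M`. -/
noncomputable def leftExtension (D₁ L : SimplicialComplex ℝ E) (f₁ : E → ℝ) (M : ℝ) : E → ℝ :=
  interp L (extendBy D₁.space f₁ M)

/-- The second function, moved above the first one. -/
noncomputable def rightExtension (D₂ L : SimplicialComplex ℝ E) (f₂ : E → ℝ) (B : ℝ) : E → ℝ :=
  interp L (extendBy D₂.space (fun x => 3 * B + 1 + f₂ x) (3 * B + 1))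

theorem leftExtension_vertex {v : E} (hv : v ∈ L.vertices) (h : v ∉ D₁.space) :
    leftExtension D₁ L f₁ M v = M := by
  rw [leftExtension, interp_vertex _ (L.mem_vertices.1 hv) (Finset.mem_singleton_self v),
    extendBy_of_notMem h]

namespace Gluing

variable (G : Gluing D D₁ D₂ L f₁ f₂ B)
include G

theorem linear_eq {K : SimplicialComplex ℝ E} {f g : E → ℝ} (hK : K ≤ D)
    (hf : IsPLMorse (subdivisionOf L K) f) (hx : x ∈ K.space)
    (hg : ∀ v ∈ K.space, g v = f v) : interp L g x = f x := by
  rw [← (G.sub.subdivisionOf hK).space_eq] at hx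
  obtain ⟨t, ht, hxt⟩ := SimplicialComplex.mem_space_iff.1 hx
  have htL := (mem_subdivisionOf.1 ht).1
  have hf' : LinearOnFaces (subdivisionOf L K) f := hf.linear
  rw [interp_eq _ htL hxt, hf'.map_isBary ht (isBary_coord htL hxt)]
  refine Finset.sum_congr rfl fun v hv => ?_
  rw [hg v ((G.sub.subdivisionOf hK).mem_space ht hv)]

theorem left_eq (hx : x ∈ D₁.space) : leftExtension D₁ L f₁ M x = f₁ x :=
  G.linear_eq G.left_le G.left_morse hx fun _ hv => extendBy_of_mem hv

theorem right_eq (hx : x ∈ D₂.space) :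
    rightExtension D₂ L f₂ B x = 3 * B + 1 + f₂ x := by
  have h : IsPLMorse (subdivisionOf L D₂) (fun x => 3 * B + 1 + f₂ x) :=
    ⟨fun s hs => by
      obtain ⟨g, hg⟩ := G.right_morse.linear s hs
      exact ⟨AffineMap.const ℝ E (3 * B + 1) + g, fun x hx => by simp [hg hx]⟩,
      fun v hv v' hv' h => G.right_morse.injOn hv hv' (add_left_cancel h)⟩
  exact G.linear_eq G.right_le h hx fun _ hv => extendBy_of_mem hv

theorem mem_space_of_carrierFace {K : SimplicialComplex ℝ E} (ht : t ∈ L.faces)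
    (hK : carrierFace D t ∈ K.faces) (hx : x ∈ convexHull ℝ (t : Set E)) : x ∈ K.space :=
  SimplicialComplex.convexHull_subset_space hK (G.sub.convexHull_subset_carrierFace ht hx)

theorem mem_right (hx : x ∈ D.space) (h : x ∉ D₁.space) : x ∈ D₂.space := by
  obtain ⟨s, hs, hxs⟩ := SimplicialComplex.mem_space_iff.1 hx
  rcases G.cover s hs with h1 | h2
  · exact absurd (SimplicialComplex.convexHull_subset_space h1 hxs) h
  · exact SimplicialComplex.convexHull_subset_space h2 hxs

theorem left_le_bound (hx : x ∈ D₁.space) : f₁ x ≤ B := by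
  rw [← (G.sub.subdivisionOf G.left_le).space_eq] at hx
  obtain ⟨t, ht, hxt⟩ := SimplicialComplex.mem_space_iff.1 hx
  have hf' : LinearOnFaces (subdivisionOf L D₁) f₁ := G.left_morse.linear
  rw [hf'.map_isBary ht (isBary_coord ht hxt)]
  refine (isBary_coord ht hxt).sum_mul_le fun v hv => (abs_le.1 (G.left_bound v ?_ ?_)).2
  · exact mem_vertices_of_mem (mem_subdivisionOf.1 ht).1 hv
  · exact (G.sub.subdivisionOf G.left_le).mem_space ht hv

/-- The shift by `3 * B + 1` leaves a gap between these values and the range `[-B, B]` of the first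
function. -/
theorem rightExtension_mem (hx : x ∈ D.space) :
    rightExtension D₂ L f₂ B x ∈ Set.Icc (2 * B + 1) (4 * B + 1) := by
  have hB := G.nonneg
  rw [← G.sub.space_eq] at hx
  obtain ⟨t, ht, hxt⟩ := SimplicialComplex.mem_space_iff.1 hx
  have hv : ∀ v ∈ t, extendBy D₂.space (fun x => 3 * B + 1 + f₂ x) (3 * B + 1) v ∈
      Set.Icc (2 * B + 1) (4 * B + 1) := by
    intro v hv
    by_cases hv2 : v ∈ D₂.space
    · rw [extendBy_of_mem hv2]
      have := abs_le.1 (G.right_bound v (mem_vertices_of_mem ht hv) hv2)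
      constructor <;> linarith
    · rw [extendBy_of_notMem hv2]
      constructor <;> linarith
  rw [rightExtension, interp_eq _ ht hxt]
  exact ⟨(isBary_coord ht hxt).le_sum_mul fun v h => (hv v h).1,
    (isBary_coord ht hxt).sum_mul_le fun v h => (hv v h).2⟩

theorem right_lower (hx : x ∈ D₂.space) : -B ≤ f₂ x := by
  have := (G.rightExtension_mem (SimplicialComplex.mem_space_iff.2
    ((SimplicialComplex.mem_space_iff.1 hx).imp fun _ h => ⟨G.right_le h.1, h.2⟩))).1
  rw [G.right_eq hx] at this
  linarith

theorem left_space_subset : D₁.space ⊆ D.space := fun _ hx =>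
  SimplicialComplex.mem_space_iff.2
    ((SimplicialComplex.mem_space_iff.1 hx).imp fun _ h => ⟨G.left_le h.1, h.2⟩)

theorem left_lt_right (hx : x ∈ D₁.space) :
    leftExtension D₁ L f₁ M x < rightExtension D₂ L f₂ B x := by
  rw [G.left_eq hx]
  linarith [G.left_le_bound hx, (G.rightExtension_mem (G.left_space_subset hx)).1, G.nonneg]

end Gluing

/-- The value at the point of the segment from `a` to `b` where the two extensions agree. -/
noncomputable def crossValue (f₁ f₂ : E → ℝ) (B M : ℝ) (a b : E) : ℝ :=
  3 * B + 1 + f₂ a + (3 * B + 1 + f₂ a - f₁ a) / (M - (f₁ a + (f₂ b - f₂ a))) * (f₂ b - f₂ a)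

-- As the cone steepens, the crossing point moves to `a`. Crossings over different `a` therefore end
-- up with different values.
omit [AddCommGroup E] [Module ℝ E] in
theorem tendsto_crossValue (f₁ f₂ : E → ℝ) (B : ℝ) (a b : E) :
    Tendsto (fun M => crossValue f₁ f₂ B M a b) atTop (𝓝 (3 * B + 1 + f₂ a)) := by
  have h1 : Tendsto (fun M : ℝ => M - (f₁ a + (f₂ b - f₂ a))) atTop atTop := by
    simp_rw [sub_eq_add_neg _ (f₁ a + _)]
    exact tendsto_atTop_add_const_right _ _ tendsto_id
  simpa [crossValue] using
    ((h1.const_div_atTop (3 * B + 1 + f₂ a - f₁ a)).mul_const (f₂ b - f₂ a)).const_add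
      (3 * B + 1 + f₂ a)

/-- The glued function is a PL Morse function once the cones are steep enough. -/
theorem Gluing.eventually_isPLMorse (G : Gluing D D₁ D₂ L f₁ f₂ B) : ∀ᶠ M in atTop,
    ∃ L', IsSubdivision L' D ∧
      IsPLMorse L' (fun x => min (leftExtension D₁ L f₁ M x) (rightExtension D₂ L f₂ B x)) := by
  have hB := G.nonneg
  have hV := finite_vertices G.sub.finite
  have inj₁ : ∀ a ∈ L.vertices, a ∈ D₁.space → ∀ b ∈ L.vertices, b ∈ D₁.space →
      f₁ a = f₁ b → a = b := by
    intro a ha ha1 b hb hb1 hab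
    refine G.left_morse.injOn ?_ ?_ hab
    · refine SimplicialComplex.mem_vertices.2 ((G.sub.mem_subdivisionOf_iff G.left_le ha).2
        (G.left_full _ ha (by simpa using ha1)))
    · refine SimplicialComplex.mem_vertices.2 ((G.sub.mem_subdivisionOf_iff G.left_le hb).2
        (G.left_full _ hb (by simpa using hb1)))
  have inj₂ : ∀ a ∈ L.vertices, a ∈ D₂.space → ∀ b ∈ L.vertices, b ∈ D₂.space →
      f₂ a = f₂ b → a = b := by
    have hmem : ∀ a ∈ L.vertices, a ∈ D₂.space → a ∈ (subdivisionOf L D₂).vertices := by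
      intro a ha ha2
      obtain ⟨s, hs, has⟩ := SimplicialComplex.mem_space_iff.1 ha2
      refine mem_subdivisionOf.2 ⟨ha, s, hs, ?_⟩
      simpa using has
    exact fun a ha ha2 b hb hb2 hab =>
      G.right_morse.injOn (hmem a ha ha2) (hmem b hb hb2) hab
  have ev1 : ∀ᶠ M in atTop, ∀ a ∈ L.vertices, ∀ b ∈ L.vertices, ∀ b' ∈ L.vertices,
      a ∈ D₂.space → b' ∈ D₂.space → a ≠ b' → crossValue f₁ f₂ B M a b ≠ 3 * B + 1 + f₂ b' := by
    refine (eventually_all_finite hV).2 fun a ha => (eventually_all_finite hV).2 fun b hb =>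
      (eventually_all_finite hV).2 fun b' hb' => ?_
    by_cases h : a ∈ D₂.space ∧ b' ∈ D₂.space ∧ a ≠ b'
    · filter_upwards [(tendsto_crossValue f₁ f₂ B a b).eventually_ne (b₂ := 3 * B + 1 + f₂ b')
        fun heq => h.2.2 (inj₂ a ha h.1 b' hb' h.2.1 (add_left_cancel heq))] with M hM _ _ _
      exact hM
    · exact Eventually.of_forall fun M h1 h2 h3 => absurd ⟨h1, h2, h3⟩ h
  have ev2 : ∀ᶠ M in atTop, ∀ a ∈ L.vertices, ∀ b ∈ L.vertices, ∀ a' ∈ L.vertices,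
      ∀ b' ∈ L.vertices, a ∈ D₂.space → a' ∈ D₂.space → a ≠ a' →
      crossValue f₁ f₂ B M a b ≠ crossValue f₁ f₂ B M a' b' := by
    refine (eventually_all_finite hV).2 fun a ha => (eventually_all_finite hV).2 fun b hb =>
      (eventually_all_finite hV).2 fun a' ha' => (eventually_all_finite hV).2 fun b' hb' => ?_
    by_cases h : a ∈ D₂.space ∧ a' ∈ D₂.space ∧ a ≠ a'
    · have h1 := (tendsto_crossValue f₁ f₂ B a b).sub (tendsto_crossValue f₁ f₂ B a' b')
      filter_upwards [h1.eventually_ne (b₂ := 0) fun heq => h.2.2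
        (inj₂ a ha h.1 a' ha' h.2.1 (add_left_cancel (sub_eq_zero.1 heq)))] with M hM _ _ _
      exact sub_ne_zero.1 hM
    · exact Eventually.of_forall fun M h1 h2 h3 => absurd ⟨h1, h2, h3⟩ h
  filter_upwards [ev1, ev2, eventually_gt_atTop (4 * B + 1)] with M hM1 hM2 hM
  set u := leftExtension D₁ L f₁ M with hu
  set v := rightExtension D₂ L f₂ B with hv
  have hlu : LinearOnFaces L u := linearOnFaces_interp L _
  have hlv : LinearOnFaces L v := linearOnFaces_interp L _
  -- After cutting along `u = v`, the minimum is one and the same of the two affine functions on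
  -- each simplex.
  obtain ⟨L', hL', hsign, hvert⟩ := exists_cut G.sub.finite (hlu.sub hlv)
  refine ⟨L', hL'.trans G.sub, fun s hs => ?_, ?_⟩
  · obtain ⟨gu, hgu⟩ := hlu.of_subset hL'.subset s hs
    obtain ⟨gv, hgv⟩ := hlv.of_subset hL'.subset s hs
    have hval : ∀ x ∈ convexHull ℝ (s : Set E), u x - v x =
        ∑ y ∈ s, coord L' x y * (u - v) y := fun x hx =>
      ((hlu.sub hlv).of_subset hL'.subset).map_isBary hs (isBary_coord hs hx)
    rcases hsign s hs with h | h
    · refine ⟨gv, fun x hx => ?_⟩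
      have := (isBary_coord hs hx).le_sum_mul h
      rw [← hval x hx] at this
      rw [← hgv hx]
      exact min_eq_right (by linarith)
    · refine ⟨gu, fun x hx => ?_⟩
      have := (isBary_coord hs hx).sum_mul_le h
      rw [← hval x hx] at this
      rw [← hgu hx]
      exact min_eq_left (by linarith)
  have hLD : ∀ x ∈ L.vertices, x ∈ D.space := fun x hx =>
    G.sub.mem_space hx (Finset.mem_singleton_self x)
  -- Three kinds of vertices: those in `D₁`, with values at most `B`; old vertices outside `D₁`,
  -- where `v` is the minimum; and crossings on edges from `a ∈ D₁ ∩ D₂` to `b ∉ D₁`. The last two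
  -- kinds have values at least `2 * B + 1`.
  have hclass : ∀ p ∈ L'.vertices,
      (p ∈ L.vertices ∧ p ∈ D₁.space ∧ min (u p) (v p) = f₁ p) ∨
      (2 * B + 1 ≤ min (u p) (v p) ∧
        ((p ∈ L.vertices ∧ p ∉ D₁.space ∧ p ∈ D₂.space ∧ min (u p) (v p) = 3 * B + 1 + f₂ p) ∨
        ∃ a ∈ L.vertices, ∃ b ∈ L.vertices, a ∈ D₁.space ∧ a ∈ D₂.space ∧ b ∉ D₁.space ∧
          b ∈ D₂.space ∧ min (u p) (v p) = crossValue f₁ f₂ B M a b ∧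
          ∃ μ : ℝ, μ = (3 * B + 1 + f₂ a - f₁ a) / (M - (f₁ a + (f₂ b - f₂ a))) ∧
            p = (1 - μ) • a + μ • b)) := by
    intro p hp
    have hpD : p ∈ D.space := (hL'.trans G.sub).mem_space hp (Finset.mem_singleton_self p)
    rcases hvert p hp with hpL | ⟨a, b, μ, hμ, s, hs, has, hbs, ha, hb, hp0, rfl⟩
    · by_cases hp1 : p ∈ D₁.space
      · exact Or.inl ⟨hpL, hp1, by
          rw [min_eq_left (G.left_lt_right hp1).le]; exact G.left_eq hp1⟩
      · have hvu : min (u p) (v p) = v p := min_eq_right (by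
          rw [hu, leftExtension_vertex hpL hp1]
          exact (G.rightExtension_mem hpD).2.trans hM.le)
        rw [hvu]
        exact Or.inr ⟨(G.rightExtension_mem hpD).1, Or.inl ⟨hpL, hp1, G.mem_right hpD hp1,
          G.right_eq (G.mem_right hpD hp1)⟩⟩
    · have haL := mem_vertices_of_mem hs has
      have hbL := mem_vertices_of_mem hs hbs
      have hb1 : b ∉ D₁.space := fun h => by
        have := G.left_lt_right (M := M) h
        simp only [Pi.sub_apply] at hb
        linarith
      have ha1 : a ∈ D₁.space := by
        by_contra h
        have h1 := leftExtension_vertex (f₁ := f₁) (M := M) haL h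
        have h2 := (G.rightExtension_mem (hLD a haL)).2
        simp only [Pi.sub_apply] at ha
        rw [hu, h1] at ha
        linarith
      have hs2 : carrierFace D s ∈ D₂.faces :=
        (G.cover _ (G.sub.carrierFace_mem hs)).resolve_left fun h =>
          hb1 (G.mem_space_of_carrierFace hs h (subset_convexHull ℝ _ hbs))
      have ha2 := G.mem_space_of_carrierFace hs hs2 (subset_convexHull ℝ _ has)
      have hb2 := G.mem_space_of_carrierFace hs hs2 (subset_convexHull ℝ _ hbs)
      have hcomb : ∀ k : E → ℝ, LinearOnFaces L k →
          k ((1 - μ) • a + μ • b) = (1 - μ) * k a + μ * k b := by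
        intro k hk
        obtain ⟨g, hg⟩ := hk s hs
        have hsa := subset_convexHull ℝ (s : Set E) has
        have hsb := subset_convexHull ℝ (s : Set E) hbs
        rw [hg (convex_convexHull ℝ _ hsa hsb (by linarith [hμ.2]) hμ.1.le (by ring)), hg hsa,
          hg hsb, Convex.combo_affine_apply (by ring), smul_eq_mul, smul_eq_mul]
      set p := (1 - μ) • a + μ • b with hpdef
      have hup := hcomb u hlu
      have hvp := hcomb v hlv
      simp only [Pi.sub_apply] at hp0
      have hua : u a = f₁ a := G.left_eq ha1
      have hub : u b = M := leftExtension_vertex hbL hb1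
      have hva : v a = 3 * B + 1 + f₂ a := G.right_eq ha2
      have hvb : v b = 3 * B + 1 + f₂ b := G.right_eq hb2
      have h1 := abs_le.1 (G.left_bound a haL ha1)
      have h2 := abs_le.1 (G.right_bound a haL ha2)
      have h3 := abs_le.1 (G.right_bound b hbL hb2)
      have hden : 0 < M - (f₁ a + (f₂ b - f₂ a)) := by linarith
      have hμeq : μ = (3 * B + 1 + f₂ a - f₁ a) / (M - (f₁ a + (f₂ b - f₂ a))) := by
        rw [eq_div_iff hden.ne']
        rw [hup, hvp, hua, hub, hva, hvb] at hp0
        linarith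
      have hmin : min (u p) (v p) = v p := min_eq_right (by linarith)
      right
      rw [hmin]
      refine ⟨(G.rightExtension_mem hpD).1, Or.inr ⟨a, haL, b, hbL, ha1, ha2, hb1, hb2, ?_, μ, hμeq,
        rfl⟩⟩
      rw [crossValue, ← hμeq, hvp, hva, hvb]
      ring
  intro p hp p' hp' heq
  simp only at heq
  rcases hclass p hp with ⟨hpL, hp1, h1⟩ | ⟨hlow, h1⟩ <;>
    rcases hclass p' hp' with ⟨hpL', hp1', h1'⟩ | ⟨hlow', h1'⟩
  · exact inj₁ p hpL hp1 p' hpL' hp1' (h1.symm.trans (heq.trans h1'))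
  · linarith [G.left_le_bound hp1]
  · linarith [G.left_le_bound hp1']
  rcases h1 with ⟨hpL, hp1, hp2, h1⟩ | ⟨a, ha, b, hb, ha1, ha2, hb1, hb2, h1, μ, hμ, hpe⟩ <;>
    rcases h1' with ⟨hpL', hp1', hp2', h1'⟩ | ⟨a', ha', b', hb', ha1', ha2', hb1', hb2', h1', μ', hμ', hpe'⟩
  · exact inj₂ p hpL hp2 p' hpL' hp2' (add_left_cancel (h1.symm.trans (heq.trans h1')))
  · exact absurd (h1'.symm.trans (heq.symm.trans h1))
      (hM1 a' ha' b' hb' p hpL ha2' hp2 fun h => hp1 (h ▸ ha1'))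
  · exact absurd (h1.symm.trans (heq.trans h1'))
      (hM1 a ha b hb p' hpL' ha2 hp2' fun h => hp1' (h ▸ ha1))
  · have hcv := h1.symm.trans (heq.trans h1')
    obtain rfl : a = a' := by
      by_contra hne
      exact hM2 a ha b hb a' ha' b' hb' ha2 ha2' hne hcv
    have k1 := abs_le.1 (G.left_bound a ha ha1)
    have k2 := abs_le.1 (G.right_bound a ha ha2)
    have k3 := abs_le.1 (G.right_bound b hb hb2)
    have k4 := abs_le.1 (G.right_bound b' hb' hb2')
    have hd : 0 < M - (f₁ a + (f₂ b - f₂ a)) := by linarith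
    have hd' : 0 < M - (f₁ a + (f₂ b' - f₂ a)) := by linarith
    -- For two crossings over the same `a` the limit does not help. Cross-multiplication leaves the
    -- factor `f₂ b - f₂ b'` times factors that are positive for large `M`.
    have hbb : f₂ b = f₂ b' := by
      rw [crossValue, crossValue, add_right_inj, div_mul_eq_mul_div, div_mul_eq_mul_div,
        div_eq_div_iff hd.ne' hd'.ne'] at hcv
      have h0 : (3 * B + 1 + f₂ a - f₁ a) * (M - f₁ a) * (f₂ b - f₂ b') = 0 := by linarith
      rcases mul_eq_zero.1 h0 with h0 | h0
      · rcases mul_eq_zero.1 h0 with h0 | h0 <;> linarith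
      · linarith
    obtain rfl := inj₂ b hb hb2 b' hb' hb2' hbb
    rw [hpe, hpe', hμ, hμ']

end Gluing
end PLWidth

namespace PLWidth

/-! ### Level sets of the glued function and the width inequality. -/

section Width

open Filter Topology

variable {E : Type*} [AddCommGroup E] [Module ℝ E] {n : ℕ}
  {L D D₁ D₂ : SimplicialComplex ℝ E} {s t : Finset E} {S : Finset (Finset E)}
  {f₁ f₂ : E → ℝ} {B M : ℝ} {x : E}

theorem FlatStructure.sum_le_vol_restrict {K : SimplicialComplex ℝ E} (F : FlatStructure n D)
    (hK : K ≤ D) {k : ℕ} {A : Set E} {T : Finset (Finset E)} (hT : ∀ s ∈ T, s ∈ K.faces) :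
    ∑ s ∈ T, μHE[k] (F.chart s '' (A ∩ openSimplex s)) ≤ (F.restrict hK).vol k A := by
  classical
  calc ∑ s ∈ T, μHE[k] (F.chart s '' (A ∩ openSimplex s))
      = ∑ s : T, μHE[k] (F.chart s '' (A ∩ openSimplex (s : Finset E))) :=
        (Finset.sum_coe_sort T fun s => μHE[k] (F.chart s '' (A ∩ openSimplex s))).symm
    _ = ∑' s : T, μHE[k] (F.chart s '' (A ∩ openSimplex (s : Finset E))) := (tsum_fintype _).symm
    _ ≤ _ := ENNReal.tsum_comp_le_tsum_of_injective
        (f := fun s : T => (⟨s, hT s s.2⟩ : K.faces))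
        (fun a b hab => Subtype.ext (congrArg (fun s : K.faces => (s : Finset E)) hab))
        fun s : K.faces => μHE[k] (F.chart s '' (A ∩ openSimplex (s : Finset E)))

theorem FlatStructure.vol_empty (F : FlatStructure n D) (k : ℕ) : F.vol k ∅ = 0 := by
  simp [FlatStructure.vol]

open scoped Classical in
/-- The level sets of the glued function consist of level sets of the two given functions, of
which only one is not empty, and of slices of the cones. -/
theorem Gluing.levelWidth_le (G : Gluing D D₁ D₂ L f₁ f₂ B) (F : FlatStructure n D)
    (hfin : D.faces.Finite) {m : Finset E → ℝ≥0∞}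
    (hm : ∀ t ∈ L.faces, carrierFace D t ∉ D₁.faces → ∀ c ≤ 4 * B + 1,
      μHE[n - 1] (F.chart (carrierFace D t) '' {x ∈ openSimplex t | leftExtension D₁ L f₁ M x = c}) ≤
        m t) :
    F.levelWidth (fun x => min (leftExtension D₁ L f₁ M x) (rightExtension D₂ L f₂ B x)) ≤
      max ((F.restrict G.left_le).levelWidth f₁) ((F.restrict G.right_le).levelWidth f₂) +
        ∑ t ∈ G.sub.finite.toFinset.filter (fun t => carrierFace D t ∉ D₁.faces), m t := by
  refine iSup_le fun c => ?_
  have hB := G.nonneg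
  set A : Set E := {x ∈ D.space | min (leftExtension D₁ L f₁ M x) (rightExtension D₂ L f₂ B x) = c}
    with hA
  set P := hfin.toFinset.filter (fun s => s ∈ D₁.faces) with hP
  set Q := hfin.toFinset.filter (fun s => s ∉ D₁.faces) with hQ
  set T := G.sub.finite.toFinset.filter (fun t => carrierFace D t ∉ D₁.faces) with hT
  set X : Finset E → Set E := fun t =>
    {x ∈ openSimplex t | leftExtension D₁ L f₁ M x = c ∧ c ≤ 4 * B + 1} with hX
  have hQD : ∀ s ∈ Q, s ∈ D.faces ∧ s ∉ D₁.faces := fun s hs => by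
    rwa [hQ, Finset.mem_filter, hfin.mem_toFinset] at hs
  have hTL : ∀ t ∈ T, t ∈ L.faces ∧ carrierFace D t ∉ D₁.faces := fun t ht => by
    rwa [hT, Finset.mem_filter, G.sub.finite.mem_toFinset] at ht
  have hleft : ∑ s ∈ P, μHE[n - 1] (F.chart s '' (A ∩ openSimplex s)) ≤
      (F.restrict G.left_le).vol (n - 1) {x ∈ D₁.space | f₁ x = c} := by
    refine le_trans (Finset.sum_le_sum fun s hs => measure_mono (Set.image_mono ?_))
      (F.sum_le_vol_restrict G.left_le (T := P) fun s hs => (Finset.mem_filter.1 hs).2)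
    rintro x ⟨⟨hxD, hxc⟩, hxs⟩
    have hx1 : x ∈ D₁.space :=
      SimplicialComplex.convexHull_subset_space (Finset.mem_filter.1 hs).2 hxs.1
    rw [min_eq_left (G.left_lt_right hx1).le, G.left_eq hx1] at hxc
    exact ⟨⟨hx1, hxc⟩, hxs⟩
  have hright : ∑ s ∈ Q, μHE[n - 1] (F.chart s '' (A ∩ openSimplex s)) ≤
      (F.restrict G.right_le).vol (n - 1) {x ∈ D₂.space | f₂ x = c - (3 * B + 1)} +
        ∑ t ∈ T, m t := by
    have h1 : ∀ s ∈ Q, μHE[n - 1] (F.chart s '' (A ∩ openSimplex s)) ≤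
        μHE[n - 1] (F.chart s '' ({x ∈ D₂.space | f₂ x = c - (3 * B + 1)} ∩ openSimplex s)) +
        ∑ t ∈ T.filter (fun t => carrierFace D t = s),
          μHE[n - 1] (F.chart (carrierFace D t) '' X t) := by
      intro s hs
      obtain ⟨hsD, hs1⟩ := hQD s hs
      rw [Finset.sum_congr rfl fun t ht => by rw [(Finset.mem_filter.1 ht).2]]
      refine le_trans (measure_mono ?_) ((measure_union_le _ _).trans
        (add_le_add_right (measure_biUnion_finset_le (T.filter fun t => carrierFace D t = s)
          fun t => F.chart s '' X t) _))
      rintro _ ⟨x, ⟨⟨hxD, hxc⟩, hxs⟩, rfl⟩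
      -- Where the cone is lower, the level is bounded by the right extension, hence by `4 * B + 1`,
      -- as the slice estimate requires; where it is higher, the point is on a level set of `f₂`.
      rcases le_total (leftExtension D₁ L f₁ M x) (rightExtension D₂ L f₂ B x) with h | h
      · right
        rw [min_eq_left h] at hxc
        obtain ⟨t, ht, hts, hxt⟩ := G.sub.exists_openSimplex hsD hxs
        refine Set.mem_iUnion₂.2 ⟨t, Finset.mem_filter.2 ⟨Finset.mem_filter.2
          ⟨G.sub.finite.mem_toFinset.2 ht, hts ▸ hs1⟩, hts⟩, x, ⟨hxt, hxc, ?_⟩, rfl⟩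
        exact hxc ▸ h.trans (G.rightExtension_mem hxD).2
      · left
        have hx2 : x ∈ D₂.space := SimplicialComplex.convexHull_subset_space
          ((G.cover s hsD).resolve_left hs1) hxs.1
        rw [min_eq_right h, G.right_eq hx2] at hxc
        exact ⟨x, ⟨⟨hx2, by linarith⟩, hxs⟩, rfl⟩
    refine (Finset.sum_le_sum h1).trans ?_
    rw [Finset.sum_add_distrib, Finset.sum_fiberwise_of_maps_to (g := carrierFace D) fun t ht =>
      Finset.mem_filter.2 ⟨hfin.mem_toFinset.2 (G.sub.carrierFace_mem (hTL t ht).1), (hTL t ht).2⟩]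
    refine add_le_add (F.sum_le_vol_restrict G.right_le fun s hs =>
      (G.cover s (hQD s hs).1).resolve_left (hQD s hs).2) (Finset.sum_le_sum fun t ht => ?_)
    by_cases hc : c ≤ 4 * B + 1
    · refine le_trans (measure_mono (Set.image_mono ?_)) (hm t (hTL t ht).1 (hTL t ht).2 c hc)
      exact fun x hx => ⟨hx.1, hx.2.1⟩
    · have : X t = ∅ := Set.eq_empty_of_forall_notMem fun x hx => hc hx.2.2
      simp [this]
  rw [F.vol_eq_sum hfin, ← Finset.sum_filter_add_sum_filter_not _ (fun s => s ∈ D₁.faces)]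
  refine (add_le_add hleft hright).trans ?_
  rw [← add_assoc]
  refine add_le_add ?_ le_rfl
  -- The level `B` separates the two ranges.
  rcases le_or_gt c B with hc | hc
  · have : {x ∈ D₂.space | f₂ x = c - (3 * B + 1)} = ∅ := by
      refine Set.eq_empty_of_forall_notMem fun x hx => ?_
      have := G.right_lower hx.1
      rw [hx.2] at this
      linarith
    rw [this, FlatStructure.vol_empty, add_zero]
    exact (le_iSup (fun c => (F.restrict G.left_le).vol (n - 1) {x ∈ D₁.space | f₁ x = c}) c).trans
      (le_max_left _ _)
  · have : {x ∈ D₁.space | f₁ x = c} = ∅ := by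
      refine Set.eq_empty_of_forall_notMem fun x hx => ?_
      have := G.left_le_bound hx.1
      rw [hx.2] at this
      linarith
    rw [this, FlatStructure.vol_empty, zero_add]
    exact (le_iSup (fun c => (F.restrict G.right_le).vol (n - 1) {x ∈ D₂.space | f₂ x = c})
      (c - (3 * B + 1))).trans (le_max_right _ _)

theorem FlatStructure.width_le_levelWidth (F : FlatStructure n D) (hL : IsSubdivision L D)
    {f : E → ℝ} (hf : IsPLMorse L f) : F.width ≤ F.levelWidth f :=
  iInf₂_le_of_le L hL (iInf₂_le_of_le f hf le_rfl)

theorem FlatStructure.exists_levelWidth_lt (F : FlatStructure n D) {c : ℝ≥0∞} (h : F.width < c) :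
    ∃ L, IsSubdivision L D ∧ ∃ f, IsPLMorse L f ∧ F.levelWidth f < c := by
  simpa [FlatStructure.width, iInf_lt_iff] using h

theorem Gluing.width_le (G : Gluing D D₁ D₂ L f₁ f₂ B) [NeZero n] (F : FlatStructure n D)
    (hfin : D.faces.Finite) (h : Decomposes n D D₁ D₂ S)
    (hcof : ∀ a : Finset E, a.card = n → ∀ T : Finset (Finset E),
      (∀ t ∈ T, t ∈ L.faces ∧ t.card = n + 1 ∧ a ⊆ t) → T.card ≤ 2) :
    F.width ≤ max ((F.restrict G.left_le).levelWidth f₁) ((F.restrict G.right_le).levelWidth f₂) +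
      2 * F.chainVol S := by
  classical
  refine ENNReal.le_of_forall_pos_le_add fun ε hε _ => ?_
  have hB := G.nonneg
  -- Each simplex may contribute an error `ε / N`; the extra one keeps `N` nonzero.
  set N : ℝ≥0∞ := (G.sub.finite.toFinset.card : ℝ≥0∞) + 1 with hN
  have hN0 : N ≠ 0 := by simp [hN]
  have hNt : N ≠ ∞ := by simp [hN]
  have hη0 : (ε : ℝ≥0∞) / N ≠ 0 := ENNReal.div_ne_zero.2 ⟨by exact_mod_cast hε.ne', hNt⟩
  have hηt : (ε : ℝ≥0∞) / N ≠ ∞ := ENNReal.div_ne_top ENNReal.coe_ne_top hN0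
  set α : Finset E → Finset E := fun t => t.filter fun v => v ∈ D₁.space with hα
  have hslice : ∀ᶠ M : ℝ in atTop, ∀ t ∈ L.faces, carrierFace D t ∉ D₁.faces → ∀ c ≤ 4 * B + 1,
      μHE[n - 1] (F.chart (carrierFace D t) ''
        {x ∈ openSimplex t | leftExtension D₁ L f₁ M x = c}) ≤
      μHE[n - 1] (F.chart (carrierFace D t) '' convexHull ℝ (α t : Set E)) + ε / N := by
    refine (eventually_all_finite G.sub.finite).2 fun t ht => ?_
    by_cases hc : carrierFace D t ∈ D₁.faces
    · exact Eventually.of_forall fun _ h => absurd hc h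
    have hss : α t ⊂ t := by
      refine Finset.ssubset_iff_subset_ne.2 ⟨Finset.filter_subset _ _, fun heq => ?_⟩
      refine hc (G.left_full t ht fun v hv => ?_)
      rw [← heq] at hv
      exact (Finset.mem_filter.1 hv).2
    filter_upwards [F.eventually_slice_le (G.sub.carrierFace_mem ht) (L.indep ht)
      (G.sub.convexHull_subset_carrierFace ht) hss (B := 4 * B + 1) (by linarith) hη0 hηt]
      with M hM _ c hcB
    refine hM (extendBy D₁.space f₁ M) (fun v hv => ?_) (fun v hv hva => ?_) c hcB _ fun x hx => ?_
    · obtain ⟨hvt, hv1⟩ := Finset.mem_filter.1 hv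
      rw [extendBy_of_mem hv1]
      linarith [G.left_bound v (mem_vertices_of_mem ht hvt) hv1]
    · exact extendBy_of_notMem fun h => hva (Finset.mem_filter.2 ⟨hv, h⟩)
    · refine ⟨coord L x, isBary_coord ht hx.1.1, ?_⟩
      rw [← hx.2, leftExtension, interp_eq _ ht hx.1.1]
      rfl
  obtain ⟨M, ⟨L', hL', hf⟩, hM⟩ := (G.eventually_isPLMorse.and hslice).exists
  refine (F.width_le_levelWidth hL' hf).trans ((G.levelWidth_le F hfin hM).trans ?_)
  rw [add_assoc]
  refine add_le_add le_rfl ?_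
  rw [Finset.sum_add_distrib]
  refine add_le_add ?_ ?_
  · convert F.sum_slices_le h G.sub G.left_full hcof
  · rw [Finset.sum_const, nsmul_eq_mul]
    calc _ ≤ N * (ε / N) := by
          refine mul_le_mul_left ?_ _
          refine le_trans ?_ le_self_add
          exact_mod_cast Finset.card_filter_le _ _
      _ = ε := ENNReal.mul_div_cancel hN0 hNt

end Width

/-- Nearly optimal functions are perturbed to a common refinement and glued; optimality and
perturbation each cost `ε / 2`. The constant is `2` in every dimension. -/
theorem Decomposes.width_le {E : Type*} [NormedAddCommGroup E] [NormedSpace ℝ E]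
    {n : ℕ} [NeZero n] {D : SimplicialComplex ℝ E} (hfin : D.faces.Finite) (F : FlatStructure n D)
    {M : Type*} [TopologicalSpace M] [ChartedSpace (EuclideanHalfSpace n) M] (e : D.space ≃ₜ M)
    {D₁ D₂ : SimplicialComplex ℝ E} {S : Finset (Finset E)} (h : Decomposes n D D₁ D₂ S) :
    F.width ≤ max (F.restrict h.left_le).width (F.restrict h.right_le).width +
      2 * F.chainVol S := by
  classical
  refine ENNReal.le_of_forall_pos_le_add fun ε hε hlt => ?_
  set W := max (F.restrict h.left_le).width (F.restrict h.right_le).width with hW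
  have hWt : W < ∞ := lt_of_le_of_lt le_self_add hlt
  have hε0 : (ε / 2 : ℝ≥0∞) ≠ 0 := by simpa using hε.ne'
  have hWε : W < W + ε / 2 := ENNReal.lt_add_right hWt.ne hε0
  obtain ⟨L₁, hL₁, f₁, hf₁, hlt₁⟩ :=
    (F.restrict h.left_le).exists_levelWidth_lt ((le_max_left _ _).trans_lt hWε)
  obtain ⟨L₂, hL₂, f₂, hf₂, hlt₂⟩ :=
    (F.restrict h.right_le).exists_levelWidth_lt ((le_max_right _ _).trans_lt hWε)
  have hspace : ∀ {K K' : SimplicialComplex ℝ E}, K' ≤ D → IsSubdivision K K' →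
      ∀ s ∈ K.faces, (s : Set E) ⊆ D.space := by
    intro K K' hK' hK s hs v hv
    obtain ⟨t, ht, hst⟩ := hK.subset s hs
    exact SimplicialComplex.convexHull_subset_space (hK' ht) (hst (subset_convexHull ℝ _ hv))
  -- Being adapted to the simplices of both `L₁` and `L₂`, the parts of `L` over `D₁` and `D₂`
  -- subdivide them; the order of the coordinates makes `D₁` full.
  obtain ⟨L, hL, hord, hadapt⟩ := exists_refinement hfin (P := L₁.faces ∪ L₂.faces)
    (hL₁.finite.union hL₂.finite) (fun s hs => hs.elim (fun h => L₁.indep h) fun h => L₂.indep h)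
    (fun s hs => hs.elim (hspace h.left_le hL₁ s) (hspace h.right_le hL₂ s))
  have hs₁ := hL.subdivisionOf_of_adapted h.left_le hL₁ fun s hs => hadapt s (Or.inl hs)
  have hs₂ := hL.subdivisionOf_of_adapted h.right_le hL₂ fun s hs => hadapt s (Or.inr hs)
  obtain ⟨g₁, hg₁, hgW₁⟩ := hf₁.exists_perturbation (F.restrict h.left_le)
    (hfin.subset fun s hs => h.left_le hs) hL₁ hs₁ hε0 hlt₁.ne_top
  obtain ⟨g₂, hg₂, hgW₂⟩ := hf₂.exists_perturbation (F.restrict h.right_le)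
    (hfin.subset fun s hs => h.right_le hs) hL₂ hs₂ hε0 hlt₂.ne_top
  obtain ⟨B₁, hB₁⟩ := ((finite_vertices hL.finite).image fun v => |g₁ v|).bddAbove
  obtain ⟨B₂, hB₂⟩ := ((finite_vertices hL.finite).image fun v => |g₂ v|).bddAbove
  have G : Gluing D D₁ D₂ L g₁ g₂ (max 0 (max B₁ B₂)) :=
    { sub := hL
      left_le := h.left_le
      right_le := h.right_le
      cover := h.cover
      left_full := fun t ht hv => hL.carrierFace_mem_of_vertices h.left_le hord ht hv
      left_morse := hg₁
      right_morse := hg₂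
      nonneg := le_max_left _ _
      left_bound := fun v hv _ => (hB₁ (Set.mem_image_of_mem _ hv)).trans
        ((le_max_left _ _).trans (le_max_right _ _))
      right_bound := fun v hv _ => (hB₂ (Set.mem_image_of_mem _ hv)).trans
        ((le_max_right _ _).trans (le_max_right _ _)) }
  have hcof : ∀ a : Finset E, a.card = n → ∀ T : Finset (Finset E),
      (∀ t ∈ T, t ∈ L.faces ∧ t.card = n + 1 ∧ a ⊆ t) → T.card ≤ 2 := fun a ha T hT =>
    -- The bound is needed for `L`, which triangulates the same manifold as `D`.
    card_cofaces_le_two ((Homeomorph.setCongr hL.space_eq).trans e) ha T hT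
  refine (G.width_le F hfin h hcof).trans ?_
  rw [add_right_comm]
  refine add_le_add (max_le ?_ ?_) le_rfl
  · calc _ ≤ W + ε / 2 + ε / 2 := hgW₁.trans (add_le_add hlt₁.le le_rfl)
      _ = W + ε := by rw [add_assoc, ENNReal.add_halves]
  · calc _ ≤ W + ε / 2 + ε / 2 := hgW₂.trans (add_le_add hlt₂.le le_rfl)
      _ = W + ε := by rw [add_assoc, ENNReal.add_halves]

end PLWidth

theorem mainTheorem7 {E : Type*} [NormedAddCommGroup E] [NormedSpace ℝ E]
    (n : ℕ) [NeZero n]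
    (D : SimplicialComplex ℝ E) (hfin : D.faces.Finite) (F : PLWidth.FlatStructure n D)
    {M : Type*} [TopologicalSpace M] [T2Space M] [CompactSpace M]
    [ChartedSpace (EuclideanHalfSpace n) M] (e : D.space ≃ₜ M)
    (D₁ D₂ : SimplicialComplex ℝ E) (S : Finset (Finset E))
    (h : PLWidth.Decomposes n D D₁ D₂ S) :
    F.width ≤ max (F.restrict h.left_le).width (F.restrict h.right_le).width
      + 2 * (n : ℝ≥0∞) * F.chainVol S := by
  -- The constant `2` is weakened to `2 * n`, using `1 ≤ n`.
  refine (h.width_le hfin F e).trans (add_le_add le_rfl ?_)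
  have hn : (1 : ℝ≥0∞) ≤ n := Nat.one_le_cast.2 (Nat.one_le_iff_ne_zero.2 (NeZero.ne n))
  calc 2 * F.chainVol S = 2 * 1 * F.chainVol S := by rw [mul_one]
    _ ≤ 2 * n * F.chainVol S := by gcongr
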